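/- Let $z_1,z_2>0$. **TASEP.** For $n\ge 1$ consider the totally asymmetric exclusion process on the sites $1,\dots,n$ with configurations $(\tau_1,\dots,\tau_n)\in\{0,1\}^n$: a particle enters the empty site $1$ at rate $\alpha=z_1$, hops to an empty right neighbour at rate $1$, and leaves the occupied site $n$ at rate $\beta=z_2$. Let $\langle\cdot\rangle_n$ on functions of $\tau$ denote expectation in its stationary distribution. **One-transit walks.** Consider paths from $(0,0)$ to $(2n,0)$ with steps $(1,\pm1)$ that, for some $c\in\{0,\dots,2n\}$, stay weakly above the $x$-axis up to $c$ and weakly below it from $c$ on (the number $c$ is then unique; $c=0$ and $c=2n$ are allowed). A down step has weight $z_1$ and an up step weight $z_2$, except that steps ending on the axis have weight $1$. Let $Z_n$ be the sum of the weights of all such paths ($Z_0=1$) and $\tilde Z_n=(z_1z_2)^{-n}Z_n$. Let $\langle\hat a_i\rangle_n$ (respectively $\langle\hat b_i\rangle_n$) be the probability, under the normalised weights, that the path is on the axis at $2i$ and $2i\le c$ (respectively $2i\ge c$), for $0\le i\le n$. Put $J_n=\tilde Z_{n-1}/\tilde Z_n$ for $n\ge1$, and let $C_p=\frac1{p+1}\binom{2p}{p}$.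 **Claim.** 1. For every $n\ge1$ the TASEP has exactly one stationary distribution, and $J_n$ is its mean current through each of its $n+1$ bonds: $J_n=\alpha\langle 1-\tau_1\rangle_n=\langle\tau_i(1-\tau_{i+1})\rangle_n=\beta\langle\tau_n\rangle_n$ for $1\le i<n$. 2. For all $1\le i\le n$, $$\langle\tau_i\rangle_n=\sum_{p=0}^{n-i-1}C_p\prod_{j=0}^pJ_{n-j}+\frac1{z_2}J_n\langle\hat b_{i-1}\rangle_{n-1},$$ $$\langle\tau_i\rangle_n=1-\sum_{p=0}^{i-2}C_p\prod_{j=0}^pJ_{n-j}-\frac1{z_1}J_n\langle\hat a_{i-1}\rangle_{n-1},$$ $$\langle\tau_i\rangle_n=\frac12\left[1+\sum_{p=i-1}^{n-i-1}C_p\prod_{j=0}^pJ_{n-j}+J_n\left(\frac1{z_2}\langle\hat b_{i-1}\rangle_{n-1}-\frac1{z_1}\langle\hat a_{i-1}\rangle_{n-1}\right)\right],$$ with the convention $\sum_{p=r}^{s}=-\sum_{p=s+1}^{r-1}$ for $s<r-1$ (and $\sum_{p=r}^{r-1}=0$). 3. If $0<x<1$ and $i_n/n\to x$, then $\sum_{p=i_n-1}^{n-i_n-1}C_p\prod_{j=0}^pJ_{n-j}\to0$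 as $n\to\infty$. 4. As $n\to\infty$, $\frac1n\sum_{i=1}^n\langle\hat a_i\rangle_n\to a$ and $\frac1n\sum_{i=1}^n\langle\hat b_i\rangle_n\to b$, where, with $r(z)=\frac{1-2z}{1-z}$, $$(a,b)=\begin{cases}(0,0)& z_1,z_2\ge\frac12,\\ (r(z_1),0)& z_1<\frac12,\ z_2>z_1,\\ (0,r(z_2))& z_2<\frac12,\ z_1>z_2,\\ (\tfrac12r(z),\tfrac12r(z))& z_1=z_2=z<\frac12.\end{cases}$$ The limits $J=\lim_nJ_n>0$ and $\rho=\lim_n\frac1n\sum_{i=1}^n\langle\tau_i\rangle_n$ exist. Unless $z_1=z_2<\frac12$, one has moreover $\langle\tau_{i_n}\rangle_n\to\rho$ whenever $i_n/n\to x$ with $0<x<1$. In all cases $$\frac{2\rho-1}{J}=\frac b{z_2}-\frac a{z_1}.$$ -/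

import Mathlib

noncomputable section

namespace OneTransit

/-! ### The one-transit walk (OTW) model -/

/-- Height after `k` steps of the path with `2n` steps `s` (`true` = north-east step,
`false` = south-east step), started at height `0`. -/
def height {n : ℕ} (s : Fin (2 * n) → Bool) (k : ℕ) : ℤ :=
  ∑ j : Fin (2 * n), if j.val < k then (if s j then 1 else -1) else 0

/-- One-transit walks from `(0,0)` to `(2n,0)`: for some `c` the path is weakly above the axis
up to `c` and weakly below the axis from `c` on.  The transit may take place at either end, so
that a path entirely above (or entirely below) the axis is allowed. -/
def IsOneTransit {n : ℕ} (s : Fin (2 * n) → Bool) : Prop :=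
  height s (2 * n) = 0 ∧
    ∃ c, c ≤ 2 * n ∧ (∀ k, k ≤ c → 0 ≤ height s k) ∧
      (∀ k, c ≤ k → k ≤ 2 * n → height s k ≤ 0)

/-- Boltzmann weight: `z₁` for each down step and `z₂` for each up step, except those that end
on the axis, which have weight `1`. -/
def weight (z₁ z₂ : ℝ) {n : ℕ} (s : Fin (2 * n) → Bool) : ℝ :=
  ∏ j : Fin (2 * n), if height s (j.val + 1) = 0 then 1 else if s j then z₂ else z₁

open Classical in
/-- Partition function `Z_n(z₁,z₂)` of the OTW model. -/
def Z (z₁ z₂ : ℝ) (n : ℕ) : ℝ :=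
  ∑ s : Fin (2 * n) → Bool, if IsOneTransit s then weight z₁ z₂ s else 0

/-- Reduced partition function `Z̃_n(z₁,z₂)`, where `Z_n = (z₁ z₂)^n Z̃_n`. -/
def Zt (z₁ z₂ : ℝ) (n : ℕ) : ℝ := Z z₁ z₂ n / (z₁ * z₂) ^ n

/-- The path touches the axis at `2i` and this point belongs to its upper part. -/
def ContactAbove {n : ℕ} (s : Fin (2 * n) → Bool) (i : ℕ) : Prop :=
  height s (2 * i) = 0 ∧ ∀ k, k ≤ 2 * i → 0 ≤ height s k

/-- The path touches the axis at `2i` and this point belongs to its lower part. -/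
def ContactBelow {n : ℕ} (s : Fin (2 * n) → Bool) (i : ℕ) : Prop :=
  height s (2 * i) = 0 ∧ ∀ k, 2 * i ≤ k → k ≤ 2 * n → height s k ≤ 0

open Classical in
/-- `⟨â_i⟩_n`: the probability of a contact at site `2i` above the axis. -/
def aExp (z₁ z₂ : ℝ) (n i : ℕ) : ℝ :=
  (∑ s : Fin (2 * n) → Bool,
    if IsOneTransit s ∧ ContactAbove s i then weight z₁ z₂ s else 0) / Z z₁ z₂ n

open Classical in
/-- `⟨b̂_i⟩_n`: the probability of a contact at site `2i` below the axis. -/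
def bExp (z₁ z₂ : ℝ) (n i : ℕ) : ℝ :=
  (∑ s : Fin (2 * n) → Bool,
    if IsOneTransit s ∧ ContactBelow s i then weight z₁ z₂ s else 0) / Z z₁ z₂ n

/-- `ρ(z) = (1 - 2z)/(1 - z)`. -/
def contactRho (z : ℝ) : ℝ := (1 - 2 * z) / (1 - z)

/-- The contact density `a` in the phase diagram. -/
def aDens (z₁ z₂ : ℝ) : ℝ :=
  if 1 / 2 ≤ z₁ ∧ 1 / 2 ≤ z₂ then 0
  else if z₁ < z₂ then contactRho z₁
  else if z₂ < z₁ then 0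
  else contactRho z₁ / 2

/-- The contact density `b` in the phase diagram. -/
def bDens (z₁ z₂ : ℝ) : ℝ :=
  if 1 / 2 ≤ z₁ ∧ 1 / 2 ≤ z₂ then 0
  else if z₁ < z₂ then 0
  else if z₂ < z₁ then contactRho z₂
  else contactRho z₂ / 2

/-- The finite-size current `J_n = Z̃_{n-1}/Z̃_n` (for `n ≥ 1`). -/
def J (z₁ z₂ : ℝ) (n : ℕ) : ℝ := Zt z₁ z₂ (n - 1) / Zt z₁ z₂ n

/-! ### The open TASEP on the sites `1, …, n` (site `i` is the element `i - 1` of `Fin n`) -/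

/-- Transition rate from `η` to `η'`: a particle enters the empty first site with rate `α`,
leaves the occupied last site with rate `β`, and hops to an empty right neighbour with
rate `1`. -/
def rate (α β : ℝ) {n : ℕ} (η η' : Fin n → Bool) : ℝ :=
  (∑ k : Fin n,
    if k.val = 0 ∧ η k = false ∧ η' = Function.update η k true then α else 0) +
  (∑ k : Fin n,
    if k.val + 1 = n ∧ η k = true ∧ η' = Function.update η k false then β else 0) +
  ∑ k : Fin n, ∑ l : Fin n,
    if l.val = k.val + 1 ∧ η k = true ∧ η l = false ∧
        η' = Function.update (Function.update η k false) l true then 1 else 0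

/-- `p` is a stationary probability distribution of the master equation. -/
def IsStationary (α β : ℝ) {n : ℕ} (p : (Fin n → Bool) → ℝ) : Prop :=
  (∀ η, 0 ≤ p η) ∧ ∑ η, p η = 1 ∧
    ∀ η, ∑ η', (rate α β η' η * p η' - rate α β η η' * p η) = 0

/-- Occupation number `τ_i ∈ {0,1}` of the site `i`, `1 ≤ i ≤ n`. -/
def occ {n : ℕ} (η : Fin n → Bool) (i : ℕ) : ℝ :=
  if ∃ k : Fin n, k.val + 1 = i ∧ η k = true then 1 else 0

/-- Mean occupation `⟨τ_i⟩` under `p`. -/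
def dens {n : ℕ} (p : (Fin n → Bool) → ℝ) (i : ℕ) : ℝ := ∑ η, p η * occ η i

/-- Mean particle current across the bond `(i, i+1)`, `0 ≤ i ≤ n`, where the bonds `0` and `n`
connect the system to the left and the right reservoir. -/
def bondCurrent (α β : ℝ) {n : ℕ} (p : (Fin n → Bool) → ℝ) (i : ℕ) : ℝ :=
  if i = 0 then ∑ η, p η * (α * (1 - occ η 1))
  else if i = n then ∑ η, p η * (β * occ η n)
  else ∑ η, p η * (occ η i * (1 - occ η (i + 1)))

/-- The term `C_p ∏_{j=0}^{p} J_{n-j}`. -/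
def catTerm (z₁ z₂ : ℝ) (n p : ℕ) : ℝ :=
  (catalan p : ℝ) * ∏ j ∈ Finset.range (p + 1), J z₁ z₂ (n - j)

/-- `∑_{p=i-1}^{n-i-1} C_p ∏_{j=0}^{p} J_{n-j}`, with the usual convention
`∑_{p=r}^{s} = -∑_{p=s+1}^{r-1}` when `s < r - 1`.  At least one of the two sums is empty. -/
def signedSum (z₁ z₂ : ℝ) (n i : ℕ) : ℝ :=
  ∑ p ∈ Finset.Ico (i - 1) (n - i), catTerm z₁ z₂ n p -
    ∑ p ∈ Finset.Ico (n - i) (i - 1), catTerm z₁ z₂ n p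

end OneTransit

end

noncomputable section

open PowerSeries

namespace OneTransit

/-! ### Generating functions -/

/-! Both models are governed by the same generating functions. With `c` the Catalan series, Dyck
paths weighted by `1/z` per return to the axis have generating function `G_z = 1/(1 - X c/z)`, with
coefficients `dyckSum`. Cutting a one-transit walk at its unique transit makes the reduced partition
function the coefficient `transitSum` of `G_{z₁} G_{z₂}`. Cutting it at a contact gives the contact
probabilities as `dyckSum * transitSum / transitSum` (`aExp_eq`, `bExp_eq`).

On the TASEP side the matrix ansatz is realised on polynomials: `E` is multiplication by `X`, the
right vector is `1`, the left vector is evaluation at `α⁻¹`, and `D` is determined by `D 1 = β⁻¹`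
and `D E = D + E`. A telescoping cancellation makes the matrix products stationary
(`master_wordWeight`), and a minimum principle on the irreducible chain gives uniqueness
(`eq_matrixMeasure`). Normal ordering `D C^m` from the right and `C^m E` from the left, with `C = D
+ E`, produces Catalan convolutions and boundary terms containing `dyckSum` (`apply_opD_pow`,
`eval_pow_opE`). Hence the normalisation is `transitSum` (`eval_opC_pow`), the bond relation `D E =
C` gives the current, and the two orderings give the first two density formulas. The third formula
is their half sum.

For the limits, suitable `x > 0` make `x^n * transitSum n` subexponential (`exists_regular`). If the
smaller parameter is `z < 1/2`, then `x = z(1-z)`, and the rescaled sequence converges off the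
diagonal and grows linearly on it. Otherwise `x = 1/4`, and the rescaled sequence behaves like a
constant, like `binom(2n,n)/4^n` or like `C_n/4^n`, according to how many parameters equal `1/2`.
The value `x` is the limiting current. The Catalan sum in the bulk is dominated by a tail of the
convergent series `∑ C_k x^k`, so it vanishes (`tendsto_signedSum`). The contact probability
converges as both lengths grow, except on the coexistence line, where only its average does, because
the transit point is asymptotically uniform there. The signed Catalan sums cancel exactly when
summed over all sites, so the mean density and the final relation follow in every phase. -/

/-- Generating function of the Catalan numbers. -/
def catGF : ℝ⟦X⟧ := PowerSeries.mk fun n => (catalan n : ℝ)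

/-- Generating function of Dyck paths with weight `1 / z` for each return to the axis. -/
def contactGF (z : ℝ) : ℝ⟦X⟧ := (1 - C z⁻¹ * (X * catGF))⁻¹

/-- Reduced weight of the excursions above the axis of length `2 n`. -/
def dyckSum (z : ℝ) (n : ℕ) : ℝ := coeff n (contactGF z)

/-- Reduced weight of the one-transit walks of length `2 n`, as a coefficient. -/
def transitSum (z₁ z₂ : ℝ) (n : ℕ) : ℝ := coeff n (contactGF z₁ * contactGF z₂)

@[simp] lemma coeff_catGF (n : ℕ) : coeff n catGF = (catalan n : ℝ) := by simp [catGF]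

lemma catGF_eq : catGF = 1 + X * catGF ^ 2 := by
  have h := congrArg (PowerSeries.map (Nat.castRingHom ℝ)) catalanSeries_sq_mul_X_add_one
  have hc : PowerSeries.map (Nat.castRingHom ℝ) catalanSeries = catGF := by
    ext n; simp
  rw [map_add, map_mul, map_pow, hc, map_one, PowerSeries.map_X] at h
  linear_combination -h

lemma contactGF_mul (z : ℝ) : contactGF z * (1 - C z⁻¹ * (X * catGF)) = 1 :=
  PowerSeries.inv_mul_cancel _ (by simp)

lemma catGF_ne_zero : catGF ≠ 0 := by
  intro h
  have := coeff_catGF 0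
  simp [h] at this

lemma contactGF_succ (z : ℝ) : contactGF z = 1 + X * (C z⁻¹ * (catGF * contactGF z)) := by
  linear_combination contactGF_mul z

/-- This form mirrors the normal ordering of one more matrix factor: a boundary term plus a Catalan
convolution without its constant part. It is what `reduction_step` consumes. -/
lemma contactGF_rec (z : ℝ) :
    contactGF z = 1 + X * (C z⁻¹ * contactGF z + catGF * (contactGF z - 1)) := by
  linear_combination contactGF_mul z * (1 - X * catGF) +
    C z⁻¹ * X * contactGF z * catGF_eq

/-- This is the recursion satisfied by the matrix product normalisation. The three terms come from
`E` meeting the left vector, from the bulk reduction of `D C^n`, and from `D` meeting the right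
vector. -/
lemma contactGF_mul_rec (z₁ z₂ : ℝ) :
    contactGF z₁ * contactGF z₂ = 1 + X * (C z₁⁻¹ * (contactGF z₁ * contactGF z₂) +
      catGF * (contactGF z₁ * contactGF z₂ - 1) + C z₂⁻¹ * contactGF z₂) := by
  refine mul_left_cancel₀ catGF_ne_zero ?_
  linear_combination contactGF_mul z₁ * contactGF z₂ + contactGF_mul z₂ +
    (contactGF z₁ * contactGF z₂ - 1) * catGF_eq

lemma coeff_catGF_mul_sub_one {F : ℝ⟦X⟧} (hF : coeff 0 F = 1) (n : ℕ) :
    coeff n (catGF * (F - 1)) = ∑ p ∈ Finset.range n, (catalan p : ℝ) * coeff (n - p) F := by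
  rw [coeff_mul, Finset.Nat.sum_antidiagonal_eq_sum_range_succ_mk, Finset.sum_range_succ]
  simp only [Nat.sub_self, map_sub, hF, coeff_catGF]
  simp only [coeff_zero_eq_constantCoeff, map_one, sub_self, mul_zero, add_zero]
  refine Finset.sum_congr rfl fun p hp => ?_
  rw [coeff_one, if_neg (by have := Finset.mem_range.1 hp; omega), sub_zero]

@[simp] lemma dyckSum_zero (z : ℝ) : dyckSum z 0 = 1 := by
  rw [dyckSum, contactGF_succ]; simp

@[simp] lemma transitSum_zero (z₁ z₂ : ℝ) : transitSum z₁ z₂ 0 = 1 := by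
  rw [transitSum, contactGF_mul_rec]; simp

lemma transitSum_comm (z₁ z₂ : ℝ) (n : ℕ) : transitSum z₁ z₂ n = transitSum z₂ z₁ n := by
  rw [transitSum, mul_comm, transitSum]

lemma transitSum_eq_sum (z₁ z₂ : ℝ) (n : ℕ) :
    transitSum z₁ z₂ n = ∑ k ∈ Finset.range (n + 1), dyckSum z₁ k * dyckSum z₂ (n - k) := by
  rw [transitSum, coeff_mul, Finset.Nat.sum_antidiagonal_eq_sum_range_succ_mk]; rfl

lemma dyckSum_succ (z : ℝ) (n : ℕ) :
    dyckSum z (n + 1) = z⁻¹ * ∑ p ∈ Finset.range (n + 1), (catalan p : ℝ) * dyckSum z (n - p) := by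
  rw [dyckSum, contactGF_succ, map_add, coeff_succ_X_mul, coeff_C_mul, coeff_mul,
    Finset.Nat.sum_antidiagonal_eq_sum_range_succ_mk, coeff_one, if_neg (by omega), zero_add]
  simp [dyckSum]

lemma dyckSum_succ' (z : ℝ) (n : ℕ) :
    dyckSum z (n + 1) = z⁻¹ * dyckSum z n +
      ∑ p ∈ Finset.range n, (catalan p : ℝ) * dyckSum z (n - p) := by
  rw [dyckSum, contactGF_rec, map_add, coeff_succ_X_mul, map_add, coeff_C_mul,
    coeff_catGF_mul_sub_one (dyckSum_zero z), coeff_one, if_neg (by omega), zero_add]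
  rfl

lemma transitSum_succ (z₁ z₂ : ℝ) (n : ℕ) :
    transitSum z₁ z₂ (n + 1) = z₁⁻¹ * transitSum z₁ z₂ n +
      ∑ p ∈ Finset.range n, (catalan p : ℝ) * transitSum z₁ z₂ (n - p) +
        z₂⁻¹ * dyckSum z₂ n := by
  rw [transitSum, contactGF_mul_rec, map_add, coeff_succ_X_mul, map_add, map_add, coeff_C_mul,
    coeff_C_mul, coeff_catGF_mul_sub_one (transitSum_zero z₁ z₂), coeff_one, if_neg (by omega),
    zero_add]
  rfl

/-! ### Positivity and monotonicity of the weights -/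

lemma catalan_pos (n : ℕ) : 0 < catalan n := by
  have h := _root_.succ_mul_catalan_eq_centralBinom n
  have := n.centralBinom_pos
  rw [← h] at this
  exact Nat.pos_of_mul_pos_left this

lemma dyckSum_pos {z : ℝ} (hz : 0 < z) (n : ℕ) : 0 < dyckSum z n := by
  induction n using Nat.strong_induction_on with
  | _ n ih =>
    rcases n with _ | n
    · simp
    · rw [dyckSum_succ]
      refine mul_pos (inv_pos.2 hz) (Finset.sum_pos (fun p _ => mul_pos ?_ (ih _ (by omega)))
        ⟨0, by simp⟩)
      exact_mod_cast catalan_pos p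

lemma dyckSum_anti {z z' : ℝ} (hz : 0 < z) (h : z ≤ z') (n : ℕ) : dyckSum z' n ≤ dyckSum z n := by
  induction n using Nat.strong_induction_on with
  | _ n ih =>
    rcases n with _ | n
    · simp
    · rw [dyckSum_succ, dyckSum_succ]
      refine mul_le_mul (inv_anti₀ hz h) (Finset.sum_le_sum fun p _ =>
        mul_le_mul_of_nonneg_left (ih _ (by omega)) (by positivity)) ?_ (inv_pos.2 hz).le
      exact Finset.sum_nonneg fun p _ =>
        mul_nonneg (by positivity) (dyckSum_pos (hz.trans_le h) _).le

lemma transitSum_pos {z₁ z₂ : ℝ} (h₁ : 0 < z₁) (h₂ : 0 < z₂) (n : ℕ) : 0 < transitSum z₁ z₂ n := by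
  rw [transitSum_eq_sum]
  exact Finset.sum_pos (fun k _ => mul_pos (dyckSum_pos h₁ _) (dyckSum_pos h₂ _)) ⟨0, by simp⟩

lemma dyckSum_le_transitSum {z₁ z₂ : ℝ} (h₁ : 0 < z₁) (h₂ : 0 < z₂) (n : ℕ) :
    dyckSum z₁ n ≤ transitSum z₁ z₂ n := by
  rw [transitSum_eq_sum]
  refine le_trans (le_of_eq ?_) (Finset.single_le_sum (f := fun k => dyckSum z₁ k * dyckSum z₂ (n - k))
    (fun k _ => (mul_pos (dyckSum_pos h₁ _) (dyckSum_pos h₂ _)).le)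
    (Finset.mem_range.2 n.lt_succ_self))
  simp

/-! ### Algebraic identities in special form -/

/-- The denominator is rationalised: `c = 1 + X c²` gives `(z - X c)(1 - z - X c) = z(1-z) - X`.
This exhibits the candidate pole at `X = z(1-z)` that sets the growth rate for `z < 1/2`. -/
lemma mul_contactGF_sub {z : ℝ} (hz : z ≠ 0) :
    (C (z * (1 - z)) - X) * contactGF z = C (z * (1 - z)) - C z * (X * catGF) := by
  have hc : (C z : ℝ⟦X⟧) * C z⁻¹ = 1 := by rw [← map_mul, mul_inv_cancel₀ hz, map_one]
  have h2 : (C (z * (1 - z)) : ℝ⟦X⟧) = C z * (1 - C z) := by simp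
  have hu := contactGF_mul z
  have hu' : contactGF z * (C z - X * catGF) = C z := by
    linear_combination C z * hu + contactGF z * X * catGF * hc
  have hne : (C z - X * catGF : ℝ⟦X⟧) ≠ 0 := by
    intro h
    have := congrArg (coeff 0) h
    simp at this
    exact hz this
  refine mul_right_cancel₀ hne ?_
  rw [h2]
  linear_combination (C z * (1 - C z) - X) * hu' + X * C z * catGF_eq

/-- Two-term recursion of the excursion weights. -/
lemma dyckSum_step {z : ℝ} (hz : z ≠ 0) (n : ℕ) :
    z * (1 - z) * dyckSum z (n + 1) = dyckSum z n - z * catalan n := by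
  have h := congrArg (coeff (n + 1)) (mul_contactGF_sub hz)
  rw [sub_mul, map_sub, map_sub, coeff_C_mul, coeff_C_mul, coeff_succ_X_mul, coeff_succ_X_mul,
    coeff_catGF, coeff_C, if_neg (by omega)] at h
  change z * (1 - z) * dyckSum z (n + 1) - dyckSum z n = _ at h
  linarith

lemma catalan_succ_mul (n : ℕ) :
    ((n : ℝ) + 2) * catalan (n + 1) = 2 * (2 * n + 1) * catalan n := by
  have h1 := _root_.succ_mul_catalan_eq_centralBinom n
  have h2 := _root_.succ_mul_catalan_eq_centralBinom (n + 1)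
  have h3 := Nat.succ_mul_centralBinom_succ n
  rw [← h1, ← h2] at h3
  have h4 : ((n : ℝ) + 1) * (((n : ℝ) + 1 + 1) * catalan (n + 1)) =
      2 * (2 * n + 1) * ((n + 1) * catalan n) := by exact_mod_cast h3
  have : (n : ℝ) + 1 ≠ 0 := by positivity
  refine mul_left_cancel₀ this ?_
  linear_combination h4

lemma dyckSum_half (n : ℕ) : dyckSum (1 / 2) n = (n + 1) * catalan n := by
  induction n with
  | zero => simp
  | succ n ih =>
    have h := dyckSum_step (z := 1 / 2) (by norm_num) n
    have h2 := catalan_succ_mul n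
    rw [ih] at h
    push_cast
    linear_combination 4 * h - h2

/-- Partial fractions in the variable `X c` for the product of the two geometric series. -/
lemma sub_mul_transitSum {z₁ z₂ : ℝ} (h₁ : z₁ ≠ 0) (h₂ : z₂ ≠ 0) (n : ℕ) :
    (z₁ - z₂) * transitSum z₁ z₂ n = z₁ * dyckSum z₂ n - z₂ * dyckSum z₁ n := by
  have e1 := contactGF_mul z₁
  have e2 := contactGF_mul z₂
  have hc : ∀ z : ℝ, z ≠ 0 → (C z : ℝ⟦X⟧) * C z⁻¹ = 1 := fun z hz => by
    rw [← map_mul, mul_inv_cancel₀ hz, map_one]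
  have c1 := hc z₁ h₁
  have c2 := hc z₂ h₂
  have h : C (z₁ - z₂) * (contactGF z₁ * contactGF z₂) =
      C z₁ * contactGF z₂ - C z₂ * contactGF z₁ := by
    rw [map_sub]
    linear_combination C z₁ * contactGF z₂ * e1 - C z₂ * contactGF z₁ * e2 +
      contactGF z₁ * contactGF z₂ * X * catGF * (c1 - c2)
  have := congrArg (coeff n) h
  rwa [coeff_C_mul, map_sub, coeff_C_mul, coeff_C_mul] at this

/-- At `z = 1/2` the two conjugate factors coincide, so `G_z² = 1/(1 - 4X)`. -/
lemma transitSum_half_half (n : ℕ) : transitSum (1 / 2) (1 / 2) n = 4 ^ n := by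
  have h := mul_contactGF_sub (z := 1 / 2) (by norm_num)
  have e := contactGF_mul (1 / 2)
  have key : (C (1 / 4 : ℝ) - X) * (contactGF (1 / 2) * contactGF (1 / 2)) = C (1 / 4 : ℝ) := by
    have c0 : (C (1 / 2 * (1 - 1 / 2) : ℝ) : ℝ⟦X⟧) = C (1 / 4 : ℝ) := by norm_num
    have c1 : (C (1 / 2 : ℝ) : ℝ⟦X⟧) = C (1 / 4 : ℝ) * C (1 / 2)⁻¹ := by
      rw [← map_mul]; norm_num
    rw [c0, c1] at h
    linear_combination contactGF (1 / 2) * h + C (1 / 4 : ℝ) * e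
  induction n with
  | zero => simp
  | succ n ih =>
    have := congrArg (coeff (n + 1)) key
    rw [sub_mul, map_sub, coeff_C_mul, coeff_succ_X_mul, coeff_C, if_neg (by omega)] at this
    change 1 / 4 * transitSum (1 / 2) (1 / 2) (n + 1) - transitSum (1 / 2) (1 / 2) n = 0 at this
    rw [ih] at this
    rw [pow_succ]; linarith

end OneTransit

end

noncomputable section

open Polynomial

namespace OneTransit

/-! ### The matrix ansatz, represented on polynomials -/

/-- The matrix of an occupied site: `D 1 = β⁻¹` and `D (X p) = D p + X p`. -/
def opD (β : ℝ) : ℝ[X] →ₗ[ℝ] ℝ[X] :=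
  (Polynomial.basisMonomials ℝ).constr ℝ fun i => C β⁻¹ + ∑ j ∈ Finset.range i, X ^ (j + 1)

/-- The matrix of an empty site: multiplication by `X`. -/
def opE : ℝ[X] →ₗ[ℝ] ℝ[X] := LinearMap.mulLeft ℝ X

/-- The matrix of a site with a given occupation. -/
def siteOp (β : ℝ) (b : Bool) : ℝ[X] →ₗ[ℝ] ℝ[X] := if b then opD β else opE

/-- The sum of the two matrices. -/
def opC (β : ℝ) : ℝ[X] →ₗ[ℝ] ℝ[X] := opD β + opE

/-- The product of matrices attached to a configuration, applied to the right vector. -/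
def wordVec (β : ℝ) (l : List Bool) : ℝ[X] := l.foldr (fun b p => siteOp β b p) 1

/-- The matrix product weight of a configuration. -/
def wordWeight (α β : ℝ) (l : List Bool) : ℝ := (wordVec β l).eval α⁻¹

@[simp] lemma opE_apply (p : ℝ[X]) : opE p = X * p := rfl

lemma opD_X_pow (β : ℝ) (i : ℕ) :
    opD β (X ^ i) = C β⁻¹ + ∑ j ∈ Finset.range i, X ^ (j + 1) := by
  have : (X ^ i : ℝ[X]) = Polynomial.basisMonomials ℝ i := by
    rw [Polynomial.coe_basisMonomials, X_pow_eq_monomial]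
  rw [this, opD, Module.Basis.constr_basis]

lemma opD_one (β : ℝ) : opD β 1 = C β⁻¹ := by simpa using opD_X_pow β 0

/-- The bulk relation `D E = D + E` of the matrix algebra, checked on monomials. -/
lemma opD_X_mul (β : ℝ) (p : ℝ[X]) : opD β (X * p) = opD β p + X * p := by
  have h : opD β ∘ₗ opE = opD β + opE := by
    refine (Polynomial.basisMonomials ℝ).ext fun i => ?_
    have e : Polynomial.basisMonomials ℝ i = (X ^ i : ℝ[X]) := by
      rw [Polynomial.coe_basisMonomials, X_pow_eq_monomial]
    rw [e, LinearMap.comp_apply, LinearMap.add_apply, opE_apply, ← pow_succ', opD_X_pow,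
      opD_X_pow, Finset.sum_range_succ, add_assoc]
  exact LinearMap.congr_fun h p

@[simp] lemma wordVec_nil (β : ℝ) : wordVec β [] = 1 := rfl

@[simp] lemma wordVec_cons (β : ℝ) (b : Bool) (l : List Bool) :
    wordVec β (b :: l) = siteOp β b (wordVec β l) := rfl

lemma opD_eq_sum (β : ℝ) (p : ℝ[X]) :
    opD β p = ∑ i ∈ p.support, C (p.coeff i) * (C β⁻¹ + ∑ j ∈ Finset.range i, X ^ (j + 1)) := by
  conv_lhs => rw [p.as_sum_support_C_mul_X_pow]
  rw [map_sum]
  refine Finset.sum_congr rfl fun i _ => ?_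
  rw [← smul_eq_C_mul, map_smul, opD_X_pow, smul_eq_C_mul]

/-- `D` sends every monomial to a polynomial with nonnegative coefficients and value at least `β⁻¹`
at `1`. The value at `1` is carried along to exclude the zero polynomial. -/
lemma opD_nonneg {β : ℝ} (hβ : 0 < β) {p : ℝ[X]} (hp : ∀ i, 0 ≤ p.coeff i) (h0 : 0 < p.eval 1) :
    (∀ i, 0 ≤ (opD β p).coeff i) ∧ 0 < (opD β p).eval 1 := by
  constructor
  · intro k
    rw [opD_eq_sum, finsetSum_coeff]
    refine Finset.sum_nonneg fun i _ => ?_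
    rw [coeff_C_mul, coeff_add, coeff_C, finsetSum_coeff]
    refine mul_nonneg (hp i) (add_nonneg (by split_ifs <;> positivity)
      (Finset.sum_nonneg fun j _ => ?_))
    rw [coeff_X_pow]; split_ifs <;> norm_num
  · have h : 0 < β⁻¹ * p.eval 1 := mul_pos (inv_pos.2 hβ) h0
    refine h.trans_le ?_
    rw [opD_eq_sum, eval_finsetSum, eval_eq_sum, Polynomial.sum_def, Finset.mul_sum]
    refine Finset.sum_le_sum fun i _ => ?_
    simp only [one_pow, mul_one, eval_mul, eval_C, eval_add, eval_finsetSum, eval_pow, eval_X,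
      Finset.sum_const, Finset.card_range, nsmul_eq_mul]
    have := mul_nonneg (hp i) (Nat.cast_nonneg (α := ℝ) i)
    linarith

lemma wordVec_nonneg {β : ℝ} (hβ : 0 < β) (l : List Bool) :
    (∀ i, 0 ≤ (wordVec β l).coeff i) ∧ 0 < (wordVec β l).eval 1 := by
  induction l with
  | nil =>
    refine ⟨fun i => ?_, by simp⟩
    rw [wordVec_nil, coeff_one]; split_ifs <;> norm_num
  | cons b l ih =>
    rw [wordVec_cons]
    cases b
    · simp only [siteOp, Bool.false_eq_true, if_false, opE_apply]
      refine ⟨fun i => ?_, by simpa using ih.2⟩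
      cases i with
      | zero => simp
      | succ i => rw [coeff_X_mul]; exact ih.1 i
    · simp only [siteOp, if_true]
      exact opD_nonneg hβ ih.1 ih.2

lemma wordWeight_pos {α β : ℝ} (hα : 0 < α) (hβ : 0 < β) (l : List Bool) :
    0 < wordWeight α β l := by
  obtain ⟨h1, h2⟩ := wordVec_nonneg hβ l
  rw [wordWeight, eval_eq_sum, Polynomial.sum_def]
  have hne : wordVec β l ≠ 0 := fun h => by simp [h] at h2
  refine Finset.sum_pos (fun i hi => mul_pos (lt_of_le_of_ne (h1 i) (mem_support_iff.1 hi).symm)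
    (by positivity)) (nonempty_support_iff.2 hne)

/-! ### Reduction of products -/

/-- Regrouping the double sum by `k + q` lets the Catalan recurrence collapse it. -/
lemma sum_catalan_conv (f : ℕ → ℝ) (m : ℕ) :
    ∑ k ∈ Finset.range m, (catalan k : ℝ) *
        ∑ q ∈ Finset.range (m - k), (catalan q : ℝ) * f (m - k - q) =
      ∑ s ∈ Finset.range m, (catalan (s + 1) : ℝ) * f (m - s) := by
  have h := Finset.sum_range_diag_flip m
    (fun k q => (catalan k : ℝ) * ((catalan q : ℝ) * f (m - k - q)))
  simp only [Finset.mul_sum]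
  rw [← h]
  refine Finset.sum_congr rfl fun s _ => ?_
  rw [catalan_succ', Finset.Nat.sum_antidiagonal_eq_sum_range_succ_mk]
  push_cast
  rw [Finset.sum_mul]
  refine Finset.sum_congr rfl fun k hk => ?_
  have : m - k - (s - k) = m - s := by have := Finset.mem_range.1 hk; omega
  rw [this]; ring

/-- The inductive step shared by both normal orderings, left and right. Here `f k` stands for the
value of `C^k`, and the boundary terms recombine through `dyckSum_succ'`. -/
lemma reduction_step (f : ℕ → ℝ) (z : ℝ) (m : ℕ) :
    f (m + 1) + (∑ k ∈ Finset.range m, (catalan k : ℝ) *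
        (∑ q ∈ Finset.range (m - k), (catalan q : ℝ) * f (m - k - q) +
          z⁻¹ * dyckSum z (m - k) * f 0) + z⁻¹ * dyckSum z m * (z⁻¹ * f 0)) =
      ∑ q ∈ Finset.range (m + 1), (catalan q : ℝ) * f (m + 1 - q) +
        z⁻¹ * dyckSum z (m + 1) * f 0 := by
  rw [Finset.sum_range_succ' _ m, dyckSum_succ']
  simp only [mul_add, Finset.sum_add_distrib, sum_catalan_conv, Nat.add_sub_add_right,
    catalan_zero, Nat.cast_one, one_mul, Nat.sub_zero, add_mul]
  have : ∑ x ∈ Finset.range m, (catalan x : ℝ) * (z⁻¹ * dyckSum z (m - x) * f 0) =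
      z⁻¹ * (∑ x ∈ Finset.range m, (catalan x : ℝ) * dyckSum z (m - x)) * f 0 := by
    rw [Finset.mul_sum, Finset.sum_mul]
    exact Finset.sum_congr rfl fun _ _ => by ring
  rw [this]; ring

lemma opD_opC (β : ℝ) (p : ℝ[X]) : opD β (opC β p) = opC β p + opD β (opD β p) := by
  simp only [opC, LinearMap.add_apply, map_add, opE_apply, opD_X_mul]; ring

lemma opC_opE (β : ℝ) (p : ℝ[X]) : opC β (opE p) = opC β p + opE (opE p) := by
  simp only [opC, LinearMap.add_apply, opE_apply, opD_X_mul]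

lemma opD_opE (β : ℝ) (p : ℝ[X]) : opD β (opE p) = opC β p := by
  simp only [opC, LinearMap.add_apply, opE_apply, opD_X_mul]

/-- Since `D C = C + D D`, one factor `C` is traded for a second `D`, and the remaining `D C^m` is
reduced by induction. Quantifying over `φ` allows the hypothesis to be used for `φ ∘ D`. -/
lemma apply_opD_pow (β : ℝ) (m : ℕ) (φ : ℝ[X] →ₗ[ℝ] ℝ) :
    φ (opD β ((opC β ^ m) 1)) =
      ∑ k ∈ Finset.range m, (catalan k : ℝ) * φ ((opC β ^ (m - k)) 1) +
        β⁻¹ * dyckSum β m * φ 1 := by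
  have h1 : ∀ ψ : ℝ[X] →ₗ[ℝ] ℝ, ψ (opD β 1) = β⁻¹ * ψ 1 := fun ψ => by
    rw [opD_one, ← mul_one (C β⁻¹), ← smul_eq_C_mul, map_smul, smul_eq_mul]
  induction m using Nat.strong_induction_on generalizing φ with
  | _ m ih =>
    rcases m with _ | m
    · simp [h1]
    · rw [pow_succ', Module.End.mul_apply, opD_opC, map_add]
      have h2 := ih m (by omega) (φ ∘ₗ opD β)
      simp only [LinearMap.comp_apply] at h2
      rw [h2, h1, ← Module.End.mul_apply, ← pow_succ']
      have h3 := reduction_step (fun k => φ ((opC β ^ k) 1)) β m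
      simp only [pow_zero, Module.End.one_apply] at h3
      rw [← h3]
      congr 2
      refine Finset.sum_congr rfl fun k _ => ?_
      rw [ih (m - k) (by omega)]

/-- The mirror image of `apply_opD_pow`, based on `C E = C + E E`. Evaluation at `α⁻¹` turns the
leftmost `E` into `α⁻¹`, and the polynomial varies so that induction applies to `E p`. -/
lemma eval_pow_opE (α β : ℝ) (m : ℕ) (p : ℝ[X]) :
    ((opC β ^ m) (opE p)).eval α⁻¹ =
      ∑ k ∈ Finset.range m, (catalan k : ℝ) * ((opC β ^ (m - k)) p).eval α⁻¹ +
        α⁻¹ * dyckSum α m * p.eval α⁻¹ := by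
  induction m using Nat.strong_induction_on generalizing p with
  | _ m ih =>
    rcases m with _ | m
    · simp
    · rw [pow_succ, Module.End.mul_apply, opC_opE, map_add, eval_add, ih m (by omega) (opE p),
        ← Module.End.mul_apply, ← pow_succ]
      have h3 := reduction_step (fun k => ((opC β ^ k) p).eval α⁻¹) α m
      simp only [pow_zero, Module.End.one_apply] at h3
      rw [← h3]
      congr 2
      · refine Finset.sum_congr rfl fun k _ => ?_
        rw [ih (m - k) (by omega)]
      · simp

/-- The bridge between the models: splitting the first factor as `D + E` reproduces
`transitSum_succ`. -/
lemma eval_opC_pow (α β : ℝ) (n : ℕ) :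
    ((opC β ^ n) 1).eval α⁻¹ = transitSum α β n := by
  induction n using Nat.strong_induction_on with
  | _ n ih =>
    rcases n with _ | n
    · simp
    · have h := apply_opD_pow β n (Polynomial.leval α⁻¹)
      simp only [Polynomial.leval_apply, eval_one, mul_one] at h
      rw [pow_succ', Module.End.mul_apply, opC, LinearMap.add_apply, ← opC, eval_add, h,
        transitSum_succ, opE_apply, eval_mul, eval_X, ih n (by omega)]
      rw [Finset.sum_congr rfl fun k _ => by rw [ih (n - k) (by omega)]]
      ring

/-! ### Sums over configurations -/

/-- Occupation number of an entry of a list. -/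
def listOcc (l : List Bool) (i : ℕ) : ℝ := if l[i]? = some true then 1 else 0

lemma occ_eq_listOcc {n : ℕ} (η : Fin n → Bool) (i : ℕ) :
    occ η (i + 1) = listOcc (List.ofFn η) i := by
  unfold occ listOcc
  congr 1
  rw [List.getElem?_ofFn, eq_iff_iff]
  constructor
  · rintro ⟨k, hk, h⟩
    obtain rfl : k.val = i := by omega
    simp [h]
  · intro h
    by_cases hi : i < n
    · exact ⟨⟨i, hi⟩, rfl, by simpa [hi] using h⟩
    · simp [hi] at h

/-- Sum of the vectors of all configurations of length `n`, with coefficients `g`. -/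
def configSum (β : ℝ) (n : ℕ) (g : List Bool → ℝ) : ℝ[X] :=
  ∑ η : Fin n → Bool, g (List.ofFn η) • wordVec β (List.ofFn η)

lemma configSum_succ (β : ℝ) (n : ℕ) (g : List Bool → ℝ) :
    configSum β (n + 1) g = opD β (configSum β n fun l => g (true :: l)) +
      opE (configSum β n fun l => g (false :: l)) := by
  unfold configSum
  rw [← (Fin.consEquiv fun _ => Bool).sum_comp, Fintype.sum_prod_type, Fintype.sum_bool, map_sum,
    map_sum]
  simp [Fin.consEquiv, List.ofFn_succ, siteOp]

lemma configSum_zero (β : ℝ) (n : ℕ) : configSum β n (fun _ => 0) = 0 := by simp [configSum]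

lemma configSum_one (β : ℝ) (n : ℕ) : configSum β n (fun _ => 1) = (opC β ^ n) 1 := by
  induction n with
  | zero => simp [configSum]
  | succ n ih => rw [configSum_succ, ih, pow_succ', Module.End.mul_apply]; rfl

/-- Sites to the left of the observable are unconstrained, so each contributes a factor `C`. -/
lemma configSum_shift (β : ℝ) (n i : ℕ) {g : List Bool → ℝ} {g' : ℕ → List Bool → ℝ}
    (h0 : ∀ l, g' 0 l = g l) (h : ∀ i b l, g' (i + 1) (b :: l) = g' i l) :
    configSum β (i + n) (g' i) = (opC β ^ i) (configSum β n g) := by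
  induction i with
  | zero => simp only [zero_add, pow_zero, Module.End.one_apply]; congr 1; exact funext h0
  | succ i ih =>
    rw [show i + 1 + n = i + n + 1 by omega, configSum_succ, pow_succ', Module.End.mul_apply, ← ih]
    simp only [h]; rfl

lemma configSum_occ (β : ℝ) (i m : ℕ) :
    configSum β (i + (m + 1)) (fun l => listOcc l i) = (opC β ^ i) (opD β ((opC β ^ m) 1)) := by
  rw [configSum_shift β (m + 1) i (g := fun l => listOcc l 0) (g' := fun i l => listOcc l i)
    (fun _ => rfl) (fun i b l => by simp [listOcc]), configSum_succ]
  simp [listOcc, configSum_zero, configSum_one]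

lemma configSum_hole (β : ℝ) (i m : ℕ) :
    configSum β (i + (m + 1)) (fun l => 1 - listOcc l i) =
      (opC β ^ i) (opE ((opC β ^ m) 1)) := by
  rw [configSum_shift β (m + 1) i (g := fun l => 1 - listOcc l 0)
    (g' := fun i l => 1 - listOcc l i)
    (fun _ => rfl) (fun i b l => by simp [listOcc]), configSum_succ]
  simp [listOcc, configSum_zero, configSum_one]

/-- An occupied site followed by an empty one contributes `D E = C`. The observable thus shortens
the system by one site, which makes the current independent of the bond. -/
lemma configSum_bond (β : ℝ) (i m : ℕ) :
    configSum β (i + (m + 2)) (fun l => listOcc l i * (1 - listOcc l (i + 1))) =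
      (opC β ^ (i + (m + 1))) 1 := by
  rw [configSum_shift β (m + 2) i (g := fun l => listOcc l 0 * (1 - listOcc l 1))
    (g' := fun i l => listOcc l i * (1 - listOcc l (i + 1)))
    (fun _ => rfl) (fun i b l => by simp [listOcc]), configSum_succ]
  have h1 : configSum β (m + 1) (fun l => listOcc (true :: l) 0 * (1 - listOcc (true :: l) 1)) =
      opE ((opC β ^ m) 1) := by
    have := configSum_hole β 0 m
    simp only [zero_add, pow_zero, Module.End.one_apply] at this
    rw [← this]; simp [listOcc]
  have h2 : configSum β (m + 1) (fun l => listOcc (false :: l) 0 * (1 - listOcc (false :: l) 1)) =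
      0 := by
    simp [listOcc, configSum]
  rw [h1, h2, map_zero, add_zero, opD_opE, pow_add, pow_succ', Module.End.mul_apply,
    Module.End.mul_apply]

lemma eval_configSum (α β : ℝ) (n : ℕ) (g : List Bool → ℝ) :
    (configSum β n g).eval α⁻¹ =
      ∑ η : Fin n → Bool, wordWeight α β (List.ofFn η) * g (List.ofFn η) := by
  simp [configSum, eval_finsetSum, wordWeight, mul_comm]

lemma sum_wordWeight (α β : ℝ) (n : ℕ) :
    ∑ η : Fin n → Bool, wordWeight α β (List.ofFn η) = transitSum α β n := by
  have := eval_configSum α β n fun _ => 1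
  simp only [mul_one] at this
  rw [← this, configSum_one, eval_opC_pow]

lemma sum_wordWeight_occ (α β : ℝ) (i m : ℕ) :
    ∑ η : Fin (i + (m + 1)) → Bool, wordWeight α β (List.ofFn η) * occ η (i + 1) =
      ∑ k ∈ Finset.range m, (catalan k : ℝ) * transitSum α β (i + m - k) +
        β⁻¹ * dyckSum β m * transitSum α β i := by
  simp only [occ_eq_listOcc]
  rw [← eval_configSum α β _ fun l => listOcc l i, configSum_occ]
  have h := apply_opD_pow β m (Polynomial.leval α⁻¹ ∘ₗ (opC β ^ i))
  simp only [LinearMap.comp_apply, Polynomial.leval_apply] at h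
  rw [h, eval_opC_pow]
  congr 1
  refine Finset.sum_congr rfl fun k hk => ?_
  rw [← Module.End.mul_apply, ← pow_add, eval_opC_pow,
    Nat.add_sub_assoc (Finset.mem_range.1 hk).le]

lemma sum_wordWeight_hole (α β : ℝ) (i m : ℕ) :
    ∑ η : Fin (i + (m + 1)) → Bool, wordWeight α β (List.ofFn η) * (1 - occ η (i + 1)) =
      ∑ k ∈ Finset.range i, (catalan k : ℝ) * transitSum α β (i + m - k) +
        α⁻¹ * dyckSum α i * transitSum α β m := by
  simp only [occ_eq_listOcc]
  rw [← eval_configSum α β _ fun l => 1 - listOcc l i, configSum_hole, eval_pow_opE, eval_opC_pow]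
  congr 1
  refine Finset.sum_congr rfl fun k hk => ?_
  rw [← Module.End.mul_apply, ← pow_add, eval_opC_pow]
  congr 2
  have := Finset.mem_range.1 hk
  omega

lemma sum_wordWeight_bond (α β : ℝ) (i m : ℕ) :
    ∑ η : Fin (i + (m + 2)) → Bool,
        wordWeight α β (List.ofFn η) * (occ η (i + 1) * (1 - occ η (i + 2))) =
      transitSum α β (i + (m + 1)) := by
  simp only [occ_eq_listOcc]
  rw [← eval_configSum α β _ fun l => listOcc l i * (1 - listOcc l (i + 1)), configSum_bond,
    eval_opC_pow]

end OneTransit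

end

noncomputable section

open Polynomial

namespace OneTransit

/-! ### Transitions -/

lemma rate_eq (α β : ℝ) {m : ℕ} (η η' : Fin (m + 1) → Bool) :
    rate α β η η' =
      (if η 0 = false ∧ η' = Function.update η 0 true then α else 0) +
      (if η (Fin.last m) = true ∧ η' = Function.update η (Fin.last m) false then β else 0) +
      ∑ j : Fin m, if η j.castSucc = true ∧ η j.succ = false ∧
        η' = Function.update (Function.update η j.castSucc false) j.succ true then 1 else 0 := by
  unfold rate
  congr 1
  · congr 1
    · rw [Fin.sum_univ_succ]; simp
    · rw [Fin.sum_univ_castSucc]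
      have : ∀ j : Fin m, ¬ (j.castSucc.val + 1 = m + 1) := fun j => by
        have := j.2
        rw [Fin.val_castSucc]; omega
      rw [Finset.sum_eq_zero fun j _ => if_neg fun h => this j h.1]
      simp
  · rw [Fin.sum_univ_castSucc]
    have h0 : ∑ l : Fin (m + 1), (if l.val = (Fin.last m).val + 1 ∧ η (Fin.last m) = true ∧
        η l = false ∧ η' = Function.update (Function.update η (Fin.last m) false) l true
        then (1 : ℝ) else 0) = 0 := by
      refine Finset.sum_eq_zero fun l _ => if_neg ?_
      rintro ⟨h, -⟩
      have := l.2; simp at h; omega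
    rw [h0, add_zero]
    refine Finset.sum_congr rfl fun j _ => ?_
    rw [Finset.sum_eq_single j.succ]
    · simp
    · intro l _ hl
      refine if_neg ?_
      rintro ⟨h, -⟩
      exact hl (Fin.ext (by simpa using h))
    · simp

lemma update_eq_iff {ι : Type*} [DecidableEq ι] (η η' : ι → Bool) (k : ι) (b : Bool) :
    (η' k = b ∧ η = Function.update η' k (!b)) ↔ (η k = !b ∧ η' = Function.update η k b) := by
  constructor
  · rintro ⟨h, rfl⟩; simp [← h]
  · rintro ⟨h, rfl⟩; simp [← h]

lemma update_update_eq_iff {ι : Type*} [DecidableEq ι] (η η' : ι → Bool) {k l : ι} (hkl : k ≠ l) :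
    (η' k = true ∧ η' l = false ∧ η = Function.update (Function.update η' k false) l true) ↔
      (η k = false ∧ η l = true ∧ η' = Function.update (Function.update η k true) l false) := by
  constructor
  · rintro ⟨h, h', rfl⟩
    refine ⟨by simp [hkl], by simp, funext fun x => ?_⟩
    by_cases hl : x = l
    · simp [hl, h']
    · by_cases hk : x = k
      · simp [hk, h, hkl]
      · simp [hk, hl]
  · rintro ⟨h, h', rfl⟩
    refine ⟨by simp [hkl], by simp, funext fun x => ?_⟩
    by_cases hl : x = l
    · simp [hl, h']
    · by_cases hk : x = k
      · simp [hk, h, hkl]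
      · simp [hk, hl]

/-- Each elementary move has at most one source for a given target, so its sum over configurations
has at most one term. -/
lemma sum_ite_mul_of_iff {κ : Type*} [Fintype κ] {A : κ → Prop} [DecidablePred A] {Q : Prop}
    [Decidable Q] (ζ : κ) (h : ∀ x, A x ↔ (Q ∧ x = ζ)) (c : ℝ) (p : κ → ℝ) :
    ∑ x, (if A x then c else 0) * p x = if Q then c * p ζ else 0 := by
  classical
  simp only [h]
  by_cases hQ : Q <;> simp [hQ]

/-- The gain term of the master equation. -/
lemma sum_rate_mul (α β : ℝ) {m : ℕ} (p : (Fin (m + 1) → Bool) → ℝ) (η : Fin (m + 1) → Bool) :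
    ∑ η', rate α β η' η * p η' =
      (if η 0 = true then α * p (Function.update η 0 false) else 0) +
      (if η (Fin.last m) = false then β * p (Function.update η (Fin.last m) true) else 0) +
      ∑ j : Fin m, if η j.castSucc = false ∧ η j.succ = true then
        1 * p (Function.update (Function.update η j.castSucc true) j.succ false) else 0 := by
  simp only [rate_eq, add_mul, Finset.sum_add_distrib, Finset.sum_mul]
  congr 1
  · congr 1
    · exact sum_ite_mul_of_iff _ (fun η' => update_eq_iff η η' 0 false) α p
    · exact sum_ite_mul_of_iff _ (fun η' => update_eq_iff η η' (Fin.last m) true) β p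
  · rw [Finset.sum_comm]
    refine Finset.sum_congr rfl fun j _ => ?_
    refine sum_ite_mul_of_iff _ (fun η' => ?_) 1 p
    rw [update_update_eq_iff _ _ (Fin.castSucc_lt_succ).ne, and_assoc]

/-- The loss term of the master equation. -/
lemma sum_rate (α β : ℝ) {m : ℕ} (η : Fin (m + 1) → Bool) :
    ∑ η', rate α β η η' =
      (if η 0 = false then α else 0) + (if η (Fin.last m) = true then β else 0) +
      ∑ j : Fin m, if η j.castSucc = true ∧ η j.succ = false then 1 else 0 := by
  simp only [rate_eq, Finset.sum_add_distrib]
  have key : ∀ {A : (Fin (m + 1) → Bool) → Prop} [DecidablePred A] {Q : Prop} [Decidable Q]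
      (ζ : Fin (m + 1) → Bool) (_ : ∀ x, A x ↔ (Q ∧ x = ζ)) (c : ℝ),
      ∑ x, (if A x then c else 0) = if Q then c else 0 := fun ζ h c => by
    simpa using sum_ite_mul_of_iff ζ h c fun _ => 1
  congr 1
  · congr 1
    · exact key _ (fun η' => Iff.rfl) α
    · exact key _ (fun η' => Iff.rfl) β
  · rw [Finset.sum_comm]
    exact Finset.sum_congr rfl fun j _ => key _ (fun η' => and_assoc.symm) 1

/-! ### Stationarity of the matrix product weights -/

lemma wordVec_append (β : ℝ) (l₁ l₂ : List Bool) :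
    wordVec β (l₁ ++ l₂) = (l₁.map (siteOp β)).prod (wordVec β l₂) := by
  induction l₁ with
  | nil => simp
  | cons b l₁ ih => simp [ih, Module.End.mul_apply]

lemma wordWeight_false_cons {α : ℝ} (β : ℝ) (hα : α ≠ 0) (l : List Bool) :
    α * wordWeight α β (false :: l) = wordWeight α β l := by
  simp [wordWeight, siteOp, hα]

lemma wordWeight_append_true (α : ℝ) {β : ℝ} (hβ : β ≠ 0) (l : List Bool) :
    β * wordWeight α β (l ++ [true]) = wordWeight α β l := by
  have h : wordVec β [true] = β⁻¹ • wordVec β [] := by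
    simp [siteOp, opD_one, smul_eq_C_mul]
  have h2 : wordVec β l = wordVec β (l ++ []) := by simp
  rw [wordWeight, wordWeight, h2, wordVec_append, wordVec_append, h, map_smul, eval_smul, smul_eq_mul,
    mul_inv_cancel_left₀ hβ]

lemma wordWeight_true_false (α β : ℝ) (l₁ l₂ : List Bool) :
    wordWeight α β (l₁ ++ true :: false :: l₂) =
      wordWeight α β (l₁ ++ true :: l₂) + wordWeight α β (l₁ ++ false :: l₂) := by
  simp only [wordWeight, wordVec_append, wordVec_cons, siteOp, if_true, Bool.false_eq_true,
    if_false, opE_apply, opD_X_mul, map_add, eval_add]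

lemma ofFn_update_update {m : ℕ} (η : Fin (m + 1) → Bool) (j : Fin m) :
    ∃ l₁ l₂ : List Bool, ∀ x y : Bool,
      List.ofFn (Function.update (Function.update η j.castSucc x) j.succ y) =
        l₁ ++ x :: y :: l₂ ∧ l₁.length = j := by
  refine ⟨(List.ofFn η).take j, (List.ofFn η).drop (j + 2), fun x y => ⟨?_, ?_⟩⟩
  · have hj := j.2
    refine List.ext_getElem (by simp; omega) fun i h1 h2 => ?_
    simp only [List.getElem_ofFn, List.getElem_append, List.length_take, List.length_ofFn]
    have hmin : min (j : ℕ) (m + 1) = j := by omega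
    simp only [hmin]
    simp only [List.length_ofFn] at h1
    split_ifs with hi
    · have e1 : (⟨i, h1⟩ : Fin (m + 1)) ≠ j.succ := fun h => by
        have := congrArg Fin.val h; simp at this; omega
      have e2 : (⟨i, h1⟩ : Fin (m + 1)) ≠ j.castSucc := fun h => by
        have := congrArg Fin.val h; simp at this; omega
      simp [e1, e2, -List.ofFn_succ]
    · obtain hi | hi | hi : i = j ∨ i = j + 1 ∨ ∃ d, i = j + 2 + d := by
        rcases Nat.lt_or_ge i (j + 2) with h | h
        · omega
        · exact Or.inr (Or.inr ⟨i - (j + 2), by omega⟩)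
      · have e : (⟨i, h1⟩ : Fin (m + 1)) = j.castSucc := Fin.ext (by simpa using hi)
        rw [e, Function.update_of_ne (Fin.castSucc_lt_succ).ne]
        simp [hi]
      · have e : (⟨i, h1⟩ : Fin (m + 1)) = j.succ := Fin.ext (by simpa using hi)
        rw [e]
        simp [hi]
      · obtain ⟨d, rfl⟩ := hi
        have e1 : (⟨j + 2 + d, h1⟩ : Fin (m + 1)) ≠ j.succ := fun h => by
          have := congrArg Fin.val h; simp at this; omega
        have e2 : (⟨j + 2 + d, h1⟩ : Fin (m + 1)) ≠ j.castSucc := fun h => by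
          have := congrArg Fin.val h; simp at this; omega
        have e3 : (j : ℕ) + 2 + d - j = d + 2 := by omega
        simp only [ne_eq, e1, not_false_eq_true, Function.update_of_ne, e2, e3,
          List.getElem_cons_succ, List.getElem_drop, List.getElem_ofFn]
  · simp; omega

/-- The weight of a configuration with the site `k` removed, with the sign of its occupation. -/
def deletedWeight (α β : ℝ) {m : ℕ} (η : Fin (m + 1) → Bool) (k : Fin (m + 1)) : ℝ :=
  (if η k then -1 else 1) * wordWeight α β ((List.ofFn η).eraseIdx k)

/-- The relation `D E = D + E` writes the net flow through a bond as a difference of signed weights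
with one site deleted. Summed over bonds these telescope, and the two reservoir terms cancel the
ends. -/
lemma bond_balance (α β : ℝ) {m : ℕ} (η : Fin (m + 1) → Bool) (j : Fin m) :
    (if η j.castSucc = false ∧ η j.succ = true then 1 * wordWeight α β (List.ofFn
        (Function.update (Function.update η j.castSucc true) j.succ false)) else 0) -
      (if η j.castSucc = true ∧ η j.succ = false then 1 else 0) * wordWeight α β (List.ofFn η) =
    deletedWeight α β η j.castSucc - deletedWeight α β η j.succ := by
  obtain ⟨l₁, l₂, h⟩ := ofFn_update_update η j
  have h0 := (h (η j.castSucc) (η j.succ)).1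
  have hl := (h true true).2
  rw [Function.update_eq_self, Function.update_eq_self] at h0
  have hw := wordWeight_true_false α β l₁ l₂
  rw [deletedWeight, deletedWeight, (h true false).1, h0]
  have e1 : (l₁ ++ η j.castSucc :: η j.succ :: l₂).eraseIdx (j.castSucc : ℕ) =
      l₁ ++ η j.succ :: l₂ := by
    rw [List.eraseIdx_append_of_length_le (by simp [hl])]; simp [hl]
  have e2 : (l₁ ++ η j.castSucc :: η j.succ :: l₂).eraseIdx (j.succ : ℕ) =
      l₁ ++ η j.castSucc :: l₂ := by
    rw [List.eraseIdx_append_of_length_le (by simp [hl])]; simp [hl]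
  rw [e1, e2]
  cases η j.castSucc <;> cases η j.succ <;> (simp [hw]; try ring)

lemma left_balance {α : ℝ} (β : ℝ) (hα : α ≠ 0) {m : ℕ} (η : Fin (m + 1) → Bool) :
    (if η 0 = true then α * wordWeight α β (List.ofFn (Function.update η 0 false)) else 0) -
      (if η 0 = false then α else 0) * wordWeight α β (List.ofFn η) =
    -deletedWeight α β η 0 := by
  have h : ∀ b, List.ofFn (Function.update η 0 b) = b :: List.ofFn (fun i : Fin m => η i.succ) :=
    fun b => by simp [List.ofFn_succ, Fin.succ_ne_zero]
  have h0 := h (η 0)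
  rw [Function.update_eq_self] at h0
  rw [deletedWeight, h, h0]
  cases η 0 <;> simp [wordWeight_false_cons, hα]

lemma right_balance (α : ℝ) {β : ℝ} (hβ : β ≠ 0) {m : ℕ} (η : Fin (m + 1) → Bool) :
    (if η (Fin.last m) = false then
        β * wordWeight α β (List.ofFn (Function.update η (Fin.last m) true)) else 0) -
      (if η (Fin.last m) = true then β else 0) * wordWeight α β (List.ofFn η) =
    deletedWeight α β η (Fin.last m) := by
  have h : ∀ b, List.ofFn (Function.update η (Fin.last m) b) =
      List.ofFn (fun i : Fin m => η i.castSucc) ++ [b] :=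
    fun b => by rw [List.ofFn_succ_last]; simp [Fin.castSucc_ne_last]
  have h0 := h (η (Fin.last m))
  rw [Function.update_eq_self] at h0
  rw [deletedWeight, h, h0]
  have e : (List.ofFn (fun i : Fin m => η i.castSucc) ++ [η (Fin.last m)]).eraseIdx
      (Fin.last m : ℕ) = List.ofFn (fun i : Fin m => η i.castSucc) := by
    rw [List.eraseIdx_append_of_length_le (by simp)]; simp
  rw [e]
  cases η (Fin.last m) <;> simp [wordWeight_append_true, hβ]

lemma master_wordWeight {α β : ℝ} (hα : α ≠ 0) (hβ : β ≠ 0) {m : ℕ} (η : Fin (m + 1) → Bool) :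
    ∑ η', (rate α β η' η * wordWeight α β (List.ofFn η') -
      rate α β η η' * wordWeight α β (List.ofFn η)) = 0 := by
  rw [Finset.sum_sub_distrib, ← Finset.sum_mul, sum_rate,
    sum_rate_mul α β fun η => wordWeight α β (List.ofFn η)]
  have h1 := left_balance β hα η
  have h2 := right_balance α hβ η
  have h3 := Finset.sum_congr rfl fun j (_ : j ∈ Finset.univ) => bond_balance α β η j
  rw [Finset.sum_sub_distrib, Finset.sum_sub_distrib, ← Finset.sum_mul] at h3
  have h4 := Fin.sum_univ_succ (deletedWeight α β η)
  rw [Fin.sum_univ_castSucc] at h4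
  linarith

/-! ### Irreducibility and uniqueness -/

lemma rate_nonneg {α β : ℝ} (hα : 0 ≤ α) (hβ : 0 ≤ β) {n : ℕ} (η η' : Fin n → Bool) :
    0 ≤ rate α β η η' := by
  unfold rate
  refine add_nonneg (add_nonneg (Finset.sum_nonneg fun k _ => ?_) (Finset.sum_nonneg fun k _ => ?_))
    (Finset.sum_nonneg fun k _ => Finset.sum_nonneg fun l _ => ?_) <;> split_ifs <;> simp [hα, hβ]

lemma rate_pos_left {α β : ℝ} (hα : 0 < α) (hβ : 0 < β) {m : ℕ} {η : Fin (m + 1) → Bool}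
    (h : η 0 = false) : 0 < rate α β η (Function.update η 0 true) := by
  rw [rate_eq, if_pos ⟨h, rfl⟩, add_assoc]
  refine add_pos_of_pos_of_nonneg hα (add_nonneg ?_ (Finset.sum_nonneg fun j _ => ?_))
  · split_ifs <;> simp [hβ.le]
  · split_ifs <;> norm_num

lemma rate_pos_right {α β : ℝ} (hα : 0 < α) (hβ : 0 < β) {m : ℕ} {η : Fin (m + 1) → Bool}
    (h : η (Fin.last m) = true) : 0 < rate α β η (Function.update η (Fin.last m) false) := by
  rw [rate_eq, if_pos (c := η (Fin.last m) = true ∧ _) ⟨h, rfl⟩]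
  refine add_pos_of_pos_of_nonneg (add_pos_of_nonneg_of_pos ?_ hβ)
    (Finset.sum_nonneg fun j _ => ?_)
  · split_ifs <;> simp [hα.le]
  · split_ifs <;> norm_num

lemma rate_pos_bulk {α β : ℝ} (hα : 0 < α) (hβ : 0 < β) {m : ℕ} {η : Fin (m + 1) → Bool}
    {j : Fin m} (h : η j.castSucc = true) (h' : η j.succ = false) :
    0 < rate α β η (Function.update (Function.update η j.castSucc false) j.succ true) := by
  rw [rate_eq]
  refine add_pos_of_nonneg_of_pos (add_nonneg ?_ ?_) (Finset.sum_pos' (fun i _ => ?_)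
    ⟨j, Finset.mem_univ _, ?_⟩)
  · split_ifs <;> simp [hα.le]
  · split_ifs <;> simp [hβ.le]
  · split_ifs <;> norm_num
  · rw [if_pos ⟨h, h', rfl⟩]; norm_num

/-- Sum of a cost over the occupied sites. -/
def occCost {n : ℕ} (c : Fin n → ℕ) (η : Fin n → Bool) : ℕ := ∑ k, if η k then c k else 0

lemma occCost_update {n : ℕ} (c : Fin n → ℕ) {η : Fin n → Bool} {k : Fin n} (h : η k = false) :
    occCost c (Function.update η k true) = occCost c η + c k := by
  have : ∀ i, (if Function.update η k true i then c i else 0) =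
      (if η i then c i else 0) + if i = k then c k else 0 := by
    intro i
    by_cases hi : i = k
    · subst hi; simp [h]
    · simp [hi]
  simp only [occCost, this, Finset.sum_add_distrib, Finset.sum_ite_eq', Finset.mem_univ, if_true]

/-- The dynamics is run backwards: the leftmost particle retreats to the left and finally out of the
first site. Each move lowers the total distance of the particles from the left reservoir. -/
lemma empty_mem_of_closed {α β : ℝ} (hα : 0 < α) (hβ : 0 < β) {m : ℕ}
    {S : Set (Fin (m + 1) → Bool)} (hS : ∀ η η', η' ∈ S → 0 < rate α β η η' → η ∈ S)
    {η : Fin (m + 1) → Bool} (hη : η ∈ S) : (fun _ => false) ∈ S := by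
  induction hN : occCost (fun k => k.val + 1) η using Nat.strong_induction_on generalizing η with
  | _ N ih =>
    by_cases hall : ∀ k, η k = false
    · rwa [← funext hall]
    · push Not at hall
      obtain ⟨k, hk, hmin⟩ : ∃ k, η k = true ∧ ∀ l < k, η l = false := by
        have hne : (Finset.univ.filter fun k => η k = true).Nonempty := by
          obtain ⟨k, hk⟩ := hall
          exact ⟨k, by simpa using hk⟩
        refine ⟨Finset.min' _ hne, by simpa using Finset.min'_mem _ hne, fun l hl => ?_⟩
        by_contra hcon
        exact absurd (Finset.min'_le _ l (by simpa using hcon)) (not_le.2 hl)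
      have he : η = Function.update (Function.update η k false) k true := by
        rw [Function.update_idem, ← hk, Function.update_eq_self]
      set ζ := Function.update η k false with hζ
      have hζk : ζ k = false := by simp [hζ]
      rcases Fin.eq_zero_or_eq_succ k with rfl | ⟨j, rfl⟩
      · have h1 := hS ζ η hη (by rw [he]; exact rate_pos_left hα hβ hζk)
        refine ih _ ?_ h1 rfl
        rw [← hN, he, occCost_update _ hζk]; simp
      · have hne : j.castSucc ≠ j.succ := (Fin.castSucc_lt_succ).ne
        have hζj : ζ j.castSucc = false := by
          rw [hζ, Function.update_of_ne hne]
          exact hmin _ Fin.castSucc_lt_succ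
        have hmove : η = Function.update (Function.update (Function.update ζ j.castSucc true)
            j.castSucc false) j.succ true := by
          rw [Function.update_idem, ← hζj, Function.update_eq_self]; exact he
        have h1 := hS (Function.update ζ j.castSucc true) η hη (by
          rw [hmove]
          exact rate_pos_bulk hα hβ (by simp) (by rw [Function.update_of_ne hne.symm, hζk]))
        refine ih _ ?_ h1 rfl
        rw [← hN, he, occCost_update _ hζk, occCost_update _ hζj]; simp

/-- Every configuration can be emptied by repeatedly advancing its rightmost particle, and closure
under predecessors carries membership back along these moves. -/
lemma mem_of_empty_mem {α β : ℝ} (hα : 0 < α) (hβ : 0 < β) {m : ℕ}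
    {S : Set (Fin (m + 1) → Bool)} (hS : ∀ η η', η' ∈ S → 0 < rate α β η η' → η ∈ S)
    (h0 : (fun _ => false) ∈ S) (η : Fin (m + 1) → Bool) : η ∈ S := by
  induction hN : occCost (fun k => m + 1 - k.val) η using Nat.strong_induction_on
    generalizing η with
  | _ N ih =>
    by_cases hall : ∀ k, η k = false
    · rwa [funext hall]
    · push Not at hall
      obtain ⟨k, hk, hmax⟩ : ∃ k, η k = true ∧ ∀ l, k < l → η l = false := by
        have hne : (Finset.univ.filter fun k => η k = true).Nonempty := by
          obtain ⟨k, hk⟩ := hall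
          exact ⟨k, by simpa using hk⟩
        refine ⟨Finset.max' _ hne, by simpa using Finset.max'_mem _ hne, fun l hl => ?_⟩
        by_contra hcon
        exact absurd (Finset.le_max' _ l (by simpa using hcon)) (not_le.2 hl)
      have he : η = Function.update (Function.update η k false) k true := by
        rw [Function.update_idem, ← hk, Function.update_eq_self]
      set ζ := Function.update η k false with hζ
      have hζk : ζ k = false := by simp [hζ]
      rcases Fin.eq_castSucc_or_eq_last k with ⟨j, rfl⟩ | rfl
      · have hne : j.castSucc ≠ j.succ := (Fin.castSucc_lt_succ).ne
        have hηj : η j.succ = false := hmax _ Fin.castSucc_lt_succ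
        have hζj : ζ j.succ = false := by rw [hζ, Function.update_of_ne hne.symm, hηj]
        refine hS η _ (ih _ ?_ (Function.update ζ j.succ true) rfl) (rate_pos_bulk hα hβ hk hηj)
        rw [← hN, he, occCost_update _ hζk, occCost_update _ hζj]
        have := j.2
        simp; omega
      · refine hS η _ (ih _ ?_ ζ rfl) (rate_pos_right hα hβ hk)
        rw [← hN, he, occCost_update _ hζk]; simp

/-- The normalised matrix product weights. -/
def matrixMeasure (α β : ℝ) {n : ℕ} (η : Fin n → Bool) : ℝ :=
  wordWeight α β (List.ofFn η) / transitSum α β n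

lemma isStationary_matrixMeasure {α β : ℝ} (hα : 0 < α) (hβ : 0 < β) (m : ℕ) :
    IsStationary α β (matrixMeasure α β : (Fin (m + 1) → Bool) → ℝ) := by
  have hY := transitSum_pos hα hβ (m + 1)
  refine ⟨fun η => (div_pos (wordWeight_pos hα hβ _) hY).le, ?_, fun η => ?_⟩
  · simp only [matrixMeasure, ← Finset.sum_div, sum_wordWeight, div_self hY.ne']
  · have := congrArg (· / transitSum α β (m + 1)) (master_wordWeight hα.ne' hβ.ne' η)
    simp only [Finset.sum_div, zero_div] at this
    rw [← this]
    exact Finset.sum_congr rfl fun η' _ => by simp only [matrixMeasure]; ring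

/-- Minimum principle: subtracting the largest multiple of the matrix measure that leaves `q`
nonnegative creates a zero. Stationarity spreads zeros to all predecessors, hence everywhere. -/
lemma eq_matrixMeasure {α β : ℝ} (hα : 0 < α) (hβ : 0 < β) {m : ℕ}
    {q : (Fin (m + 1) → Bool) → ℝ} (hq : IsStationary α β q) : q = matrixMeasure α β := by
  have hπ := isStationary_matrixMeasure hα hβ m
  have hpos : ∀ η : Fin (m + 1) → Bool, 0 < matrixMeasure α β η := fun η =>
    div_pos (wordWeight_pos hα hβ _) (transitSum_pos hα hβ _)
  obtain ⟨η₀, h₀⟩ := Finite.exists_min fun η : Fin (m + 1) → Bool => q η / matrixMeasure α β η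
  set t := q η₀ / matrixMeasure α β η₀ with ht
  have hnn : ∀ η, 0 ≤ q η - t * matrixMeasure α β η := fun η => by
    have := (le_div_iff₀ (hpos η)).1 (h₀ η)
    linarith
  have hS : ∀ η η' : Fin (m + 1) → Bool,
      η' ∈ {η | q η - t * matrixMeasure α β η = 0} → 0 < rate α β η η' →
        η ∈ {η | q η - t * matrixMeasure α β η = 0} := by
    intro η η' h hr
    simp only [Set.mem_ofPred_eq] at h ⊢
    -- The loss term is proportional to the difference at `η'`, which vanishes, so the total gain
    -- vanishes as well.
    have e : ∑ ζ, rate α β ζ η' * (q ζ - t * matrixMeasure α β ζ) = 0 := by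
      have e1 := hq.2.2 η'
      have e2 := hπ.2.2 η'
      have : ∑ ζ, rate α β ζ η' * (q ζ - t * matrixMeasure α β ζ) =
          ∑ ζ, (rate α β ζ η' * q ζ - rate α β η' ζ * q η') - t *
            ∑ ζ, (rate α β ζ η' * matrixMeasure α β ζ - rate α β η' ζ * matrixMeasure α β η') +
          (∑ ζ, rate α β η' ζ) * (q η' - t * matrixMeasure α β η') := by
        rw [Finset.mul_sum, Finset.sum_mul, ← Finset.sum_sub_distrib, ← Finset.sum_add_distrib]
        exact Finset.sum_congr rfl fun ζ _ => by ring
      rw [this, e1, e2, h]; ring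
    have := (Finset.sum_eq_zero_iff_of_nonneg fun ζ _ =>
      mul_nonneg (rate_nonneg hα.le hβ.le ζ η') (hnn ζ)).1 e η (Finset.mem_univ _)
    exact (mul_eq_zero.1 this).resolve_left hr.ne'
  have hη₀ : η₀ ∈ {η | q η - t * matrixMeasure α β η = 0} := by
    simp only [Set.mem_ofPred_eq, ht, div_mul_cancel₀ _ (hpos η₀).ne', sub_self]
  have hall : ∀ η, q η = t * matrixMeasure α β η := fun η =>
    sub_eq_zero.1 (mem_of_empty_mem hα hβ hS (empty_mem_of_closed hα hβ hS hη₀) η)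
  have h1 : t = 1 := by
    have := hq.2.1
    simp only [hall, ← Finset.mul_sum, hπ.2.1, mul_one] at this
    exact this
  exact funext fun η => by rw [hall, h1, one_mul]

end OneTransit

end

noncomputable section

open PowerSeries

namespace OneTransit

/-! ### Lattice paths with an arbitrary number of steps -/

/-- The height increment of a step. -/
def stepHeight (b : Bool) : ℤ := if b then 1 else -1

/-- Height after `k` steps of a path started at height `h`. -/
def pathHeight {N : ℕ} (h : ℤ) (s : Fin N → Bool) (k : ℕ) : ℤ :=
  h + ∑ j : Fin N, if j.val < k then stepHeight (s j) else 0

/-- Weight of a path started at height `h`. -/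
def pathWeight (z₁ z₂ : ℝ) {N : ℕ} (h : ℤ) (s : Fin N → Bool) : ℝ :=
  ∏ j : Fin N, if pathHeight h s (j.val + 1) = 0 then 1 else if s j then z₂ else z₁

/-- The path from the axis to the axis has one transit. -/
def TransitPath {N : ℕ} (s : Fin N → Bool) : Prop :=
  pathHeight 0 s N = 0 ∧ ∃ c, c ≤ N ∧ (∀ k, k ≤ c → 0 ≤ pathHeight 0 s k) ∧
    (∀ k, c ≤ k → k ≤ N → pathHeight 0 s k ≤ 0)

/-- The path stays weakly above the axis and ends on it. -/
def UpperPath {N : ℕ} (h : ℤ) (s : Fin N → Bool) : Prop :=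
  (∀ k, k ≤ N → 0 ≤ pathHeight h s k) ∧ pathHeight h s N = 0

/-- The path stays weakly below the axis and ends on it. -/
def LowerPath {N : ℕ} (s : Fin N → Bool) : Prop :=
  (∀ k, k ≤ N → pathHeight 0 s k ≤ 0) ∧ pathHeight 0 s N = 0

open Classical in
/-- Total weight of the paths with a given property. -/
def pathSum (z₁ z₂ : ℝ) {N : ℕ} (h : ℤ) (P : (Fin N → Bool) → Prop) : ℝ :=
  ∑ s : Fin N → Bool, if P s then pathWeight z₁ z₂ h s else 0

lemma height_eq_pathHeight {n : ℕ} (s : Fin (2 * n) → Bool) (k : ℕ) :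
    height s k = pathHeight 0 s k := by
  simp [height, pathHeight, stepHeight]

lemma weight_eq_pathWeight (z₁ z₂ : ℝ) {n : ℕ} (s : Fin (2 * n) → Bool) :
    weight z₁ z₂ s = pathWeight z₁ z₂ 0 s := by
  simp [weight, pathWeight, height_eq_pathHeight]

@[simp] lemma pathHeight_zero {N : ℕ} (h : ℤ) (s : Fin N → Bool) : pathHeight h s 0 = h := by
  simp [pathHeight]

lemma pathHeight_cons {N : ℕ} (h : ℤ) (b : Bool) (s : Fin N → Bool) (k : ℕ) :
    pathHeight h (Fin.cons b s : Fin (N + 1) → Bool) (k + 1) =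
      pathHeight (h + stepHeight b) s k := by
  simp [pathHeight, Fin.sum_univ_succ, add_assoc]

lemma pathWeight_cons (z₁ z₂ : ℝ) {N : ℕ} (h : ℤ) (b : Bool) (s : Fin N → Bool) :
    pathWeight z₁ z₂ h (Fin.cons b s : Fin (N + 1) → Bool) =
      (if h + stepHeight b = 0 then 1 else if b then z₂ else z₁) *
        pathWeight z₁ z₂ (h + stepHeight b) s := by
  simp [pathWeight, Fin.prod_univ_succ, pathHeight_cons]

lemma pathHeight_append_left {a b : ℕ} (h : ℤ) (s : Fin a → Bool) (t : Fin b → Bool) {k : ℕ}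
    (hk : k ≤ a) : pathHeight h (Fin.append s t) k = pathHeight h s k := by
  have : ∀ j : Fin b, ¬ (a + j.val < k) := fun j => by omega
  simp [pathHeight, Fin.sum_univ_add, this]

lemma pathHeight_append_right {a b : ℕ} (h : ℤ) (s : Fin a → Bool) (t : Fin b → Bool) (k : ℕ) :
    pathHeight h (Fin.append s t) (a + k) = pathHeight (pathHeight h s a) t k := by
  have : ∀ j : Fin a, j.val < a + k := fun j => by omega
  simp [pathHeight, Fin.sum_univ_add, this, add_assoc]

lemma pathWeight_append (z₁ z₂ : ℝ) {a b : ℕ} (h : ℤ) (s : Fin a → Bool) (t : Fin b → Bool) :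
    pathWeight z₁ z₂ h (Fin.append s t) =
      pathWeight z₁ z₂ h s * pathWeight z₁ z₂ (pathHeight h s a) t := by
  simp only [pathWeight, Fin.prod_univ_add, Fin.append_left, Fin.append_right, Fin.val_castAdd,
    Fin.val_natAdd, add_assoc, pathHeight_append_right]
  congr 1
  refine Finset.prod_congr rfl fun j _ => ?_
  rw [pathHeight_append_left _ _ _ (by omega)]

/-- The left part ends on the axis, so the weight of the right part is that of a path starting
afresh at height zero. -/
lemma pathSum_append (z₁ z₂ : ℝ) {a b : ℕ} {R : (Fin (a + b) → Bool) → Prop}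
    {P : (Fin a → Bool) → Prop} {Q : (Fin b → Bool) → Prop}
    (hR : ∀ s t, R (Fin.append s t) ↔ P s ∧ Q t) (hP : ∀ s, P s → pathHeight 0 s a = 0) :
    pathSum z₁ z₂ 0 R = pathSum z₁ z₂ 0 P * pathSum z₁ z₂ 0 Q := by
  classical
  unfold pathSum
  rw [← (Fin.appendEquiv a b).sum_comp, Fintype.sum_prod_type, Finset.sum_mul_sum]
  refine Finset.sum_congr rfl fun s _ => Finset.sum_congr rfl fun t _ => ?_
  change (if R (Fin.append s t) then pathWeight z₁ z₂ 0 (Fin.append s t) else 0) = _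
  rw [pathWeight_append]
  by_cases h1 : P s
  · rw [hP s h1]
    by_cases h2 : Q t <;> simp [hR, h1, h2]
  · simp [hR, h1]

lemma pathSum_contactAbove (z₁ z₂ : ℝ) {N a b : ℕ} (hN : N = a + b) :
    pathSum z₁ z₂ 0 (fun s : Fin N → Bool => TransitPath s ∧ pathHeight 0 s a = 0 ∧
        ∀ k, k ≤ a → 0 ≤ pathHeight 0 s k) =
      pathSum z₁ z₂ 0 (UpperPath 0 (N := a)) * pathSum z₁ z₂ 0 (TransitPath (N := b)) := by
  subst hN
  refine pathSum_append z₁ z₂ (fun s t => ?_) fun s h => h.2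
  have hl := fun k (hk : k ≤ a) => pathHeight_append_left 0 s t hk
  have hr := pathHeight_append_right 0 s t
  constructor
  · rintro ⟨⟨h1, c, hc, hc1, hc2⟩, h2, h3⟩
    rw [hl a le_rfl] at h2
    rw [h2] at hr
    -- If the transit `c` precedes `a`, truncated subtraction puts it at the start of the right
    -- part, where the height is zero.
    refine ⟨⟨fun k hk => hl k hk ▸ h3 k hk, h2⟩, (hr b).symm.trans h1, c - a, by omega, ?_, ?_⟩
    · intro k hk
      rw [← hr]
      rcases Nat.eq_zero_or_pos k with rfl | hk0
      · rw [hr]; simp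
      · exact hc1 _ (by omega)
    · intro k hk hkb
      rw [← hr]
      exact hc2 _ (by omega) (by omega)
  · rintro ⟨⟨h1, h2⟩, h3, c, hc, hc1, hc2⟩
    rw [h2] at hr
    refine ⟨⟨(hr b).trans h3, a + c, by omega, ?_, ?_⟩, (hl a le_rfl).trans h2,
      fun k hk => (hl k hk).symm ▸ h1 k hk⟩
    · intro k hk
      rcases Nat.le_total k a with h | h
      · rw [hl k h]; exact h1 k h
      · obtain ⟨d, rfl⟩ := Nat.exists_eq_add_of_le h
        rw [hr]; exact hc1 d (by omega)
    · intro k hk hkb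
      obtain ⟨d, rfl⟩ := Nat.exists_eq_add_of_le (show a ≤ k by omega)
      rw [hr]; exact hc2 d (by omega) (by omega)

lemma pathSum_contactBelow (z₁ z₂ : ℝ) {N a b : ℕ} (hN : N = a + b) :
    pathSum z₁ z₂ 0 (fun s : Fin N → Bool => TransitPath s ∧ pathHeight 0 s a = 0 ∧
        ∀ k, a ≤ k → k ≤ N → pathHeight 0 s k ≤ 0) =
      pathSum z₁ z₂ 0 (TransitPath (N := a)) * pathSum z₁ z₂ 0 (LowerPath (N := b)) := by
  subst hN
  refine pathSum_append z₁ z₂ (fun s t => ?_) fun s h => h.1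
  have hl := fun k (hk : k ≤ a) => pathHeight_append_left 0 s t hk
  have hr := pathHeight_append_right 0 s t
  constructor
  · rintro ⟨⟨h1, c, hc, hc1, hc2⟩, h2, h3⟩
    rw [hl a le_rfl] at h2
    rw [h2] at hr
    -- A transit beyond `a` is moved back to `a`, the end of the left part.
    refine ⟨⟨h2, min c a, by omega, fun k hk => ?_, fun k hk hka => ?_⟩, fun k hk => ?_,
      (hr b).symm.trans h1⟩
    · rw [← hl k (by omega)]; exact hc1 k (by omega)
    · rcases Nat.lt_or_ge k a with h | h
      · rw [← hl k hka]; exact hc2 k (by omega) (by omega)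
      · rw [show k = a by omega, h2]
    · rw [← hr]; exact h3 _ (by omega) (by omega)
  · rintro ⟨⟨h1, c, hc, hc1, hc2⟩, h2, h3⟩
    rw [h1] at hr
    have h4 : ∀ k, a ≤ k → k ≤ a + b → pathHeight 0 (Fin.append s t) k ≤ 0 := fun k hk hkb => by
      obtain ⟨d, rfl⟩ := Nat.exists_eq_add_of_le hk
      rw [hr]; exact h2 d (by omega)
    refine ⟨⟨(hr b).trans h3, c, by omega, fun k hk => ?_, fun k hk hkb => ?_⟩,
      (hl a le_rfl).trans h1, h4⟩
    · rw [hl k (by omega)]; exact hc1 k hk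
    · rcases Nat.le_total k a with h | h
      · rw [hl k h]; exact hc2 k hk h
      · exact h4 k h hkb

/-- The transit takes place after `a` steps. -/
def TransitAt {N : ℕ} (s : Fin N → Bool) (a : ℕ) : Prop :=
  pathHeight 0 s a = 0 ∧ pathHeight 0 s N = 0 ∧ (∀ k, k ≤ a → 0 ≤ pathHeight 0 s k) ∧
    ∀ k, a ≤ k → k ≤ N → pathHeight 0 s k ≤ 0

lemma pathSum_transitAt (z₁ z₂ : ℝ) {N a b : ℕ} (hN : N = a + b) :
    pathSum z₁ z₂ 0 (fun s : Fin N → Bool => TransitAt s a) =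
      pathSum z₁ z₂ 0 (UpperPath 0 (N := a)) * pathSum z₁ z₂ 0 (LowerPath (N := b)) := by
  subst hN
  refine pathSum_append z₁ z₂ (fun s t => ?_) fun s h => h.2
  have hl := fun k (hk : k ≤ a) => pathHeight_append_left 0 s t hk
  have hr := pathHeight_append_right 0 s t
  constructor
  · rintro ⟨h1, h2, h3, h4⟩
    rw [hl a le_rfl] at h1
    rw [h1] at hr
    exact ⟨⟨fun k hk => hl k hk ▸ h3 k hk, h1⟩,
      fun k hk => hr k ▸ h4 (a + k) (by omega) (by omega), (hr b).symm.trans h2⟩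
  · rintro ⟨⟨h1, h2⟩, h3, h4⟩
    rw [h2] at hr
    refine ⟨(hl a le_rfl).trans h2, (hr b).trans h4, fun k hk => (hl k hk).symm ▸ h1 k hk,
      fun k hk hkb => ?_⟩
    obtain ⟨d, rfl⟩ := Nat.exists_eq_add_of_le hk
    rw [hr]; exact h3 d (by omega)

lemma even_of_pathHeight_eq_zero {N k : ℕ} {s : Fin N → Bool} (hk : k ≤ N)
    (h : pathHeight 0 s k = 0) : Even k := by
  have h2 : ∀ b, (stepHeight b : ZMod 2) = 1 := by intro b; cases b <;> decide
  have h1 : ((pathHeight 0 s k : ℤ) : ZMod 2) = k := by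
    simp only [pathHeight, zero_add, Int.cast_sum, Int.cast_ite, h2, Int.cast_zero]
    rw [Finset.sum_boole]
    congr 1
    rw [Fin.card_filter_val_lt]; omega
  rw [h] at h1
  exact ZMod.natCast_eq_zero_iff_even.1 (by simpa using h1.symm)

/-- Between two distinct transit points the path would have to stay on the axis, which parity
forbids already after one step. Hence the sum over transit points counts each walk once. -/
lemma TransitAt.unique {N a b : ℕ} {s : Fin N → Bool} (ha : TransitAt s a) (hb : TransitAt s b)
    (hbN : b ≤ N) (hab : a ≤ b) : a = b := by
  by_contra hne
  have h1 : pathHeight 0 s (a + 1) = 0 :=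
    le_antisymm (ha.2.2.2 _ (by omega) (by omega)) (hb.2.2.1 _ (by omega))
  have h2 := even_of_pathHeight_eq_zero (by omega) h1
  have h3 := even_of_pathHeight_eq_zero (by omega) ha.1
  grind

lemma TransitPath.exists_transitAt {n : ℕ} {s : Fin (2 * n) → Bool} (h : TransitPath s) :
    ∃ k ≤ n, TransitAt s (2 * k) := by
  obtain ⟨h1, c, hc, hc1, hc2⟩ := h
  have h0 : pathHeight 0 s c = 0 := le_antisymm (hc2 c le_rfl hc) (hc1 c le_rfl)
  obtain ⟨k, rfl⟩ := (even_of_pathHeight_eq_zero hc h0).two_dvd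
  exact ⟨k, by omega, h0, h1, hc1, hc2⟩

lemma pathSum_transitPath (z₁ z₂ : ℝ) (n : ℕ) :
    pathSum z₁ z₂ 0 (TransitPath (N := 2 * n)) =
      ∑ k ∈ Finset.range (n + 1), pathSum z₁ z₂ 0 (UpperPath 0 (N := 2 * k)) *
        pathSum z₁ z₂ 0 (LowerPath (N := 2 * (n - k))) := by
  classical
  have h : ∀ k ∈ Finset.range (n + 1), pathSum z₁ z₂ 0 (UpperPath 0 (N := 2 * k)) *
        pathSum z₁ z₂ 0 (LowerPath (N := 2 * (n - k))) =
      pathSum z₁ z₂ 0 (fun s : Fin (2 * n) → Bool => TransitAt s (2 * k)) := fun k hk => by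
    rw [pathSum_transitAt]
    have := Finset.mem_range.1 hk; omega
  rw [Finset.sum_congr rfl h]
  unfold pathSum
  rw [Finset.sum_comm]
  refine Finset.sum_congr rfl fun s _ => ?_
  by_cases hs : TransitPath s
  · obtain ⟨k, hk, hsk⟩ := hs.exists_transitAt
    rw [if_pos hs, Finset.sum_eq_single k, if_pos hsk]
    · intro l hl hlk
      have := Finset.mem_range.1 hl
      refine if_neg fun hsl => hlk ?_
      rcases Nat.le_total l k with h | h
      · have := hsl.unique hsk (by omega) (by omega); omega
      · have := hsk.unique hsl (by omega) (by omega); omega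
    · intro h; exact absurd (Finset.mem_range.2 (by omega)) h
  · rw [if_neg hs]
    refine (Finset.sum_eq_zero fun k hk => if_neg fun h => hs ?_).symm
    have := Finset.mem_range.1 hk
    exact ⟨h.2.1, 2 * k, by omega, h.2.2.1, h.2.2.2⟩

/-! ### Excursions -/

lemma pathHeight_not {N : ℕ} (s : Fin N → Bool) (k : ℕ) :
    pathHeight 0 (fun j => !s j) k = -pathHeight 0 s k := by
  have : ∀ b, stepHeight (!b) = -stepHeight b := by intro b; cases b <;> rfl
  simp only [pathHeight, zero_add, this, ← Finset.sum_neg_distrib]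
  exact Finset.sum_congr rfl fun j _ => by split_ifs <;> simp

/-- Reflection in the axis exchanges up and down steps, hence the two weights. -/
lemma pathSum_lowerPath (z₁ z₂ : ℝ) (N : ℕ) :
    pathSum z₁ z₂ 0 (LowerPath (N := N)) = pathSum z₂ z₁ 0 (UpperPath 0 (N := N)) := by
  classical
  unfold pathSum
  rw [← (Equiv.piCongrRight fun _ : Fin N => Equiv.boolNot).sum_comp]
  refine Finset.sum_congr rfl fun s _ => ?_
  change (if LowerPath (fun j => !s j) then pathWeight z₁ z₂ 0 (fun j => !s j) else 0) = _
  have h1 : LowerPath (fun j => !s j) ↔ UpperPath 0 s := by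
    simp [LowerPath, UpperPath, pathHeight_not]
  have h2 : pathWeight z₁ z₂ 0 (fun j => !s j) = pathWeight z₂ z₁ 0 s := by
    simp only [pathWeight, pathHeight_not, neg_eq_zero]
    refine Finset.prod_congr rfl fun j _ => ?_
    rcases Bool.eq_false_or_eq_true (s j) with h | h <;> simp [h]
  simp only [h1, h2]

lemma upperPath_cons {N : ℕ} {h : ℤ} (hh : 0 ≤ h) (b : Bool) (s : Fin N → Bool) :
    UpperPath h (Fin.cons b s : Fin (N + 1) → Bool) ↔ UpperPath (h + stepHeight b) s := by
  unfold UpperPath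
  rw [pathHeight_cons]
  refine and_congr_left fun _ => ⟨fun H k hk => ?_, fun H k hk => ?_⟩
  · rw [← pathHeight_cons]; exact H _ (by omega)
  · rcases k with _ | k
    · simpa using hh
    · rw [pathHeight_cons]; exact H k (by omega)

lemma pathSum_upperPath_succ (z₁ z₂ : ℝ) (N : ℕ) {h : ℤ} (hh : 0 ≤ h) :
    pathSum z₁ z₂ h (UpperPath h (N := N + 1)) =
      z₂ * pathSum z₁ z₂ (h + 1) (UpperPath (h + 1) (N := N)) +
      (if h = 1 then 1 else z₁) * pathSum z₁ z₂ (h - 1) (UpperPath (h - 1) (N := N)) := by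
  classical
  unfold pathSum
  rw [← (Fin.consEquiv fun _ => Bool).sum_comp, Fintype.sum_prod_type, Fintype.sum_bool,
    Finset.mul_sum, Finset.mul_sum]
  have e : ∀ b (s : Fin N → Bool), (Fin.consEquiv fun _ => Bool) (b, s) = Fin.cons b s :=
    fun b s => rfl
  congr 1
  · refine Finset.sum_congr rfl fun s _ => ?_
    rw [e, pathWeight_cons, if_congr (upperPath_cons hh true s) rfl rfl]
    simp only [stepHeight, if_true, if_neg (show ¬ h + 1 = 0 by omega), mul_ite, mul_zero]
  · refine Finset.sum_congr rfl fun s _ => ?_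
    rw [e, pathWeight_cons, if_congr (upperPath_cons hh false s) rfl rfl]
    simp only [stepHeight, Bool.false_eq_true, if_false, ← sub_eq_add_neg, sub_eq_zero, mul_ite,
      mul_zero]

lemma pathSum_upperPath_neg (z₁ z₂ : ℝ) (N : ℕ) :
    pathSum z₁ z₂ (-1) (UpperPath (-1) (N := N)) = 0 := by
  refine Finset.sum_eq_zero fun s _ => if_neg fun h => ?_
  have := h.1 0 (by omega)
  simp at this

/-- Total weight of the paths of `N` steps from height `h` to the axis. -/
def descentSum (z₁ z₂ : ℝ) (N h : ℕ) : ℝ := pathSum z₁ z₂ (h : ℤ) (UpperPath (h : ℤ) (N := N))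

lemma descentSum_zero_zero (z₁ z₂ : ℝ) : descentSum z₁ z₂ 0 0 = 1 := by
  simp [descentSum, pathSum, UpperPath, pathHeight, pathWeight]

lemma descentSum_zero_succ (z₁ z₂ : ℝ) (h : ℕ) : descentSum z₁ z₂ 0 (h + 1) = 0 := by
  have : ¬ ((h : ℤ) + 1 = 0) := by omega
  simp [descentSum, pathSum, UpperPath, pathHeight, this]

lemma descentSum_succ_zero (z₁ z₂ : ℝ) (N : ℕ) :
    descentSum z₁ z₂ (N + 1) 0 = z₂ * descentSum z₁ z₂ N 1 := by
  have := pathSum_upperPath_succ z₁ z₂ N (h := 0) le_rfl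
  rw [show (0 : ℤ) - 1 = -1 by rfl, pathSum_upperPath_neg, mul_zero, add_zero] at this
  exact this

lemma descentSum_succ_succ (z₁ z₂ : ℝ) (N h : ℕ) :
    descentSum z₁ z₂ (N + 1) (h + 1) =
      z₂ * descentSum z₁ z₂ N (h + 2) + (if h = 0 then 1 else z₁) * descentSum z₁ z₂ N h := by
  have := pathSum_upperPath_succ z₁ z₂ N (h := ((h + 1 : ℕ) : ℤ)) (by omega)
  rw [show ((h + 1 : ℕ) : ℤ) - 1 = (h : ℤ) by omega,
    show ((h + 1 : ℕ) : ℤ) + 1 = ((h + 2 : ℕ) : ℤ) by omega,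
    if_congr (show ((h + 1 : ℕ) : ℤ) = 1 ↔ h = 0 by omega) rfl rfl] at this
  exact this

lemma descentSum_eq_zero (z₁ z₂ : ℝ) {N h : ℕ} (hN : N < h) : descentSum z₁ z₂ N h = 0 := by
  induction N generalizing h with
  | zero => obtain ⟨h, rfl⟩ := Nat.exists_eq_succ_of_ne_zero hN.ne'; exact descentSum_zero_succ _ _ h
  | succ N ih =>
    obtain ⟨h, rfl⟩ := Nat.exists_eq_succ_of_ne_zero (by omega : h ≠ 0)
    rw [Nat.succ_eq_add_one, descentSum_succ_succ, ih (by omega), ih (by omega)]; simp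

/-- There are `j` up steps and `j + h` down steps. Descending from height `h` contributes `c^h`, and
the returns after the first arrival contribute `contactGF z₁`. For `h > 0` the factor `z₁⁻¹`
corrects for the first arrival on the axis, which has weight `1`. -/
lemma descentSum_eq {z₁ : ℝ} (z₂ : ℝ) (hz₁ : z₁ ≠ 0) (N : ℕ) : ∀ j h, N = 2 * j + h →
    descentSum z₁ z₂ N h = z₁ ^ (j + h) * z₂ ^ j * coeff j (catGF ^ h * contactGF z₁) *
      if h = 0 then 1 else z₁⁻¹ := by
  induction N with
  | zero =>
    intro j h hN
    obtain rfl : j = 0 := by omega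
    obtain rfl : h = 0 := by omega
    have := dyckSum_zero z₁
    rw [dyckSum] at this
    simp [descentSum_zero_zero, this, -coeff_zero_eq_constantCoeff]
  | succ N ih =>
    intro j h hN
    rcases h with _ | h
    · obtain ⟨j, rfl⟩ := Nat.exists_eq_succ_of_ne_zero (by omega : j ≠ 0)
      rw [descentSum_succ_zero, ih j 1 (by omega), Nat.succ_eq_add_one, pow_zero, one_mul]
      conv_rhs => rw [contactGF_succ]
      rw [map_add, coeff_succ_X_mul, coeff_C_mul, coeff_one, if_neg (by omega), pow_one]
      simp; ring
    -- The generating-function form of the choice of the first step, down or up.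
    · have hrec : catGF ^ (h + 1) * contactGF z₁ = catGF ^ h * contactGF z₁ +
          X * (catGF ^ (h + 2) * contactGF z₁) := by
        linear_combination catGF ^ h * contactGF z₁ * catGF_eq
      have hw : (if h = 0 then 1 else z₁) * (if h = 0 then 1 else z₁⁻¹) = 1 := by
        split_ifs
        · simp
        · exact mul_inv_cancel₀ hz₁
      have hz := mul_inv_cancel₀ hz₁
      rw [descentSum_succ_succ, ih j h (by omega), hrec, map_add]
      generalize (if h = 0 then (1 : ℝ) else z₁⁻¹) = w at hw ⊢
      generalize (if h = 0 then (1 : ℝ) else z₁) = v at hw ⊢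
      rcases j with _ | j
      · rw [descentSum_eq_zero _ _ (by omega), coeff_zero_X_mul, if_neg (by omega)]
        linear_combination z₁ ^ h * coeff 0 (catGF ^ h * contactGF z₁) * (hw - hz)
      · rw [ih j (h + 2) (by omega), coeff_succ_X_mul, if_neg (by omega), if_neg (by omega)]
        linear_combination z₁ ^ (j + 1 + h) * z₂ ^ (j + 1) *
          coeff (j + 1) (catGF ^ h * contactGF z₁) * (hw - hz)

lemma pathSum_upperPath {z₁ : ℝ} (z₂ : ℝ) (hz₁ : z₁ ≠ 0) (m : ℕ) :
    pathSum z₁ z₂ 0 (UpperPath 0 (N := 2 * m)) = (z₁ * z₂) ^ m * dyckSum z₁ m := by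
  have h := descentSum_eq z₂ hz₁ (2 * m) m 0 rfl
  rw [descentSum] at h
  simpa [mul_pow, dyckSum] using h

/-! ### The one-transit model -/

lemma pathSum_transitPath_eq {z₁ z₂ : ℝ} (hz₁ : z₁ ≠ 0) (hz₂ : z₂ ≠ 0) (n : ℕ) :
    pathSum z₁ z₂ 0 (TransitPath (N := 2 * n)) = (z₁ * z₂) ^ n * transitSum z₁ z₂ n := by
  rw [pathSum_transitPath, transitSum_eq_sum, Finset.mul_sum]
  refine Finset.sum_congr rfl fun k hk => ?_
  rw [pathSum_lowerPath, pathSum_upperPath _ hz₁, pathSum_upperPath _ hz₂,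
    ← Nat.add_sub_of_le (Nat.lt_succ_iff.1 (Finset.mem_range.1 hk)), pow_add, mul_comm z₂ z₁,
    Nat.add_sub_cancel_left]
  ring

lemma isOneTransit_iff {n : ℕ} (s : Fin (2 * n) → Bool) : IsOneTransit s ↔ TransitPath s := by
  simp [IsOneTransit, TransitPath, height_eq_pathHeight]

lemma Z_eq {z₁ z₂ : ℝ} (hz₁ : z₁ ≠ 0) (hz₂ : z₂ ≠ 0) (n : ℕ) :
    Z z₁ z₂ n = (z₁ * z₂) ^ n * transitSum z₁ z₂ n := by
  rw [← pathSum_transitPath_eq hz₁ hz₂]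
  classical
  exact Finset.sum_congr rfl fun s _ => if_congr (isOneTransit_iff s) (weight_eq_pathWeight _ _ s) rfl

lemma Zt_eq {z₁ z₂ : ℝ} (hz₁ : z₁ ≠ 0) (hz₂ : z₂ ≠ 0) (n : ℕ) :
    Zt z₁ z₂ n = transitSum z₁ z₂ n := by
  rw [Zt, Z_eq hz₁ hz₂, mul_div_cancel_left₀]
  exact pow_ne_zero _ (mul_ne_zero hz₁ hz₂)

lemma J_eq {z₁ z₂ : ℝ} (hz₁ : z₁ ≠ 0) (hz₂ : z₂ ≠ 0) (n : ℕ) :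
    J z₁ z₂ n = transitSum z₁ z₂ (n - 1) / transitSum z₁ z₂ n := by
  rw [J, Zt_eq hz₁ hz₂, Zt_eq hz₁ hz₂]

lemma aExp_eq {z₁ z₂ : ℝ} (hz₁ : z₁ ≠ 0) (hz₂ : z₂ ≠ 0) {n i : ℕ} (hi : i ≤ n) :
    aExp z₁ z₂ n i =
      dyckSum z₁ i * transitSum z₁ z₂ (n - i) / transitSum z₁ z₂ n := by
  have h := pathSum_contactAbove z₁ z₂ (N := 2 * n) (a := 2 * i) (b := 2 * (n - i)) (by omega)
  rw [pathSum_upperPath z₂ hz₁, pathSum_transitPath_eq hz₁ hz₂] at h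
  have e : aExp z₁ z₂ n i = pathSum z₁ z₂ 0 (fun s : Fin (2 * n) → Bool =>
      TransitPath s ∧ pathHeight 0 s (2 * i) = 0 ∧
        ∀ k, k ≤ 2 * i → 0 ≤ pathHeight 0 s k) / Z z₁ z₂ n := by
    have h2 : aExp z₁ z₂ n i = pathSum z₁ z₂ 0 (fun s : Fin (2 * n) → Bool =>
        IsOneTransit s ∧ ContactAbove s i) / Z z₁ z₂ n := by
      simp only [aExp, pathSum, weight_eq_pathWeight]
      congr!
    rw [h2]
    congr 2
    funext s
    simp only [isOneTransit_iff, ContactAbove, height_eq_pathHeight]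
  have hne : (z₁ * z₂) ^ n ≠ 0 := pow_ne_zero _ (mul_ne_zero hz₁ hz₂)
  rw [e, h, Z_eq hz₁ hz₂, ← mul_div_mul_left _ (transitSum z₁ z₂ n) hne]
  congr 1
  rw [← Nat.add_sub_of_le hi, pow_add, Nat.add_sub_cancel_left]
  ring

lemma bExp_eq {z₁ z₂ : ℝ} (hz₁ : z₁ ≠ 0) (hz₂ : z₂ ≠ 0) {n i : ℕ} (hi : i ≤ n) :
    bExp z₁ z₂ n i =
      dyckSum z₂ (n - i) * transitSum z₁ z₂ i / transitSum z₁ z₂ n := by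
  have h := pathSum_contactBelow z₁ z₂ (N := 2 * n) (a := 2 * i) (b := 2 * (n - i)) (by omega)
  rw [pathSum_lowerPath, pathSum_upperPath z₁ hz₂, pathSum_transitPath_eq hz₁ hz₂] at h
  have e : bExp z₁ z₂ n i = pathSum z₁ z₂ 0 (fun s : Fin (2 * n) → Bool =>
      TransitPath s ∧ pathHeight 0 s (2 * i) = 0 ∧
        ∀ k, 2 * i ≤ k → k ≤ 2 * n → pathHeight 0 s k ≤ 0) / Z z₁ z₂ n := by
    have h2 : bExp z₁ z₂ n i = pathSum z₁ z₂ 0 (fun s : Fin (2 * n) → Bool =>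
        IsOneTransit s ∧ ContactBelow s i) / Z z₁ z₂ n := by
      simp only [bExp, pathSum, weight_eq_pathWeight]
      congr!
    rw [h2]
    congr 2
    funext s
    simp only [isOneTransit_iff, ContactBelow, height_eq_pathHeight]
  have hne : (z₁ * z₂) ^ n ≠ 0 := pow_ne_zero _ (mul_ne_zero hz₁ hz₂)
  rw [e, h, Z_eq hz₁ hz₂, ← mul_div_mul_left _ (transitSum z₁ z₂ n) hne]
  congr 1
  rw [← Nat.add_sub_of_le hi, pow_add, Nat.add_sub_cancel_left]
  ring

end OneTransit

end

noncomputable section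

open Filter Topology

namespace OneTransit

/-! ### Averages, convolutions and regular sequences -/

/-- Only boundedly many indices near each end escape the double limit; there the error is at most `C
+ |L|`, which the average suppresses. -/
lemma tendsto_avg_abs_sub {f : ℕ × ℕ → ℝ} {L C : ℝ} (hf : Tendsto f (atTop ×ˢ atTop) (𝓝 L))
    (hC : ∀ p, |f p| ≤ C) :
    Tendsto (fun n : ℕ => (∑ i ∈ Finset.range (n + 1), |f (i, n - i) - L|) / (n + 1 : ℝ))
      atTop (𝓝 0) := by
  rw [Metric.tendsto_atTop]
  intro ε hε
  rw [prod_atTop_atTop_eq] at hf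
  obtain ⟨⟨K₁, K₂⟩, hK⟩ := (Metric.tendsto_atTop.1 hf) (ε / 2) (by positivity)
  set K := max K₁ K₂
  have hC0 : 0 ≤ C := (abs_nonneg _).trans (hC (0, 0))
  set D := C + |L| with hD
  have hD0 : 0 ≤ D := by positivity
  have hpt : ∀ n i, |f (i, n - i) - L| ≤
      ε / 2 + (if i < K then D else 0) + if n - i < K then D else 0 := by
    intro n i
    have hle : |f (i, n - i) - L| ≤ D :=
      (abs_sub _ _).trans (add_le_add (hC _) le_rfl)
    by_cases h1 : i < K
    · rw [if_pos h1]; split_ifs <;> linarith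
    · by_cases h2 : n - i < K
      · rw [if_neg h1, if_pos h2]; linarith
      · have := hK (i, n - i) ⟨by simp only; omega, by simp only; omega⟩
        rw [Real.dist_eq] at this
        rw [if_neg h1, if_neg h2]; linarith
  have hsum : ∀ n : ℕ, ∑ i ∈ Finset.range (n + 1), |f (i, n - i) - L| ≤
      (n + 1) * (ε / 2) + 2 * (K * D) := by
    intro n
    have hA : ∑ i ∈ Finset.range (n + 1), (if i < K then D else 0) ≤ K * D := by
      rw [← Finset.sum_filter, Finset.sum_const, nsmul_eq_mul]
      refine mul_le_mul_of_nonneg_right ?_ hD0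
      have : ((Finset.range (n + 1)).filter fun i => i < K) ⊆ Finset.range K := fun i hi => by
        simp at hi ⊢; exact hi.2
      simpa using Finset.card_le_card this
    have hB : ∑ i ∈ Finset.range (n + 1), (if n - i < K then D else 0) ≤ K * D := by
      have := Finset.sum_range_reflect (fun i => if i < K then D else 0) (n + 1)
      refine le_trans (le_of_eq ?_) hA
      rw [← this]
      exact Finset.sum_congr rfl fun i _ => by simp
    calc _ ≤ ∑ i ∈ Finset.range (n + 1),
          (ε / 2 + (if i < K then D else 0) + if n - i < K then D else 0) :=
          Finset.sum_le_sum fun i _ => hpt n i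
      _ = (n + 1) * (ε / 2) + ∑ i ∈ Finset.range (n + 1), (if i < K then D else 0) +
          ∑ i ∈ Finset.range (n + 1), (if n - i < K then D else 0) := by
          rw [Finset.sum_add_distrib, Finset.sum_add_distrib]; simp
      _ ≤ _ := by linarith
  obtain ⟨N, hN⟩ := exists_nat_gt (2 * (K * D) / (ε / 2))
  refine ⟨N, fun n hn => ?_⟩
  have hn1 : (0 : ℝ) < n + 1 := by positivity
  rw [Real.dist_eq, sub_zero, abs_of_nonneg (by positivity), div_lt_iff₀ hn1]
  refine (hsum n).trans_lt ?_
  rw [div_lt_iff₀ (by positivity)] at hN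
  have : (N : ℝ) ≤ n := by exact_mod_cast hn
  nlinarith

lemma tendsto_weighted_avg {f : ℕ × ℕ → ℝ} {w : ℕ → ℕ → ℝ} {L C W : ℝ}
    (hf : Tendsto f (atTop ×ˢ atTop) (𝓝 L)) (hC : ∀ p, |f p| ≤ C)
    (hw : ∀ n i, |w n i| ≤ 1)
    (hW : Tendsto (fun n : ℕ => (∑ i ∈ Finset.range (n + 1), w n i) / (n + 1 : ℝ)) atTop (𝓝 W)) :
    Tendsto (fun n : ℕ => (∑ i ∈ Finset.range (n + 1), f (i, n - i) * w n i) / (n + 1 : ℝ))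
      atTop (𝓝 (L * W)) := by
  have h1 : Tendsto (fun n : ℕ =>
      (∑ i ∈ Finset.range (n + 1), (f (i, n - i) - L) * w n i) / (n + 1 : ℝ)) atTop (𝓝 0) := by
    refine squeeze_zero_norm (fun n => ?_) (tendsto_avg_abs_sub hf hC)
    rw [Real.norm_eq_abs, abs_div, abs_of_nonneg (by positivity : (0 : ℝ) ≤ n + 1)]
    gcongr
    refine (Finset.abs_sum_le_sum_abs _ _).trans (Finset.sum_le_sum fun i _ => ?_)
    rw [abs_mul]
    exact mul_le_of_le_one_right (abs_nonneg _) (hw n i)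
  have h2 := h1.add (hW.const_mul L)
  rw [zero_add] at h2
  refine h2.congr fun n => ?_
  simp only [sub_mul, Finset.sum_sub_distrib, ← Finset.mul_sum]
  ring

lemma tendsto_avg {f : ℕ × ℕ → ℝ} {L C : ℝ} (hf : Tendsto f (atTop ×ˢ atTop) (𝓝 L))
    (hC : ∀ p, |f p| ≤ C) :
    Tendsto (fun n : ℕ => (∑ i ∈ Finset.range (n + 1), f (i, n - i)) / (n + 1 : ℝ))
      atTop (𝓝 L) := by
  have := tendsto_weighted_avg (w := fun _ _ => 1) (W := 1) hf hC (by simp)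
    (tendsto_const_nhds.congr fun n => by
      have : (n : ℝ) + 1 ≠ 0 := by positivity
      simp [this])
  simpa using this

lemma exists_abs_le_of_tendsto {u : ℕ → ℝ} {r : ℝ} (hu : Tendsto u atTop (𝓝 r)) :
    ∃ C, ∀ n, |u n| ≤ C := by
  obtain ⟨C, hC⟩ := hu.abs.bddAbove_range
  exact ⟨C, fun n => hC ⟨n, rfl⟩⟩

/-- Dominated convergence after reversing the sum, so that the summable factor carries the summation
index. -/
lemma tendsto_convolution {u l : ℕ → ℝ} {r : ℝ} (hu : Tendsto u atTop (𝓝 r)) (hl : ∀ n, 0 ≤ l n)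
    (hs : Summable l) :
    Tendsto (fun n => ∑ k ∈ Finset.range (n + 1), u k * l (n - k)) atTop (𝓝 (r * ∑' k, l k)) := by
  obtain ⟨C, hC⟩ := exists_abs_le_of_tendsto hu
  have hC0 : 0 ≤ C := (abs_nonneg _).trans (hC 0)
  have h := tendsto_tsum_of_dominated_convergence (𝓕 := atTop)
    (f := fun n k => if k < n + 1 then u (n - k) * l k else 0) (g := fun k => r * l k)
    (bound := fun k => C * l k) (hs.mul_left C)
    (fun k => by
      have h1 : Tendsto (fun n => u (n - k) * l k) atTop (𝓝 (r * l k)) :=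
        (hu.comp (tendsto_sub_atTop_nat k)).mul_const _
      refine h1.congr' ?_
      filter_upwards [eventually_ge_atTop k] with n hn
      rw [if_pos (by omega)])
    (Eventually.of_forall fun n k => by
      split_ifs
      · rw [Real.norm_eq_abs, abs_mul, abs_of_nonneg (hl k)]
        exact mul_le_mul_of_nonneg_right (hC _) (hl k)
      · simpa using mul_nonneg hC0 (hl k))
  rw [tsum_mul_left] at h
  refine h.congr fun n => ?_
  rw [tsum_eq_sum (s := Finset.range (n + 1)) fun k hk => if_neg (by simpa using hk),
    ← Finset.sum_range_reflect]
  refine Finset.sum_congr rfl fun k hk => ?_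
  have := Finset.mem_range.1 hk
  rw [if_pos (by omega)]
  congr 2
  omega

/-- Positive sequences without exponential growth whose values at comparable large arguments are
comparable. -/
structure RegularSeq (y : ℕ → ℝ) : Prop where
  pos : ∀ n, 0 < y n
  ratio : Tendsto (fun n => y n / y (n + 1)) atTop (𝓝 1)
  bound : ∀ δ : ℝ, 0 < δ → ∃ M : ℝ, ∀ m n : ℕ, m ≤ n → δ * n ≤ m → y m ≤ M * y n

lemma RegularSeq.of_tendsto {w y : ℕ → ℝ} {K : ℝ} (hw : RegularSeq w) (hy : ∀ n, 0 < y n)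
    (hK : 0 < K) (h : Tendsto (fun n => y n / w n) atTop (𝓝 K)) : RegularSeq y := by
  refine ⟨hy, ?_, fun δ hδ => ?_⟩
  · have h1 := (h.div (h.comp (tendsto_add_atTop_nat 1)) hK.ne').mul hw.ratio
    rw [div_self hK.ne', one_mul] at h1
    refine h1.congr fun n => ?_
    have := (hw.pos n).ne'
    have := (hw.pos (n + 1)).ne'
    have := (hy (n + 1)).ne'
    simp only [Function.comp_apply, Pi.div_apply]
    field_simp
  · obtain ⟨M, hM⟩ := hw.bound δ hδ
    obtain ⟨B, hB⟩ := exists_abs_le_of_tendsto h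
    obtain ⟨B', hB'⟩ := exists_abs_le_of_tendsto (h.inv₀ hK.ne')
    refine ⟨B * (M * B'), fun m n hmn hm => ?_⟩
    have h1 : y m ≤ B * w m := (div_le_iff₀ (hw.pos m)).1 ((le_abs_self _).trans (hB m))
    have h2 : w n ≤ B' * y n := by
      have := (le_abs_self _).trans (hB' n)
      rw [inv_div] at this
      exact (div_le_iff₀ (hy n)).1 this
    have hB0 : 0 ≤ B := (abs_nonneg _).trans (hB 0)
    have h3 := hM m n hmn hm
    have hM0 : 0 ≤ M := by
      by_contra hneg
      have := mul_neg_of_neg_of_pos (not_le.1 hneg) (hw.pos n)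
      linarith [hw.pos m]
    calc y m ≤ B * w m := h1
      _ ≤ B * (M * (B' * y n)) := by gcongr; exact h3.trans (by gcongr)
      _ = _ := by ring

lemma tendsto_natCast_add_one_div : Tendsto (fun n : ℕ => ((n : ℝ) + 1) / (n + 2)) atTop (𝓝 1) := by
  have h := (tendsto_natCast_div_add_atTop (1 : ℝ)).comp (tendsto_add_atTop_nat 1)
  refine h.congr fun n => ?_
  simp only [Function.comp_apply, Nat.cast_add, Nat.cast_one]
  ring

lemma regularSeq_one : RegularSeq fun _ => 1 :=
  ⟨by simp, by simp, fun _ _ => ⟨1, by simp⟩⟩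

lemma regularSeq_add_one : RegularSeq fun n => (n : ℝ) + 1 := by
  refine ⟨fun n => by positivity, ?_, fun δ _ => ⟨1, fun m n h _ => ?_⟩⟩
  · refine tendsto_natCast_add_one_div.congr fun n => ?_
    push_cast; ring
  · have : (m : ℝ) ≤ n := by exact_mod_cast h
    linarith

lemma add_one_le_of_mul_le {δ : ℝ} (hδ : 0 < δ) {m n : ℕ} (h : δ * n ≤ m) :
    (n : ℝ) + 1 ≤ (1 / δ + 1) * (m + 1) := by
  have h1 : (n : ℝ) ≤ m / δ := by rw [le_div_iff₀ hδ]; linarith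
  have h2 : (0 : ℝ) ≤ 1 / δ := by positivity
  have h3 : (m : ℝ) / δ = 1 / δ * m := by ring
  have : (0 : ℝ) ≤ m := by positivity
  nlinarith

lemma RegularSeq.div_add_one {w : ℕ → ℝ} (hw : RegularSeq w) :
    RegularSeq fun n => w n / (n + 1) := by
  refine ⟨fun n => div_pos (hw.pos n) (by positivity), ?_, fun δ hδ => ?_⟩
  · have h := hw.ratio.mul (tendsto_natCast_add_one_div.inv₀ one_ne_zero)
    rw [inv_one, mul_one] at h
    refine h.congr fun n => ?_
    have := (hw.pos (n + 1)).ne'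
    push_cast
    field_simp
    ring
  · obtain ⟨M, hM⟩ := hw.bound δ hδ
    refine ⟨M * (1 / δ + 1), fun m n hmn hm => ?_⟩
    have h1 := add_one_le_of_mul_le hδ hm
    have h2 := hM m n hmn hm
    rw [div_le_iff₀ (by positivity)]
    have h3 : 0 ≤ M * w n := (hw.pos m).le.trans h2
    calc w m ≤ M * w n := h2
      _ = M * w n * ((n + 1) / (n + 1)) := by rw [div_self (by positivity), mul_one]
      _ ≤ M * w n * ((1 / δ + 1) * (m + 1) / (n + 1)) := by gcongr
      _ = _ := by ring

lemma prod_add_one_le (i j : ℕ) : ((i + j : ℕ) : ℝ) + 1 ≤ ((i : ℝ) + 1) * (j + 1) := by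
  have : (0 : ℝ) ≤ i * j := by positivity
  push_cast; nlinarith

/-! ### The central binomial and Catalan sequences -/

/-- The normalised central binomial coefficients. -/
def centralSeq (n : ℕ) : ℝ := (n + 1) * catalan n / 4 ^ n

lemma catalan_pos' (n : ℕ) : (0 : ℝ) < catalan n := by exact_mod_cast catalan_pos n

lemma centralSeq_pos (n : ℕ) : 0 < centralSeq n :=
  div_pos (mul_pos (by positivity) (catalan_pos' n)) (by positivity)

lemma centralSeq_succ (n : ℕ) :
    centralSeq (n + 1) = (2 * n + 1) / (2 * n + 2) * centralSeq n := by
  have h := catalan_succ_mul n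
  have hn : (n : ℝ) + 1 ≠ 0 := by positivity
  have : centralSeq (n + 1) = ((n : ℝ) + 2) * catalan (n + 1) / (4 * 4 ^ n) := by
    rw [centralSeq, pow_succ']; push_cast; ring
  rw [this, h, centralSeq]
  field_simp
  ring

/-- The sequence `(2n+1) s_n²` is nonincreasing. With the matching lower bound in `le_centralSeq_sq`
this gives the order `n^(-1/2)` without Stirling. -/
lemma centralSeq_sq_le (n : ℕ) : centralSeq n ^ 2 ≤ 1 / (n + 1) := by
  have h : ∀ n : ℕ, centralSeq n ^ 2 * (2 * n + 1) ≤ 1 := by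
    intro n
    induction n with
    | zero => simp [centralSeq]
    | succ n ih =>
      rw [centralSeq_succ]
      refine le_trans ?_ ih
      have : ((2 * (n : ℝ) + 1) / (2 * n + 2) * centralSeq n) ^ 2 * (2 * ((n + 1 : ℕ) : ℝ) + 1) =
          centralSeq n ^ 2 * (2 * n + 1) * ((2 * n + 1) * (2 * n + 3) / (2 * n + 2) ^ 2) := by
        push_cast
        field_simp
        ring
      rw [this]
      refine mul_le_of_le_one_right (by positivity) ?_
      rw [div_le_one (by positivity)]
      nlinarith
  rw [le_div_iff₀ (by positivity)]
  refine le_trans ?_ (h n)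
  have : (0 : ℝ) ≤ n := by positivity
  gcongr
  linarith

/-- For `n ≥ 1` the sequence `4 n s_n²` is nondecreasing and starts at `1`. -/
lemma le_centralSeq_sq (n : ℕ) : 1 / (4 * ((n : ℝ) + 1)) ≤ centralSeq n ^ 2 := by
  rw [div_le_iff₀ (by positivity)]
  have h : ∀ n : ℕ, 1 ≤ centralSeq (n + 1) ^ 2 * (4 * (n + 1)) := by
    intro n
    induction n with
    | zero => norm_num [centralSeq_succ, centralSeq]
    | succ n ih =>
      rw [centralSeq_succ]
      refine ih.trans ?_
      have : ((2 * ((n + 1 : ℕ) : ℝ) + 1) / (2 * ((n + 1 : ℕ) : ℝ) + 2) * centralSeq (n + 1)) ^ 2 *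
          (4 * (((n + 1 : ℕ) : ℝ) + 1)) =
          centralSeq (n + 1) ^ 2 * (4 * (n + 1)) *
            ((2 * n + 3) ^ 2 / ((2 * n + 4) * (2 * n + 2))) := by
        push_cast
        field_simp
        ring
      rw [this]
      refine le_mul_of_one_le_right (by positivity) ?_
      rw [one_le_div (by positivity)]
      nlinarith
  rcases n with _ | n
  · simp [centralSeq]
  · refine (h n).trans ?_
    push_cast
    gcongr
    linarith

lemma regularSeq_centralSeq : RegularSeq centralSeq := by
  refine ⟨centralSeq_pos, ?_, fun δ hδ => ⟨4 * (1 / δ + 1), fun m n _ hm => ?_⟩⟩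
  · have h : Tendsto (fun n : ℕ => 1 + 1 / (2 * (n : ℝ) + 1)) atTop (𝓝 (1 + 0)) := by
      refine tendsto_const_nhds.add ?_
      refine tendsto_const_nhds.div_atTop ?_
      exact tendsto_atTop_add_const_right _ _
        (tendsto_natCast_atTop_atTop.const_mul_atTop (by norm_num))
    rw [add_zero] at h
    refine h.congr fun n => ?_
    have := (centralSeq_pos n).ne'
    rw [centralSeq_succ]
    field_simp
    ring
  · have h1 := add_one_le_of_mul_le hδ hm
    have hA : 1 ≤ 4 * (1 / δ + 1) := by
      have : 0 < 1 / δ := by positivity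
      linarith
    have h0 := (centralSeq_pos n).le
    refine le_of_sq_le_sq ?_ (by positivity)
    calc centralSeq m ^ 2 ≤ 1 / (m + 1) := centralSeq_sq_le m
      _ ≤ 4 * (1 / δ + 1) * (1 / (4 * (n + 1))) := by
          rw [div_le_iff₀ (by positivity)]
          rw [show 4 * (1 / δ + 1) * (1 / (4 * ((n : ℝ) + 1))) * (m + 1) =
            (1 / δ + 1) * (m + 1) / (n + 1) by field_simp]
          rwa [le_div_iff₀ (by positivity), one_mul]
      _ ≤ 4 * (1 / δ + 1) * centralSeq n ^ 2 := by gcongr; exact le_centralSeq_sq n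
      _ ≤ (4 * (1 / δ + 1)) ^ 2 * centralSeq n ^ 2 := by
          gcongr; exact le_self_pow₀ hA (by norm_num)
      _ = _ := by ring

lemma regularSeq_catalan : RegularSeq fun n => (catalan n : ℝ) / 4 ^ n := by
  have h := regularSeq_centralSeq.div_add_one
  have e : (fun n : ℕ => centralSeq n / ((n : ℝ) + 1)) = fun n => (catalan n : ℝ) / 4 ^ n := by
    funext n
    rw [centralSeq]
    field_simp
  rwa [e] at h

lemma tendsto_of_sq_tendsto_zero {ι : Type*} {l : Filter ι} {f : ι → ℝ}
    (h : Tendsto (fun i => f i ^ 2) l (𝓝 0)) : Tendsto f l (𝓝 0) := by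
  have := (Real.continuous_sqrt.tendsto 0).comp h
  rw [Real.sqrt_zero] at this
  refine (tendsto_zero_iff_abs_tendsto_zero f).2 (this.congr fun i => ?_)
  simp [Real.sqrt_sq_eq_abs]

lemma tendsto_centralSeq : Tendsto centralSeq atTop (𝓝 0) :=
  tendsto_of_sq_tendsto_zero (squeeze_zero (fun _ => sq_nonneg _) centralSeq_sq_le
    tendsto_one_div_add_atTop_nhds_zero_nat)

lemma tendsto_centralSeq_mul_div : Tendsto (fun p : ℕ × ℕ =>
    centralSeq p.1 * centralSeq p.2 / centralSeq (p.1 + p.2)) (atTop ×ˢ atTop) (𝓝 0) := by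
  have h1 : Tendsto (fun p : ℕ × ℕ => 4 * (1 / ((p.1 : ℝ) + 1) + 1 / ((p.2 : ℝ) + 1)))
      (atTop ×ˢ atTop) (𝓝 (4 * (0 + 0))) :=
    ((tendsto_one_div_add_atTop_nhds_zero_nat.comp tendsto_fst).add
      (tendsto_one_div_add_atTop_nhds_zero_nat.comp tendsto_snd)).const_mul 4
  rw [add_zero, mul_zero] at h1
  refine tendsto_of_sq_tendsto_zero (squeeze_zero (fun _ => sq_nonneg _) (fun p => ?_) h1)
  obtain ⟨i, j⟩ := p
  have h := le_centralSeq_sq (i + j)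
  have hp := centralSeq_pos (i + j)
  rw [div_pow, mul_pow, div_le_iff₀ (by positivity)]
  have h2 := prod_add_one_le i j
  calc centralSeq i ^ 2 * centralSeq j ^ 2 ≤ 1 / (i + 1) * (1 / (j + 1)) := by
        gcongr
        · exact centralSeq_sq_le i
        · exact centralSeq_sq_le j
    _ ≤ 4 * (1 / ((i : ℝ) + 1) + 1 / ((j : ℝ) + 1)) * (1 / (4 * (((i + j : ℕ) : ℝ) + 1))) := by
        rw [← sub_nonneg]
        have : 4 * (1 / ((i : ℝ) + 1) + 1 / ((j : ℝ) + 1)) * (1 / (4 * (((i + j : ℕ) : ℝ) + 1))) -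
          1 / (i + 1) * (1 / (j + 1)) = 1 / ((i + 1) * (j + 1) * (i + j + 1)) := by
          push_cast
          field_simp
          ring
        rw [this]; positivity
    _ ≤ _ := by gcongr

lemma tendsto_catalan_mul_div : Tendsto (fun p : ℕ × ℕ =>
    (catalan p.1 : ℝ) / 4 ^ p.1 * ((catalan p.2 : ℝ) / 4 ^ p.2) /
      ((catalan (p.1 + p.2) : ℝ) / 4 ^ (p.1 + p.2))) (atTop ×ˢ atTop) (𝓝 0) := by
  have e : ∀ n, (catalan n : ℝ) / 4 ^ n = centralSeq n / (n + 1) := fun n => by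
    rw [centralSeq]; field_simp
  refine squeeze_zero (fun p => by positivity) (fun p => ?_) tendsto_centralSeq_mul_div
  obtain ⟨i, j⟩ := p
  have := centralSeq_pos i
  have := centralSeq_pos j
  have := centralSeq_pos (i + j)
  simp only [e]
  have h : centralSeq i / (i + 1) * (centralSeq j / (j + 1)) /
      (centralSeq (i + j) / (((i + j : ℕ) : ℝ) + 1)) =
      centralSeq i * centralSeq j / centralSeq (i + j) *
        ((((i + j : ℕ) : ℝ) + 1) / ((i + 1) * (j + 1))) := by field_simp
  rw [h]
  refine mul_le_of_le_one_right (by positivity) ?_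
  rw [div_le_one (by positivity)]
  exact prod_add_one_le i j

end OneTransit

end

noncomputable section

open Filter Topology

namespace OneTransit

/-! ### Catalan sums and excursion weights -/

/-- The two-term recursion telescopes after rescaling. Positivity of the left side then bounds the
Catalan partial sums, even at the radius of convergence `1/4`. -/
lemma pow_mul_dyckSum {z : ℝ} (hz : z ≠ 0) (n : ℕ) :
    (z * (1 - z)) ^ n * dyckSum z n =
      1 - z * ∑ k ∈ Finset.range n, (catalan k : ℝ) * (z * (1 - z)) ^ k := by
  induction n with
  | zero => simp
  | succ n ih =>
    rw [Finset.sum_range_succ, pow_succ, mul_assoc, dyckSum_step hz, mul_sub, ih]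
    ring

lemma sum_catalan_le {z : ℝ} (hz : 0 < z) (hz1 : z < 1) (n : ℕ) :
    ∑ k ∈ Finset.range n, (catalan k : ℝ) * (z * (1 - z)) ^ k ≤ 1 / z := by
  have h := pow_mul_dyckSum hz.ne' n
  have h1 : 0 ≤ (z * (1 - z)) ^ n * dyckSum z n :=
    mul_nonneg (pow_nonneg (mul_nonneg hz.le (by linarith)) _) (dyckSum_pos hz n).le
  rw [le_div_iff₀ hz]
  linarith

lemma catalan_mul_pow_nonneg {z : ℝ} (hz : 0 < z) (hz1 : z < 1) (k : ℕ) :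
    0 ≤ (catalan k : ℝ) * (z * (1 - z)) ^ k :=
  mul_nonneg (by positivity) (pow_nonneg (mul_nonneg hz.le (by linarith)) _)

lemma summable_catalan {z : ℝ} (hz : 0 < z) (hz1 : z < 1) :
    Summable fun k => (catalan k : ℝ) * (z * (1 - z)) ^ k :=
  summable_of_sum_range_le (catalan_mul_pow_nonneg hz hz1) (sum_catalan_le hz hz1)

/-- The sum satisfies the Catalan quadratic, whose roots are `1/z` and `1/(1-z)`. The partial-sum
bound at the conjugate parameter `1 - z` selects the smaller root. -/
lemma tsum_catalan {z : ℝ} (hz : 0 < z) (hz2 : z ≤ 1 / 2) :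
    ∑' k, (catalan k : ℝ) * (z * (1 - z)) ^ k = 1 / (1 - z) := by
  have hz1 : z < 1 := by linarith
  have hs := summable_catalan hz hz1
  set f : ℕ → ℝ := fun k => (catalan k : ℝ) * (z * (1 - z)) ^ k with hf
  set S := ∑' k, f k with hS
  have hle : S ≤ 1 / (1 - z) := by
    refine hs.tsum_le_of_sum_range_le fun n => ?_
    have := sum_catalan_le (z := 1 - z) (by linarith) (by linarith) n
    rwa [sub_sub_cancel, mul_comm (1 - z) z] at this
  have hquad : S = 1 + z * (1 - z) * S ^ 2 := by
    have h1 := hs.tsum_eq_zero_add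
    have h2 := tsum_mul_tsum_eq_tsum_sum_antidiagonal_of_summable_norm hs.norm hs.norm
    have h3 : ∀ n, f (n + 1) = z * (1 - z) *
        ∑ kl ∈ Finset.HasAntidiagonal.antidiagonal n, f kl.1 * f kl.2 := by
      intro n
      simp only [hf]
      rw [catalan_succ', Nat.cast_sum, Finset.sum_mul, Finset.mul_sum]
      refine Finset.sum_congr rfl fun p hp => ?_
      rw [← Finset.HasAntidiagonal.mem_antidiagonal.1 hp]
      push_cast
      ring
    rw [← hS, tsum_congr h3, tsum_mul_left, ← h2] at h1
    simpa [hf, sq] using h1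
  have hfac : (z * S - 1) * ((1 - z) * S - 1) = 0 := by linear_combination -hquad
  have h1z : 0 < 1 - z := by linarith
  rcases mul_eq_zero.1 hfac with h | h
  · have h1 : S = 1 / z := by field_simp; linarith
    have h2 : 1 / (1 - z) ≤ 1 / z := one_div_le_one_div_of_le hz (by linarith)
    have h3 : 1 / (1 - z) = 1 / z := le_antisymm h2 (h1 ▸ hle)
    rw [h3, h1]
  · field_simp; linarith

lemma tendsto_pow_mul_dyckSum {z : ℝ} (hz : 0 < z) (hz2 : z ≤ 1 / 2) :
    Tendsto (fun n => (z * (1 - z)) ^ n * dyckSum z n) atTop (𝓝 (contactRho z)) := by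
  have h := ((summable_catalan hz (by linarith)).hasSum.tendsto_sum_nat.const_mul z).const_sub 1
  rw [tsum_catalan hz hz2] at h
  have e : 1 - z * (1 / (1 - z)) = contactRho z := by
    have : 1 - z ≠ 0 := by linarith
    rw [contactRho]; field_simp; ring
  rw [e] at h
  exact h.congr fun n => (pow_mul_dyckSum hz.ne' n).symm

lemma contactRho_pos {z : ℝ} (hz2 : z < 1 / 2) : 0 < contactRho z :=
  div_pos (by linarith) (by linarith)

lemma pow_mul_dyckSum_le_one {z : ℝ} (hz : 0 < z) (hz1 : z < 1) (n : ℕ) :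
    (z * (1 - z)) ^ n * dyckSum z n ≤ 1 := by
  rw [pow_mul_dyckSum hz.ne']
  have := Finset.sum_nonneg fun k (_ : k ∈ Finset.range n) => catalan_mul_pow_nonneg hz hz1 k
  nlinarith

/-- The weight at `w` grows at most like `(v(1-v))^(-n)` with `v = min w (1/2)`. Since `t(1-t)`
increases up to `1/2`, a geometric series dominates. -/
lemma summable_pow_mul_dyckSum {z w : ℝ} (hz : 0 < z) (hz2 : z < 1 / 2) (hzw : z < w) :
    Summable fun n => (z * (1 - z)) ^ n * dyckSum w n := by
  set v := min w (1 / 2) with hv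
  have hzv : z < v := lt_min hzw hz2
  have hv2 : v ≤ 1 / 2 := min_le_right _ _
  have hx : 0 < z * (1 - z) := mul_pos hz (by linarith)
  have hv0 : 0 < v * (1 - v) := mul_pos (by linarith) (by linarith)
  have hxv : z * (1 - z) < v * (1 - v) := by nlinarith
  refine Summable.of_nonneg_of_le
    (fun n => mul_nonneg (pow_nonneg hx.le _) (dyckSum_pos (by linarith) n).le) (fun n => ?_)
    (summable_geometric_of_lt_one (div_pos hx hv0).le ((div_lt_one hv0).2 hxv))
  have h1 := pow_mul_dyckSum_le_one (z := v) (by linarith) (by linarith) n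
  have h2 := dyckSum_anti (z := v) (z' := w) (by linarith) (min_le_left _ _) n
  rw [div_pow, le_div_iff₀ (pow_pos hv0 _)]
  calc (z * (1 - z)) ^ n * dyckSum w n * (v * (1 - v)) ^ n
      ≤ (z * (1 - z)) ^ n * dyckSum v n * (v * (1 - v)) ^ n := by
        gcongr
    _ = (z * (1 - z)) ^ n * ((v * (1 - v)) ^ n * dyckSum v n) := by ring
    _ ≤ (z * (1 - z)) ^ n := mul_le_of_le_one_right (pow_nonneg hx.le _) h1

/-! ### Powers of the Catalan series -/

/-- The coefficients of the powers of `x C(x)`. -/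
def ballot (p n : ℕ) : ℝ := PowerSeries.coeff n ((PowerSeries.X * catGF) ^ p)

lemma ballot_of_lt {p n : ℕ} (h : n < p) : ballot p n = 0 := by
  rw [ballot, mul_pow, PowerSeries.coeff_X_pow_mul', if_neg (by omega)]

lemma ballot_zero (n : ℕ) : ballot 0 n = if n = 0 then 1 else 0 := by
  rw [ballot, pow_zero, PowerSeries.coeff_one]

lemma ballot_one (n : ℕ) : ballot 1 (n + 1) = catalan n := by
  rw [ballot, pow_one, PowerSeries.coeff_succ_X_mul, coeff_catGF]

lemma ballot_succ_succ (p n : ℕ) : ballot (p + 2) (n + 1) = ballot (p + 1) (n + 1) - ballot p n := by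
  have h : (PowerSeries.X * catGF) ^ (p + 2) = (PowerSeries.X * catGF) ^ (p + 1) -
      PowerSeries.X * (PowerSeries.X * catGF) ^ p := by
    linear_combination -(PowerSeries.X * catGF) ^ p * PowerSeries.X * catGF_eq
  rw [ballot, h, map_sub, PowerSeries.coeff_succ_X_mul]
  rfl

/-- The Lagrange inversion formula with its denominator cleared, which keeps `m = p = 0` harmless.
It follows by double induction from `c^(p+1) = c^p + X c^(p+2)`. -/
lemma mul_coeff_catGF_pow (m : ℕ) : ∀ p : ℕ,
    (2 * m + p : ℝ) * PowerSeries.coeff m (catGF ^ p) = p * (2 * m + p).choose m := by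
  induction m with
  | zero => intro p; simp [catGF]
  | succ m ihm =>
    intro p
    induction p with
    | zero => simp [PowerSeries.coeff_one]
    | succ p ihp =>
      have hrec : catGF ^ (p + 1) = catGF ^ p + PowerSeries.X * catGF ^ (p + 2) := by
        linear_combination catGF ^ p * catGF_eq
      have h1 := ihm (p + 2)
      rw [hrec, map_add, PowerSeries.coeff_succ_X_mul]
      set A := PowerSeries.coeff (m + 1) (catGF ^ p)
      set B := PowerSeries.coeff m (catGF ^ (p + 2))
      have e1 : 2 * (m + 1) + (p + 1) = 2 * m + (p + 2) + 1 := by ring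
      have e2 : 2 * (m + 1) + p = 2 * m + (p + 2) := by ring
      rw [e2] at ihp
      rw [e1, Nat.choose_succ_succ]
      have h2 : ((m : ℝ) + 1) * (2 * m + (p + 2)).choose (m + 1) =
          (m + p + 2) * (2 * m + (p + 2)).choose m := by
        have := Nat.choose_succ_right_eq (2 * m + (p + 2)) m
        rw [show 2 * m + (p + 2) - m = m + p + 2 by omega] at this
        have h3 : ((2 * m + (p + 2)).choose (m + 1) : ℝ) * (m + 1) =
          (2 * m + (p + 2)).choose m * (m + p + 2) := by exact_mod_cast this
        linarith
      set X := ((2 * m + (p + 2)).choose m : ℝ)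
      set Y := ((2 * m + (p + 2)).choose (m + 1) : ℝ)
      push_cast at ihp h1 ⊢
      have hm : (m : ℝ) + 1 ≠ 0 := by positivity
      have hN : (2 * (m : ℝ) + p + 2) ≠ 0 := by positivity
      have hY : Y = (m + p + 2) * X / (m + 1) := by field_simp; linarith
      have hA : A = p * Y / (2 * m + p + 2) := by field_simp; linarith
      have hB : B = (p + 2) * X / (2 * m + p + 2) := by field_simp; linarith
      change (2 * ((m : ℝ) + 1) + (p + 1)) * (A + B) = (p + 1) * ((X : ℝ) + Y)
      rw [hA, hB, hY]
      field_simp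
      ring

lemma ballot_nonneg (p n : ℕ) : 0 ≤ ballot p n := by
  rcases Nat.lt_or_ge n p with h | h
  · rw [ballot_of_lt h]
  · obtain ⟨m, rfl⟩ := Nat.exists_eq_add_of_le h
    rcases p with _ | p
    · rw [ballot_zero]; split_ifs <;> norm_num
    · rw [ballot, mul_pow, add_comm, PowerSeries.coeff_X_pow_mul]
      have h1 := mul_coeff_catGF_pow m (p + 1)
      have h2 : (0 : ℝ) < 2 * m + (p + 1 : ℕ) := by push_cast; positivity
      refine nonneg_of_mul_nonneg_right (a := (2 * m + (p + 1 : ℕ) : ℝ)) ?_ h2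
      rw [h1]; positivity

/-- Equivalently, `ballot p n` divided by `p/2^p` is nonincreasing in `p ≥ 1`, which yields a
majorant in `p` uniform in `n`. The slack is `p(p-1)` times a nonnegative coefficient. -/
lemma two_mul_ballot_succ_le {p : ℕ} (hp : 1 ≤ p) (n : ℕ) :
    2 * p * ballot (p + 1) n ≤ (p + 1) * ballot p n := by
  rcases Nat.lt_or_ge n (p + 1) with h | h
  · rw [ballot_of_lt h, mul_zero]
    exact mul_nonneg (by positivity) (ballot_nonneg p n)
  · obtain ⟨m, rfl⟩ := Nat.exists_eq_add_of_le h
    have e1 : ballot (p + 1) (p + 1 + m) = PowerSeries.coeff m (catGF ^ (p + 1)) := by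
      rw [ballot, mul_pow, add_comm, PowerSeries.coeff_X_pow_mul]
    have e2 : ballot p (p + 1 + m) = PowerSeries.coeff (m + 1) (catGF ^ p) := by
      rw [ballot, mul_pow, show p + 1 + m = m + 1 + p by ring, PowerSeries.coeff_X_pow_mul]
    have hnn := ballot_nonneg (p + 1) (p + 1 + m)
    rw [e1] at hnn
    rw [e1, e2]
    have h1 := mul_coeff_catGF_pow m (p + 1)
    have h2 := mul_coeff_catGF_pow (m + 1) p
    have h3 : (2 * (m : ℝ) + p + 2) * (2 * m + (p + 1)).choose m =
        (2 * (m + 1) + p).choose (m + 1) * (m + 1) := by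
      have := Nat.add_one_mul_choose_eq (2 * m + (p + 1)) m
      rw [show 2 * m + (p + 1) + 1 = 2 * (m + 1) + p by ring]
        at this
      have h4 : ((2 * (m + 1) + p : ℕ) : ℝ) * (2 * m + (p + 1)).choose m =
        (2 * (m + 1) + p).choose (m + 1) * (m + 1) := by exact_mod_cast this
      push_cast at h4
      linarith
    set A := PowerSeries.coeff (m + 1) (catGF ^ p)
    set B := PowerSeries.coeff m (catGF ^ (p + 1))
    set X := ((2 * m + (p + 1)).choose m : ℝ)
    set Y := ((2 * (m + 1) + p).choose (m + 1) : ℝ)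
    push_cast at h1 h2
    have hN : (0 : ℝ) < 2 * (m : ℝ) + p + 2 := by positivity
    have h5 : (m + 1) * A = p * X := by
      refine mul_left_cancel₀ hN.ne' ?_
      linear_combination (m + 1 : ℝ) * h2 - p * h3
    have h6 : (p + 1) * ((m + 1) * A) = p * ((2 * m + p + 1) * B) := by
      rw [h5]; linear_combination -(p : ℝ) * h1
    have hp' : (1 : ℝ) ≤ p := by exact_mod_cast hp
    have hm : (0 : ℝ) < m + 1 := by positivity
    refine le_of_mul_le_mul_left ?_ hm
    have h7 : 0 ≤ (p : ℝ) * B * (p - 1) :=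
      mul_nonneg (mul_nonneg (by positivity) hnn) (by linarith)
    nlinarith

lemma catalan_le_succ (n : ℕ) : (catalan n : ℝ) ≤ catalan (n + 1) := by
  have h := catalan_succ_mul n
  have h1 := catalan_pos' n
  have h2 : (0 : ℝ) < n + 2 := by positivity
  refine le_of_mul_le_mul_left ?_ h2
  rw [h]
  have : (0 : ℝ) ≤ n := by positivity
  nlinarith

lemma ballot_le (p n : ℕ) : ballot p n ≤ (p + 1) * (2 * (1 / 2) ^ p) * catalan n := by
  rcases p with _ | p
  · rw [ballot_zero]
    have := catalan_pos' n
    split_ifs with h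
    · subst h; norm_num
    · simp [this.le]
  · have key : ballot (p + 1) n ≤ (p + 1) * (1 / 2) ^ p * catalan n := by
      induction p with
      | zero =>
        simp only [Nat.cast_zero, zero_add, pow_zero, one_mul]
        rcases n with _ | n
        · rw [ballot_of_lt (by omega)]; positivity
        · rw [ballot_one]; exact catalan_le_succ n
      | succ p ih =>
        have h := two_mul_ballot_succ_le (p := p + 1) (by omega) n
        have hp : (0 : ℝ) < 2 * (p + 1 : ℕ) := by positivity
        refine le_of_mul_le_mul_left (h.trans ?_) hp
        calc (((p + 1 : ℕ) : ℝ) + 1) * ballot (p + 1) n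
            ≤ (((p + 1 : ℕ) : ℝ) + 1) * ((p + 1) * (1 / 2) ^ p * catalan n) := by gcongr
          _ = _ := by push_cast; ring
    refine key.trans ?_
    push_cast
    have := catalan_pos' n
    rw [pow_succ]
    have h2 : (0 : ℝ) < (1 / 2) ^ p * catalan n := by positivity
    nlinarith

lemma tendsto_catalan_ratio :
    Tendsto (fun n => (catalan n : ℝ) / catalan (n + 1)) atTop (𝓝 (1 / 4)) := by
  have h := regularSeq_catalan.ratio.const_mul (1 / 4)
  rw [mul_one] at h
  refine h.congr fun n => ?_
  have := catalan_pos' (n + 1)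
  rw [pow_succ]
  field_simp

lemma tendsto_ballot_div (p : ℕ) :
    Tendsto (fun n => ballot p n / catalan n) atTop (𝓝 (p * (1 / 2) ^ (p + 1))) := by
  induction p using Nat.twoStepInduction with
  | zero =>
    simp only [Nat.cast_zero, zero_mul]
    refine tendsto_const_nhds.congr' ?_
    filter_upwards [eventually_ge_atTop 1] with n hn
    rw [ballot_zero, if_neg (by omega), zero_div]
  | one =>
    refine (tendsto_add_atTop_iff_nat 1).1 ?_
    have : ((1 : ℕ) : ℝ) * (1 / 2) ^ (1 + 1) = 1 / 4 := by norm_num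
    rw [this]
    exact tendsto_catalan_ratio.congr fun n => by rw [ballot_one]
  | more p h0 h1 =>
    refine (tendsto_add_atTop_iff_nat 1).1 ?_
    have h := (h1.comp (tendsto_add_atTop_nat 1)).sub (h0.mul tendsto_catalan_ratio)
    have e : ((p + 1 : ℕ) : ℝ) * (1 / 2) ^ (p + 1 + 1) - p * (1 / 2) ^ (p + 1) * (1 / 4) =
        ((p + 2 : ℕ) : ℝ) * (1 / 2) ^ (p + 2 + 1) := by push_cast; ring
    rw [e] at h
    refine h.congr fun n => ?_
    have := catalan_pos' n
    simp only [Function.comp_apply, ballot_succ_succ]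
    field_simp

lemma contactGF_expand (z : ℝ) (N : ℕ) : contactGF z =
    ∑ p ∈ Finset.range N, PowerSeries.C (z⁻¹ ^ p) * (PowerSeries.X * catGF) ^ p +
      PowerSeries.X ^ N * (PowerSeries.C (z⁻¹ ^ N) * catGF ^ N * contactGF z) := by
  induction N with
  | zero => simp
  | succ N ih =>
    rw [Finset.sum_range_succ]
    conv_lhs => rw [ih]
    simp only [map_pow]
    linear_combination PowerSeries.X ^ N * PowerSeries.C z⁻¹ ^ N * catGF ^ N * contactGF_succ z

/-- The walks are sorted by their numbers `p` and `q` of returns above and below the axis.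
Truncation at `n` is exact because `(X c)^p` has order `p`. -/
lemma transitSum_eq_ballot (z₁ z₂ : ℝ) (n : ℕ) : transitSum z₁ z₂ n =
    ∑ p ∈ Finset.range (n + 1), ∑ q ∈ Finset.range (n + 1),
      z₁⁻¹ ^ p * z₂⁻¹ ^ q * ballot (p + q) n := by
  set T : ℝ → PowerSeries ℝ := fun z => ∑ p ∈ Finset.range (n + 1),
    PowerSeries.C (z⁻¹ ^ p) * (PowerSeries.X * catGF) ^ p with hT
  obtain ⟨R₁, h1⟩ : ∃ R, contactGF z₁ = T z₁ + PowerSeries.X ^ (n + 1) * R :=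
    ⟨_, contactGF_expand z₁ (n + 1)⟩
  obtain ⟨R₂, h2⟩ : ∃ R, contactGF z₂ = T z₂ + PowerSeries.X ^ (n + 1) * R :=
    ⟨_, contactGF_expand z₂ (n + 1)⟩
  have h : contactGF z₁ * contactGF z₂ = T z₁ * T z₂ + PowerSeries.X ^ (n + 1) *
      (R₁ * contactGF z₂ + T z₁ * R₂) := by
    rw [h1, h2]; ring
  rw [transitSum, h, map_add, PowerSeries.coeff_X_pow_mul', if_neg (by omega), add_zero, hT]
  simp only
  rw [Finset.sum_mul_sum, map_sum]
  refine Finset.sum_congr rfl fun p _ => ?_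
  rw [map_sum]
  refine Finset.sum_congr rfl fun q _ => ?_
  have : PowerSeries.C (z₁⁻¹ ^ p) * (PowerSeries.X * catGF) ^ p *
      (PowerSeries.C (z₂⁻¹ ^ q) * (PowerSeries.X * catGF) ^ q) =
      PowerSeries.C (z₁⁻¹ ^ p * z₂⁻¹ ^ q) * (PowerSeries.X * catGF) ^ (p + q) := by
    rw [map_mul, pow_add]; ring
  rw [this, PowerSeries.coeff_C_mul, ballot]

lemma summable_ballot_bound {z : ℝ} (hz : 1 / 2 < z) :
    Summable fun p : ℕ => ((p : ℝ) + 1) * (z⁻¹ / 2) ^ p := by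
  have h : ‖z⁻¹ / 2‖ < 1 := by
    have hz0 : 0 < z := by linarith
    rw [Real.norm_eq_abs, abs_of_pos (by positivity), div_lt_one (by norm_num),
      inv_lt_comm₀ hz0 (by norm_num)]
    linarith
  have h1 := summable_pow_mul_geometric_of_norm_lt_one 1 h
  have h2 := summable_geometric_of_norm_lt_one h
  refine (h1.add h2).congr fun p => ?_
  ring

/-- Asymptotics in the interior of the maximal current phase. -/
lemma tendsto_transitSum_div_catalan {z₁ z₂ : ℝ} (h₁ : 1 / 2 < z₁) (h₂ : 1 / 2 < z₂) :
    ∃ K, 0 < K ∧ Tendsto (fun n => transitSum z₁ z₂ n / catalan n) atTop (𝓝 K) := by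
  have hz₁ : 0 < z₁ := by linarith
  have hz₂ : 0 < z₂ := by linarith
  set bd : ℕ × ℕ → ℝ := fun x =>
    2 * (((x.1 : ℝ) + 1) * (z₁⁻¹ / 2) ^ x.1 * (((x.2 : ℝ) + 1) * (z₂⁻¹ / 2) ^ x.2)) with hbd
  have hbs : Summable bd := by
    refine Summable.mul_left 2 ?_
    exact (summable_ballot_bound h₁).mul_of_nonneg (summable_ballot_bound h₂)
      (fun p => by positivity) (fun p => by positivity)
  set f : ℕ → ℕ × ℕ → ℝ := fun n x =>
    z₁⁻¹ ^ x.1 * z₂⁻¹ ^ x.2 * (ballot (x.1 + x.2) n / catalan n) with hf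
  set g : ℕ × ℕ → ℝ := fun x =>
    z₁⁻¹ ^ x.1 * z₂⁻¹ ^ x.2 * (((x.1 + x.2 : ℕ) : ℝ) * (1 / 2) ^ (x.1 + x.2 + 1)) with hg
  have hfb : ∀ n x, ‖f n x‖ ≤ bd x := by
    rintro n ⟨p, q⟩
    have hc := catalan_pos' n
    have hb := ballot_le (p + q) n
    have hnn := ballot_nonneg (p + q) n
    rw [Real.norm_eq_abs, abs_of_nonneg (by positivity)]
    have h1 : ballot (p + q) n / catalan n ≤ ((p + q : ℕ) + 1) * (2 * (1 / 2) ^ (p + q)) := by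
      rwa [div_le_iff₀ hc]
    calc f n (p, q) ≤ z₁⁻¹ ^ p * z₂⁻¹ ^ q * (((p : ℝ) + 1) * (q + 1) * (2 * (1 / 2) ^ (p + q))) := by
          simp only [hf]
          gcongr
          refine h1.trans ?_
          gcongr
          exact prod_add_one_le p q
      _ = bd (p, q) := by simp only [hbd, div_pow, pow_add, one_pow]; ring
  have hlim : ∀ x, Tendsto (fun n => f n x) atTop (𝓝 (g x)) := fun x =>
    (tendsto_ballot_div _).const_mul _
  have ht := tendsto_tsum_of_dominated_convergence (𝓕 := atTop) hbs hlim
    (Eventually.of_forall fun n x => hfb n x)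
  have hgb : ∀ x, ‖g x‖ ≤ bd x := fun x =>
    le_of_tendsto (hlim x).norm (Eventually.of_forall fun n => hfb n x)
  refine ⟨∑' x, g x, ?_, ht.congr fun n => ?_⟩
  -- The term `(0, 0)` of the limit vanishes, so `(1, 0)` serves as a strictly positive one.
  · refine (hbs.of_norm_bounded hgb).tsum_pos (fun x => by positivity) (1, 0) ?_
    simp only [hg]; positivity
  · rw [tsum_eq_sum (s := Finset.range (n + 1) ×ˢ Finset.range (n + 1)), Finset.sum_product,
      transitSum_eq_ballot, Finset.sum_div]
    · refine Finset.sum_congr rfl fun p _ => ?_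
      rw [Finset.sum_div]
      exact Finset.sum_congr rfl fun q _ => by simp only [hf]; ring
    · rintro ⟨p, q⟩ hx
      simp only [Finset.mem_product, Finset.mem_range, not_and_or, not_lt] at hx
      simp only [hf]
      rw [ballot_of_lt (by omega)]; simp

end OneTransit

end

noncomputable section

open Filter Topology

namespace OneTransit

/-! ### Asymptotics in the phases -/

/-- Probability of a contact above the axis, as a function of the lengths of the two parts. -/
def contactProb (z₁ z₂ : ℝ) (p : ℕ × ℕ) : ℝ :=
  dyckSum z₁ p.1 * transitSum z₁ z₂ p.2 / transitSum z₁ z₂ (p.1 + p.2)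

lemma aExp_eq_contactProb {z₁ z₂ : ℝ} (h₁ : z₁ ≠ 0) (h₂ : z₂ ≠ 0) {n i : ℕ} (hi : i ≤ n) :
    aExp z₁ z₂ n i = contactProb z₁ z₂ (i, n - i) := by
  rw [aExp_eq h₁ h₂ hi, contactProb]
  simp only [Nat.add_sub_of_le hi]

lemma bExp_eq_aExp {z₁ z₂ : ℝ} (h₁ : z₁ ≠ 0) (h₂ : z₂ ≠ 0) {n i : ℕ} (hi : i ≤ n) :
    bExp z₁ z₂ n i = aExp z₂ z₁ n (n - i) := by
  rw [bExp_eq h₁ h₂ hi, aExp_eq h₂ h₁ (Nat.sub_le n i), Nat.sub_sub_self hi,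
    transitSum_comm z₁ z₂ i, transitSum_comm z₁ z₂ n]

lemma aExp_mem_Icc {z₁ z₂ : ℝ} (h₁ : 0 < z₁) (h₂ : 0 < z₂) (n i : ℕ) :
    0 ≤ aExp z₁ z₂ n i ∧ aExp z₁ z₂ n i ≤ 1 := by
  classical
  have hw : ∀ s : Fin (2 * n) → Bool, 0 ≤ weight z₁ z₂ s := fun s =>
    Finset.prod_nonneg fun j _ => by split_ifs <;> linarith
  have hZ : 0 < Z z₁ z₂ n := by
    rw [Z_eq h₁.ne' h₂.ne']
    exact mul_pos (pow_pos (mul_pos h₁ h₂) _) (transitSum_pos h₁ h₂ n)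
  constructor
  · refine div_nonneg (Finset.sum_nonneg fun s _ => ?_) hZ.le
    split_ifs
    · exact hw s
    · exact le_rfl
  · rw [aExp, div_le_one hZ, Z]
    refine Finset.sum_le_sum fun s _ => ?_
    have := hw s
    split_ifs with h h' <;> first | exact absurd h.1 h' | linarith

lemma contactProb_abs_le {z₁ z₂ : ℝ} (h₁ : 0 < z₁) (h₂ : 0 < z₂) (p : ℕ × ℕ) :
    |contactProb z₁ z₂ p| ≤ 1 := by
  have h := aExp_mem_Icc h₁ h₂ (p.1 + p.2) p.1
  rw [aExp_eq_contactProb h₁.ne' h₂.ne' (Nat.le_add_right _ _), Nat.add_sub_cancel_left] at h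
  exact abs_le.2 ⟨by linarith [h.1], h.2⟩

lemma contactProb_eq_scaled (z₁ z₂ : ℝ) {x : ℝ} (hx : 0 < x) (p : ℕ × ℕ) :
    contactProb z₁ z₂ p = x ^ p.1 * dyckSum z₁ p.1 * (x ^ p.2 * transitSum z₁ z₂ p.2) /
      (x ^ (p.1 + p.2) * transitSum z₁ z₂ (p.1 + p.2)) := by
  rw [contactProb, ← mul_div_mul_left _ (transitSum z₁ z₂ (p.1 + p.2)) (pow_pos hx (p.1 + p.2)).ne',
    pow_add]
  congr 1
  ring

lemma tendsto_fst_add_snd : Tendsto (fun p : ℕ × ℕ => p.1 + p.2) (atTop ×ˢ atTop) atTop :=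
  tendsto_atTop_mono (fun p => Nat.le_add_right p.1 p.2) tendsto_fst

lemma tendsto_contactProb_of_tendsto {z₁ z₂ x r K : ℝ} (hx : 0 < x) (hK : K ≠ 0)
    (hu : Tendsto (fun n => x ^ n * dyckSum z₁ n) atTop (𝓝 r))
    (hy : Tendsto (fun n => x ^ n * transitSum z₁ z₂ n) atTop (𝓝 K)) :
    Tendsto (contactProb z₁ z₂) (atTop ×ˢ atTop) (𝓝 r) := by
  have h := ((hu.comp tendsto_fst).mul (hy.comp tendsto_snd)).div
    (hy.comp tendsto_fst_add_snd) hK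
  rw [mul_div_cancel_right₀ _ hK] at h
  exact h.congr fun p => (contactProb_eq_scaled z₁ z₂ hx p).symm

/-- At the scale `z₁(1-z₁)` the upper weights converge and the lower ones are summable, so their
convolution has a positive limit: the lower part stays of bounded length. -/
lemma exists_tendsto_transitSum {z₁ z₂ : ℝ} (h₁ : 0 < z₁) (h : z₁ < 1 / 2) (h₁₂ : z₁ < z₂) :
    ∃ K, 0 < K ∧ Tendsto (fun n => (z₁ * (1 - z₁)) ^ n * transitSum z₁ z₂ n) atTop (𝓝 K) := by
  have hx : 0 < z₁ * (1 - z₁) := mul_pos h₁ (by linarith)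
  have hl : ∀ n, 0 ≤ (z₁ * (1 - z₁)) ^ n * dyckSum z₂ n := fun n =>
    mul_nonneg (pow_nonneg hx.le _) (dyckSum_pos (h₁.trans h₁₂) n).le
  have hs := summable_pow_mul_dyckSum h₁ h h₁₂
  refine ⟨_, mul_pos (contactRho_pos h) (hs.tsum_pos hl 0 (by simp)),
    (tendsto_convolution (tendsto_pow_mul_dyckSum h₁ h.le) hl hs).congr fun n => ?_⟩
  rw [transitSum_eq_sum, Finset.mul_sum]
  refine Finset.sum_congr rfl fun k hk => ?_
  rw [← Nat.add_sub_of_le (Nat.lt_succ_iff.1 (Finset.mem_range.1 hk)), pow_add,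
    Nat.add_sub_cancel_left]
  ring

/-- Both factors converge after rescaling, so every transit position contributes comparably and the
convolution grows linearly. -/
lemma tendsto_transitSum_diag {z : ℝ} (hz : 0 < z) (h : z < 1 / 2) :
    Tendsto (fun n : ℕ => (z * (1 - z)) ^ n * transitSum z z n / ((n : ℝ) + 1)) atTop
      (𝓝 (contactRho z ^ 2)) := by
  have hu := tendsto_pow_mul_dyckSum hz h.le
  obtain ⟨C, hC⟩ := exists_abs_le_of_tendsto hu
  have hC0 : 0 ≤ C := (abs_nonneg _).trans (hC 0)
  have hf := (hu.comp (tendsto_fst (f := atTop) (g := atTop))).mul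
    (hu.comp (tendsto_snd (f := atTop) (g := atTop)))
  rw [← sq] at hf
  refine (tendsto_avg hf (C := C * C) fun p => ?_).congr fun n => ?_
  · rw [abs_mul]
    exact mul_le_mul (hC _) (hC _) (abs_nonneg _) hC0
  · rw [transitSum_eq_sum, Finset.mul_sum]
    congr 1
    refine Finset.sum_congr rfl fun k hk => ?_
    simp only [Function.comp_apply]
    rw [← Nat.add_sub_of_le (Nat.lt_succ_iff.1 (Finset.mem_range.1 hk)), pow_add,
      Nat.add_sub_cancel_left]
    ring

lemma scaled_transitSum_pos {z₁ z₂ x : ℝ} (h₁ : 0 < z₁) (h₂ : 0 < z₂) (hx : 0 < x) (n : ℕ) :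
    0 < x ^ n * transitSum z₁ z₂ n := mul_pos (pow_pos hx n) (transitSum_pos h₁ h₂ n)

/-- Since `dyckSum ≤ transitSum`, the contact probability is at most a ratio asymptotic to `K w_i
w_j / w_{i+j}`. -/
lemma maximal_current_of_tendsto {z₁ z₂ K : ℝ} {w : ℕ → ℝ} (h₁ : 0 < z₁) (h₂ : 0 < z₂)
    (hw : RegularSeq w)
    (hw0 : Tendsto (fun p : ℕ × ℕ => w p.1 * w p.2 / w (p.1 + p.2)) (atTop ×ˢ atTop) (𝓝 0))
    (hK : 0 < K) (hy : Tendsto (fun n => (1 / 4) ^ n * transitSum z₁ z₂ n / w n) atTop (𝓝 K)) :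
    RegularSeq (fun n => (1 / 4) ^ n * transitSum z₁ z₂ n) ∧
      Tendsto (contactProb z₁ z₂) (atTop ×ˢ atTop) (𝓝 0) := by
  have hpos := scaled_transitSum_pos h₁ h₂ (x := 1 / 4) (by norm_num)
  refine ⟨hw.of_tendsto hpos hK hy, ?_⟩
  have h := (((hy.comp tendsto_fst).mul (hy.comp tendsto_snd)).div
    (hy.comp tendsto_fst_add_snd) hK.ne').mul hw0
  rw [mul_zero] at h
  refine squeeze_zero (fun p => ?_) (fun p => ?_) h
  · exact div_nonneg (mul_nonneg (dyckSum_pos h₁ _).le (transitSum_pos h₁ h₂ _).le)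
      (transitSum_pos h₁ h₂ _).le
  · rw [contactProb_eq_scaled z₁ z₂ (x := 1 / 4) (by norm_num)]
    have e : ∀ a b c u v w : ℝ, u ≠ 0 → v ≠ 0 → w ≠ 0 →
        a / u * (b / v) / (c / w) * (u * v / w) = a * b / c := by
      intro a b c u v w hu hv hw
      field_simp
    simp only [Function.comp_apply, Pi.div_apply]
    rw [e _ _ _ _ _ _ (hw.pos _).ne' (hw.pos _).ne' (hw.pos _).ne']
    have h3 := hpos (p.1 + p.2)
    have h4 := hpos p.2
    have h5 := dyckSum_le_transitSum h₁ h₂ p.1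
    gcongr

lemma tendsto_scaled_div_catalan {z₁ z₂ : ℝ} (h₁ : 1 / 2 < z₁) (h₂ : 1 / 2 < z₂) :
    ∃ K, 0 < K ∧ Tendsto (fun n => (1 / 4) ^ n * transitSum z₁ z₂ n / ((catalan n : ℝ) / 4 ^ n))
      atTop (𝓝 K) := by
  obtain ⟨K, hK, h⟩ := tendsto_transitSum_div_catalan h₁ h₂
  refine ⟨K, hK, h.congr fun n => ?_⟩
  have := catalan_pos' n
  rw [div_pow, one_pow]
  field_simp

/-- In the partial fractions the critical weight `(n+1) C_n` dominates the one at `z₂`, which is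
only of order `C_n`. -/
lemma tendsto_scaled_div_central {z₂ : ℝ} (h₂ : 1 / 2 < z₂) :
    ∃ K, 0 < K ∧ Tendsto (fun n => (1 / 4) ^ n * transitSum (1 / 2) z₂ n / centralSeq n)
      atTop (𝓝 K) := by
  have hz₂ : 0 < z₂ := by linarith
  have h0 : Tendsto (fun n => dyckSum z₂ n / (((n : ℝ) + 1) * catalan n)) atTop (𝓝 0) := by
    obtain ⟨K, hK, h⟩ := tendsto_transitSum_div_catalan h₂ h₂
    have h3 := h.mul tendsto_one_div_add_atTop_nhds_zero_nat
    rw [mul_zero] at h3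
    refine squeeze_zero (fun n => ?_) (fun n => ?_) h3
    · exact div_nonneg (dyckSum_pos hz₂ n).le (by positivity)
    · have := catalan_pos' n
      rw [div_mul_div_comm, mul_one, mul_comm (catalan n : ℝ)]
      gcongr
      exact dyckSum_le_transitSum hz₂ hz₂ n
  have h1 := ((h0.const_mul (1 / 2)).const_sub z₂).div_const (z₂ - 1 / 2)
  rw [mul_zero, sub_zero] at h1
  have hne : z₂ - 1 / 2 ≠ 0 := by linarith
  refine ⟨_, div_pos hz₂ (by linarith), h1.congr fun n => ?_⟩
  have h2 := sub_mul_transitSum (z₁ := 1 / 2) (z₂ := z₂) (by norm_num) hz₂.ne' n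
  rw [dyckSum_half] at h2
  have hc := catalan_pos' n
  have h3 : transitSum (1 / 2) z₂ n =
      (z₂ * ((n + 1) * catalan n) - 1 / 2 * dyckSum z₂ n) / (z₂ - 1 / 2) := by
    rw [eq_div_iff hne]; linarith
  rw [h3, centralSeq, div_pow, one_pow]
  have hn : (n : ℝ) + 1 ≠ 0 := by positivity
  field_simp

lemma maximal_current {z₁ z₂ : ℝ} (h₁ : 1 / 2 ≤ z₁) (h₂ : 1 / 2 ≤ z₂) :
    RegularSeq (fun n => (1 / 4) ^ n * transitSum z₁ z₂ n) ∧
      Tendsto (contactProb z₁ z₂) (atTop ×ˢ atTop) (𝓝 0) := by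
  have hz₁ : 0 < z₁ := by linarith
  have hz₂ : 0 < z₂ := by linarith
  rcases h₁.eq_or_lt with rfl | h₁ <;> rcases h₂.eq_or_lt with rfl | h₂
  -- With `w = 1` the ratio `w_i w_j / w_{i+j}` does not vanish, so this corner instead uses the
  -- decay of `dyckSum (1/2) n / 4^n`.
  · have e : ∀ n : ℕ, (1 / 4 : ℝ) ^ n * transitSum (1 / 2) (1 / 2) n = 1 := fun n => by
      rw [transitSum_half_half, ← mul_pow]; norm_num
    constructor
    · simpa only [e] using regularSeq_one
    · refine tendsto_contactProb_of_tendsto (x := 1 / 4) (K := 1) (by norm_num) one_ne_zero ?_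
        (tendsto_const_nhds.congr fun n => (e n).symm)
      refine tendsto_centralSeq.congr fun n => ?_
      rw [dyckSum_half, centralSeq, div_pow, one_pow]; ring
  · obtain ⟨K, hK, h⟩ := tendsto_scaled_div_central h₂
    exact maximal_current_of_tendsto hz₁ hz₂ regularSeq_centralSeq tendsto_centralSeq_mul_div hK h
  · obtain ⟨K, hK, h⟩ := tendsto_scaled_div_central h₁
    simp only [transitSum_comm (1 / 2) z₁] at h
    exact maximal_current_of_tendsto hz₁ hz₂ regularSeq_centralSeq tendsto_centralSeq_mul_div hK h
  · obtain ⟨K, hK, h⟩ := tendsto_scaled_div_catalan h₁ h₂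
    exact maximal_current_of_tendsto hz₁ hz₂ regularSeq_catalan tendsto_catalan_mul_div hK h

/-- Exponential growth of the partition function, up to a regular factor. -/
lemma exists_regular {z₁ z₂ : ℝ} (h₁ : 0 < z₁) (h₂ : 0 < z₂) :
    ∃ x : ℝ, 0 < x ∧ (Summable fun k => (catalan k : ℝ) * x ^ k) ∧
      RegularSeq fun n => x ^ n * transitSum z₁ z₂ n := by
  have key : ∀ {z w : ℝ}, 0 < z → z < 1 / 2 → z < w →
      ∃ x : ℝ, 0 < x ∧ (Summable fun k => (catalan k : ℝ) * x ^ k) ∧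
        RegularSeq fun n => x ^ n * transitSum z w n := by
    intro z w hz hz2 hzw
    obtain ⟨K, hK, h⟩ := exists_tendsto_transitSum hz hz2 hzw
    have hx : 0 < z * (1 - z) := mul_pos hz (by linarith)
    refine ⟨z * (1 - z), hx, summable_catalan hz (by linarith), regularSeq_one.of_tendsto
      (scaled_transitSum_pos hz (hz.trans hzw) hx) hK ?_⟩
    simpa using h
  by_cases hmc : 1 / 2 ≤ z₁ ∧ 1 / 2 ≤ z₂
  · refine ⟨1 / 4, by norm_num, ?_, (maximal_current hmc.1 hmc.2).1⟩
    have := summable_catalan (z := 1 / 2) (by norm_num) (by norm_num)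
    rwa [show (1 / 2 : ℝ) * (1 - 1 / 2) = 1 / 4 by norm_num] at this
  · rcases lt_trichotomy z₁ z₂ with h | h | h
    · refine key h₁ ?_ h
      by_contra hcon
      exact hmc ⟨by linarith, by linarith⟩
    · subst h
      have hlt : z₁ < 1 / 2 := by
        by_contra hcon
        exact hmc ⟨by linarith, by linarith⟩
      have hx : 0 < z₁ * (1 - z₁) := mul_pos h₁ (by linarith)
      exact ⟨z₁ * (1 - z₁), hx, summable_catalan h₁ (by linarith), regularSeq_add_one.of_tendsto
        (scaled_transitSum_pos h₁ h₁ hx) (pow_pos (contactRho_pos hlt) 2)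
        (tendsto_transitSum_diag h₁ hlt)⟩
    · simp only [transitSum_comm z₁ z₂]
      refine key h₂ ?_ h
      by_contra hcon
      exact hmc ⟨by linarith, by linarith⟩

/-- The contact probability in the bulk, away from the coexistence line. -/
lemma tendsto_contactProb {z₁ z₂ : ℝ} (h₁ : 0 < z₁) (h₂ : 0 < z₂)
    (hne : ¬ (z₁ = z₂ ∧ z₁ < 1 / 2)) :
    Tendsto (contactProb z₁ z₂) (atTop ×ˢ atTop) (𝓝 (aDens z₁ z₂)) := by
  unfold aDens
  split_ifs with hmc h h'
  · exact (maximal_current hmc.1 hmc.2).2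
  · have hlt : z₁ < 1 / 2 := by
      by_contra hcon
      exact hmc ⟨by linarith, by linarith⟩
    obtain ⟨K, hK, hy⟩ := exists_tendsto_transitSum h₁ hlt h
    exact tendsto_contactProb_of_tendsto (mul_pos h₁ (by linarith)) hK.ne'
      (tendsto_pow_mul_dyckSum h₁ hlt.le) hy
  · have hlt : z₂ < 1 / 2 := by
      by_contra hcon
      exact hmc ⟨by linarith, by linarith⟩
    obtain ⟨K, hK, hy⟩ := exists_tendsto_transitSum h₂ hlt h'
    simp only [transitSum_comm z₂ z₁] at hy
    exact tendsto_contactProb_of_tendsto (mul_pos h₂ (by linarith)) hK.ne'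
      (summable_pow_mul_dyckSum h₂ hlt h').tendsto_atTop_zero hy
  · refine absurd ⟨le_antisymm (not_lt.1 h') (not_lt.1 h), ?_⟩ hne
    by_contra hcon
    exact hmc ⟨by linarith, by linarith⟩

/-- On the coexistence line the contact probability behaves like `r(z)` times the remaining fraction
of the walk, whose average over sites is `1/2`. -/
lemma tendsto_avg_contactProb_diag {z : ℝ} (hz : 0 < z) (h : z < 1 / 2) :
    Tendsto (fun n : ℕ => (∑ i ∈ Finset.range (n + 1), contactProb z z (i, n - i)) / ((n : ℝ) + 1))
      atTop (𝓝 (contactRho z / 2)) := by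
  have hr := contactRho_pos h
  have hx : 0 < z * (1 - z) := mul_pos hz (by linarith)
  have hu := tendsto_pow_mul_dyckSum hz h.le
  have hy := tendsto_transitSum_diag hz h
  obtain ⟨C, hC⟩ := exists_abs_le_of_tendsto hu
  obtain ⟨B, hB⟩ := exists_abs_le_of_tendsto hy
  have hC0 : 0 ≤ C := (abs_nonneg _).trans (hC 0)
  have hf := (hu.comp (tendsto_fst (f := atTop) (g := atTop))).mul
    (hy.comp (tendsto_snd (f := atTop) (g := atTop)))
  have hW : Tendsto (fun n : ℕ => (∑ i ∈ Finset.range (n + 1),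
      (((n - i : ℕ) : ℝ) + 1) / (n + 1)) / (n + 1 : ℝ)) atTop (𝓝 (1 / 2)) := by
    have h1 := (tendsto_one_div_add_atTop_nhds_zero_nat (𝕜 := ℝ)).const_add 1
    have h2 := h1.div_const 2
    rw [add_zero] at h2
    refine h2.congr fun n => ?_
    have h3 : ∑ i ∈ Finset.range (n + 1), (((n - i : ℕ) : ℝ) + 1) = (n + 1) * (n + 2) / 2 := by
      have := Finset.sum_range_reflect (fun i => (i : ℝ) + 1) (n + 1)
      simp only [Nat.add_sub_cancel] at this
      rw [this]
      clear this
      induction n with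
      | zero => norm_num
      | succ n ih => rw [Finset.sum_range_succ, ih]; push_cast; ring
    rw [← Finset.sum_div, h3]
    have hn : (n : ℝ) + 1 ≠ 0 := by positivity
    field_simp
    ring
  have hlim := (tendsto_weighted_avg hf (C := C * B) (fun p => by
    rw [abs_mul]; exact mul_le_mul (hC _) (hB _) (abs_nonneg _) hC0) (fun n i => by
      rw [abs_of_nonneg (by positivity), div_le_one (by positivity)]
      have : ((n - i : ℕ) : ℝ) ≤ n := by exact_mod_cast Nat.sub_le n i
      linarith) hW).div hy (pow_pos hr 2).ne'
  have e : contactRho z * contactRho z ^ 2 * (1 / 2) / contactRho z ^ 2 = contactRho z / 2 := by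
    field_simp
  rw [e] at hlim
  refine hlim.congr fun n => ?_
  have hY := scaled_transitSum_pos hz hz hx n
  have hn : (n : ℝ) + 1 ≠ 0 := by positivity
  simp only [Pi.div_apply, Function.comp_apply]
  rw [div_div, mul_div_cancel₀ _ hn, Finset.sum_div, Finset.sum_div]
  refine Finset.sum_congr rfl fun i hi => ?_
  have hi' : i + (n - i) = n := Nat.add_sub_of_le (Nat.lt_succ_iff.1 (Finset.mem_range.1 hi))
  rw [contactProb_eq_scaled z z hx]
  simp only [hi']
  have hn2 : ((n - i : ℕ) : ℝ) + 1 ≠ 0 := by positivity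
  field_simp

lemma tendsto_avg_aExp {z₁ z₂ : ℝ} (h₁ : 0 < z₁) (h₂ : 0 < z₂) :
    Tendsto (fun n : ℕ => (∑ i ∈ Finset.range (n + 1), aExp z₁ z₂ n i) / ((n : ℝ) + 1))
      atTop (𝓝 (aDens z₁ z₂)) := by
  have key : Tendsto (fun n : ℕ => (∑ i ∈ Finset.range (n + 1), contactProb z₁ z₂ (i, n - i)) /
      ((n : ℝ) + 1)) atTop (𝓝 (aDens z₁ z₂)) := by
    by_cases hne : z₁ = z₂ ∧ z₁ < 1 / 2
    · obtain ⟨rfl, hlt⟩ := hne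
      have : aDens z₁ z₁ = contactRho z₁ / 2 := by
        rw [aDens, if_neg (by intro h; linarith [h.1]), if_neg (lt_irrefl _), if_neg (lt_irrefl _)]
      rw [this]
      exact tendsto_avg_contactProb_diag h₁ hlt
    · exact tendsto_avg (tendsto_contactProb h₁ h₂ hne) (contactProb_abs_le h₁ h₂)
  refine key.congr fun n => ?_
  congr 1
  exact Finset.sum_congr rfl fun i hi => (aExp_eq_contactProb h₁.ne' h₂.ne'
    (Nat.lt_succ_iff.1 (Finset.mem_range.1 hi))).symm

lemma bDens_eq_aDens (z₁ z₂ : ℝ) : bDens z₁ z₂ = aDens z₂ z₁ := by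
  unfold aDens bDens
  rcases lt_trichotomy z₁ z₂ with h | h | h
  · simp [h, h.not_gt, and_comm]
  · simp [h]
  · simp [h, h.not_gt, and_comm]

lemma tendsto_avg_bExp {z₁ z₂ : ℝ} (h₁ : 0 < z₁) (h₂ : 0 < z₂) :
    Tendsto (fun n : ℕ => (∑ i ∈ Finset.range (n + 1), bExp z₁ z₂ n i) / ((n : ℝ) + 1))
      atTop (𝓝 (bDens z₁ z₂)) := by
  rw [bDens_eq_aDens]
  refine (tendsto_avg_aExp h₂ h₁).congr fun n => ?_
  rw [← Finset.sum_range_reflect]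
  congr 1
  refine Finset.sum_congr rfl fun i hi => ?_
  rw [bExp_eq_aExp h₁.ne' h₂.ne' (Nat.lt_succ_iff.1 (Finset.mem_range.1 hi)), Nat.add_sub_cancel]

lemma sum_Icc_one (g : ℕ → ℝ) (n : ℕ) :
    ∑ i ∈ Finset.Icc 1 n, g i = ∑ i ∈ Finset.range n, g (i + 1) := by
  induction n with
  | zero => simp
  | succ n ih => rw [Finset.sum_Icc_succ_top (by omega), ih, Finset.sum_range_succ]

lemma tendsto_avg_Icc {g : ℕ → ℕ → ℝ} {L : ℝ} (hg : ∀ n, 0 ≤ g n 0 ∧ g n 0 ≤ 1)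
    (h : Tendsto (fun n : ℕ => (∑ i ∈ Finset.range (n + 1), g n i) / ((n : ℝ) + 1))
      atTop (𝓝 L)) :
    Tendsto (fun n : ℕ => (∑ i ∈ Finset.Icc 1 n, g n i) / (n : ℝ)) atTop (𝓝 L) := by
  have h0 : Tendsto (fun n : ℕ => g n 0 / ((n : ℝ) + 1)) atTop (𝓝 0) := by
    refine squeeze_zero (fun n => div_nonneg (hg n).1 (by positivity)) (fun n => ?_)
      (tendsto_one_div_add_atTop_nhds_zero_nat (𝕜 := ℝ))
    gcongr
    exact (hg n).2
  have h1 := (h.sub h0).mul ((tendsto_natCast_div_add_atTop (1 : ℝ)).inv₀ one_ne_zero)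
  rw [sub_zero, inv_one, mul_one] at h1
  refine h1.congr' ?_
  filter_upwards [eventually_ge_atTop 1] with n hn
  have hn0 : (n : ℝ) ≠ 0 := by positivity
  have hn1 : (n : ℝ) + 1 ≠ 0 := by positivity
  rw [Finset.sum_range_succ', sum_Icc_one]
  field_simp
  ring

/-! ### Current and Catalan sums -/

lemma tendsto_J {z₁ z₂ x : ℝ} (h₁ : 0 < z₁) (h₂ : 0 < z₂) (hx : 0 < x)
    (hy : RegularSeq fun n => x ^ n * transitSum z₁ z₂ n) :
    Tendsto (fun n => J z₁ z₂ n) atTop (𝓝 x) := by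
  refine (tendsto_add_atTop_iff_nat 1).1 ?_
  have h := hy.ratio.const_mul x
  rw [mul_one] at h
  refine h.congr fun n => ?_
  have := transitSum_pos h₁ h₂ (n + 1)
  rw [J_eq h₁.ne' h₂.ne', Nat.add_sub_cancel, pow_succ]
  field_simp

/-- The product of currents telescopes; `p < n` keeps all the truncated subtractions honest. -/
lemma catTerm_eq {z₁ z₂ : ℝ} (h₁ : 0 < z₁) (h₂ : 0 < z₂) {n p : ℕ} (hp : p < n) :
    catTerm z₁ z₂ n p = catalan p * (transitSum z₁ z₂ (n - 1 - p) / transitSum z₁ z₂ n) := by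
  rw [catTerm]
  congr 1
  induction p with
  | zero => simp [J_eq h₁.ne' h₂.ne']
  | succ p ih =>
    rw [Finset.prod_range_succ, ih (by omega), J_eq h₁.ne' h₂.ne',
      show n - (p + 1) - 1 = n - 1 - (p + 1) by omega, show n - 1 - p = n - (p + 1) by omega]
    have := transitSum_pos h₁ h₂ (n - (p + 1))
    field_simp

lemma signedSum_eq (z₁ z₂ : ℝ) (n i : ℕ) : signedSum z₁ z₂ n i =
    ∑ p ∈ Finset.range (n - i), catTerm z₁ z₂ n p -
      ∑ p ∈ Finset.range (i - 1), catTerm z₁ z₂ n p := by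
  rw [signedSum]
  rcases Nat.le_total (i - 1) (n - i) with h | h
  · rw [Finset.Ico_eq_empty_of_le h, Finset.sum_empty, sub_zero, Finset.sum_Ico_eq_sub _ h]
  · rw [Finset.Ico_eq_empty_of_le h, Finset.sum_empty, zero_sub, Finset.sum_Ico_eq_sub _ h]; ring

/-- Reversing the order of the sites exchanges the two initial sums, so the Catalan part drops out
of the mean density exactly. -/
lemma sum_signedSum (z₁ z₂ : ℝ) (n : ℕ) :
    ∑ i ∈ Finset.range (n + 1), signedSum z₁ z₂ (n + 1) (i + 1) = 0 := by
  simp only [signedSum_eq, Finset.sum_sub_distrib, Nat.add_sub_cancel]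
  rw [← Finset.sum_range_reflect, sub_eq_zero]
  refine Finset.sum_congr rfl fun i hi => ?_
  have := Finset.mem_range.1 hi
  congr 2
  omega

lemma eventually_bulk {x : ℝ} (hx0 : 0 < x) (hx1 : x < 1) {i : ℕ → ℕ}
    (hi : Tendsto (fun n : ℕ => (i n : ℝ) / n) atTop (𝓝 x)) :
    ∃ δ : ℝ, 0 < δ ∧ ∀ᶠ n in atTop, 1 ≤ i n ∧ i n ≤ n ∧ δ * n ≤ ((i n - 1 : ℕ) : ℝ) ∧
      δ * n ≤ ((n - i n : ℕ) : ℝ) := by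
  set δ := min x (1 - x) / 2 with hδ
  have hδ0 : 0 < δ := half_pos (lt_min hx0 (by linarith))
  have h1 : δ < x := by
    have := min_le_left x (1 - x)
    linarith
  have h2 : x < 1 - δ := by
    have := min_le_right x (1 - x)
    linarith
  have hi2 : Tendsto (fun n : ℕ => (i n : ℝ) / n - 1 / n) atTop (𝓝 (x - 0)) :=
    hi.sub tendsto_one_div_atTop_nhds_zero_nat
  rw [sub_zero] at hi2
  refine ⟨δ, hδ0, ?_⟩
  filter_upwards [hi2.eventually_const_lt h1, hi.eventually_lt_const h2,
    eventually_ge_atTop 1] with n hn1 hn2 hn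
  have hn0 : (0 : ℝ) < n := by exact_mod_cast hn
  rw [← sub_div, lt_div_iff₀ hn0] at hn1
  rw [div_lt_iff₀ hn0] at hn2
  have hle1 : 1 ≤ i n := by
    have : (0 : ℝ) < i n := by nlinarith
    exact_mod_cast this
  have hle2 : i n ≤ n := by
    have : (i n : ℝ) ≤ n := by nlinarith
    exact_mod_cast this
  refine ⟨hle1, hle2, ?_, ?_⟩
  · push_cast [hle1]; exact hn1.le
  · push_cast [hle2]; linarith

lemma tendsto_atTop_of_mul_le {δ : ℝ} (hδ : 0 < δ) {k : ℕ → ℕ}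
    (h : ∀ᶠ n : ℕ in atTop, δ * (n : ℝ) ≤ k n) : Tendsto k atTop atTop := by
  refine (tendsto_natCast_atTop_iff (R := ℝ)).1 (tendsto_atTop_mono' _ h ?_)
  exact tendsto_natCast_atTop_atTop.const_mul_atTop hδ

/-- In the bulk both endpoints of the sum are of order `n`, and so is the length left after removing
`p + 1` sites. Regularity bounds each term by a constant times `C_p w^p`, leaving a tail of a
convergent series. -/
lemma tendsto_signedSum {z₁ z₂ : ℝ} (h₁ : 0 < z₁) (h₂ : 0 < z₂) {x : ℝ} (hx0 : 0 < x)
    (hx1 : x < 1) {i : ℕ → ℕ} (hi : Tendsto (fun n : ℕ => (i n : ℝ) / n) atTop (𝓝 x)) :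
    Tendsto (fun n => signedSum z₁ z₂ n (i n)) atTop (𝓝 0) := by
  obtain ⟨w, hw, hs, hy⟩ := exists_regular h₁ h₂
  obtain ⟨δ, hδ, hev⟩ := eventually_bulk hx0 hx1 hi
  obtain ⟨M, hM⟩ := hy.bound δ hδ
  set m : ℕ → ℕ := fun n => min (i n - 1) (n - i n) with hm
  have hmt : Tendsto m atTop atTop := by
    refine tendsto_atTop_of_mul_le hδ ?_
    filter_upwards [hev] with n hn
    rw [hm, Nat.cast_min]
    exact le_min hn.2.2.1 hn.2.2.2
  set f : ℕ → ℝ := fun k => (catalan k : ℝ) * w ^ k with hf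
  have hf0 : ∀ k, 0 ≤ f k := fun k => by positivity
  have htail : Tendsto (fun n => M * w * (∑' k, f k - ∑ k ∈ Finset.range (m n), f k)) atTop
      (𝓝 0) := by
    have := ((hs.hasSum.tendsto_sum_nat.comp hmt).const_sub (∑' k, f k)).const_mul (M * w)
    rwa [sub_self, mul_zero] at this
  refine squeeze_zero_norm' ?_ htail
  filter_upwards [hev] with n hn
  obtain ⟨hn1, hn2, hn3, hn4⟩ := hn
  have hM0 : 0 ≤ M := by
    have h3 : δ * (n : ℝ) ≤ n := hn3.trans (by exact_mod_cast by omega)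
    have := hM n n le_rfl h3
    have h4 := hy.pos n
    nlinarith
  have hterm : ∀ p, p < max (i n - 1) (n - i n) →
      0 ≤ catTerm z₁ z₂ n p ∧ catTerm z₁ z₂ n p ≤ M * w * f p := by
    intro p hp
    have hpn : p < n := by omega
    have hY := transitSum_pos h₁ h₂ n
    have hY' := transitSum_pos h₁ h₂ (n - 1 - p)
    rw [catTerm_eq h₁ h₂ hpn]
    refine ⟨by positivity, ?_⟩
    have hle : δ * (n : ℝ) ≤ ((n - 1 - p : ℕ) : ℝ) := by
      rcases le_max_iff.1 (Nat.succ_le_of_lt hp) with h | h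
      · exact hn4.trans (by exact_mod_cast by omega)
      · exact hn3.trans (by exact_mod_cast by omega)
    have h3 := hM (n - 1 - p) n (by omega) hle
    have e : w ^ n = w ^ (n - 1 - p) * (w * w ^ p) := by
      rw [← pow_succ', ← pow_add]; congr 1; omega
    rw [e] at h3
    have h4 : transitSum z₁ z₂ (n - 1 - p) ≤ M * (w * w ^ p) * transitSum z₁ z₂ n := by
      refine le_of_mul_le_mul_left ?_ (pow_pos hw (n - 1 - p))
      linarith
    rw [← div_le_iff₀ hY] at h4
    calc (catalan p : ℝ) * (transitSum z₁ z₂ (n - 1 - p) / transitSum z₁ z₂ n)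
        ≤ catalan p * (M * (w * w ^ p)) := by gcongr
      _ = M * w * f p := by simp only [hf]; ring
  have hsum : ∀ a b, m n ≤ a → b ≤ max (i n - 1) (n - i n) →
      0 ≤ ∑ p ∈ Finset.Ico a b, catTerm z₁ z₂ n p ∧
      ∑ p ∈ Finset.Ico a b, catTerm z₁ z₂ n p ≤
        M * w * (∑' k, f k - ∑ k ∈ Finset.range (m n), f k) := by
    intro a b ha hb
    have hlt : ∀ p ∈ Finset.Ico a b, p < max (i n - 1) (n - i n) := fun p hp =>
      (Finset.mem_Ico.1 hp).2.trans_le hb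
    refine ⟨Finset.sum_nonneg fun p hp => (hterm p (hlt p hp)).1, ?_⟩
    refine (Finset.sum_le_sum fun p hp => (hterm p (hlt p hp)).2).trans ?_
    rw [← Finset.mul_sum]
    refine mul_le_mul_of_nonneg_left ?_ (by positivity)
    rw [le_sub_iff_add_le, ← Finset.sum_union]
    · exact hs.sum_le_tsum _ fun k _ => hf0 k
    · rw [Finset.disjoint_left]
      intro p hp hp'
      have := (Finset.mem_Ico.1 hp).1
      have := Finset.mem_range.1 hp'
      omega
  have hA := hsum (i n - 1) (n - i n) (min_le_left _ _) (le_max_right _ _)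
  have hB := hsum (n - i n) (i n - 1) (min_le_right _ _) (le_max_left _ _)
  rw [Real.norm_eq_abs, signedSum, abs_le]
  exact ⟨by linarith [hA.1, hB.2], by linarith [hA.2, hB.1]⟩

/-! ### Observables of the stationary state -/

lemma sum_matrixMeasure_mul (α β : ℝ) {n : ℕ} (g : (Fin n → Bool) → ℝ) :
    ∑ η, matrixMeasure α β η * g η =
      (∑ η : Fin n → Bool, wordWeight α β (List.ofFn η) * g η) / transitSum α β n := by
  rw [Finset.sum_div]
  exact Finset.sum_congr rfl fun η _ => by rw [matrixMeasure]; ring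

lemma sum_matrixMeasure {α β : ℝ} (hα : 0 < α) (hβ : 0 < β) (n : ℕ) :
    ∑ η : Fin n → Bool, matrixMeasure α β η = 1 := by
  have := sum_matrixMeasure_mul α β fun _ : Fin n → Bool => 1
  simp only [mul_one, sum_wordWeight] at this
  rw [this, div_self (transitSum_pos hα hβ n).ne']

lemma bondCurrent_matrixMeasure {z₁ z₂ : ℝ} (h₁ : 0 < z₁) (h₂ : 0 < z₂) {n i : ℕ} (hn : 1 ≤ n)
    (hi : i ≤ n) :
    bondCurrent z₁ z₂ (matrixMeasure z₁ z₂ : (Fin n → Bool) → ℝ) i = J z₁ z₂ n := by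
  rw [J_eq h₁.ne' h₂.ne', bondCurrent]
  split_ifs with h0 hl
  · obtain ⟨m, rfl⟩ : ∃ m, n = 0 + (m + 1) := ⟨n - 1, by omega⟩
    have h := sum_wordWeight_hole z₁ z₂ 0 m
    rw [sum_matrixMeasure_mul]
    simp only [mul_left_comm _ z₁, ← Finset.mul_sum]
    rw [show occ (n := 0 + (m + 1)) = occ from rfl]
    simp only [zero_add] at h ⊢
    rw [h]
    have := h₁.ne'
    simp
    field_simp
  · obtain ⟨m, rfl⟩ : ∃ m, n = m + (0 + 1) := ⟨n - 1, by omega⟩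
    have h := sum_wordWeight_occ z₁ z₂ m 0
    rw [sum_matrixMeasure_mul]
    simp only [mul_left_comm _ z₂, ← Finset.mul_sum]
    simp only [zero_add] at h ⊢
    rw [h]
    have := h₂.ne'
    simp
    field_simp
  · obtain ⟨k, rfl⟩ : ∃ k, i = k + 1 := ⟨i - 1, by omega⟩
    obtain ⟨m, rfl⟩ : ∃ m, n = k + (m + 2) := ⟨n - k - 2, by omega⟩
    rw [sum_matrixMeasure_mul, sum_wordWeight_bond]
    rfl

/-- The occupied site is normal ordered towards the right vector; its boundary term is the numerator
of a contact below the axis in a walk with index `n - 1`. -/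
lemma dens_matrixMeasure_right {z₁ z₂ : ℝ} (h₁ : 0 < z₁) (h₂ : 0 < z₂) {n i : ℕ} (hi1 : 1 ≤ i)
    (hi : i ≤ n) :
    dens (matrixMeasure z₁ z₂ : (Fin n → Bool) → ℝ) i =
      ∑ p ∈ Finset.range (n - i), catTerm z₁ z₂ n p +
        1 / z₂ * J z₁ z₂ n * bExp z₁ z₂ (n - 1) (i - 1) := by
  obtain ⟨k, rfl⟩ : ∃ k, i = k + 1 := ⟨i - 1, by omega⟩
  obtain ⟨m, rfl⟩ : ∃ m, n = k + (m + 1) := ⟨n - k - 1, by omega⟩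
  have e1 : k + (m + 1) - (k + 1) = m := by omega
  have e2 : k + (m + 1) - 1 = k + m := by omega
  have hY := transitSum_pos h₁ h₂ (k + m)
  rw [dens, sum_matrixMeasure_mul, sum_wordWeight_occ, e1, J_eq h₁.ne' h₂.ne', e2,
    Nat.add_sub_cancel, bExp_eq h₁.ne' h₂.ne' (by omega), Nat.add_sub_cancel_left, add_div,
    Finset.sum_div]
  congr 1
  · refine Finset.sum_congr rfl fun p hp => ?_
    have := Finset.mem_range.1 hp
    rw [catTerm_eq h₁ h₂ (by omega), e2, mul_div_assoc]
  · field_simp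

/-- The hole probability is normal ordered towards the left vector, where the boundary term is a
contact above the axis. -/
lemma dens_matrixMeasure_left {z₁ z₂ : ℝ} (h₁ : 0 < z₁) (h₂ : 0 < z₂) {n i : ℕ} (hi1 : 1 ≤ i)
    (hi : i ≤ n) :
    dens (matrixMeasure z₁ z₂ : (Fin n → Bool) → ℝ) i =
      1 - ∑ p ∈ Finset.range (i - 1), catTerm z₁ z₂ n p -
        1 / z₁ * J z₁ z₂ n * aExp z₁ z₂ (n - 1) (i - 1) := by
  obtain ⟨k, rfl⟩ : ∃ k, i = k + 1 := ⟨i - 1, by omega⟩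
  obtain ⟨m, rfl⟩ : ∃ m, n = k + (m + 1) := ⟨n - k - 1, by omega⟩
  have e2 : k + (m + 1) - 1 = k + m := by omega
  have hY := transitSum_pos h₁ h₂ (k + m)
  have h0 : dens (matrixMeasure z₁ z₂ : (Fin (k + (m + 1)) → Bool) → ℝ) (k + 1) =
      1 - ∑ η : Fin (k + (m + 1)) → Bool, matrixMeasure z₁ z₂ η * (1 - occ η (k + 1)) := by
    simp only [mul_sub, mul_one, Finset.sum_sub_distrib, sum_matrixMeasure h₁ h₂, dens]
    ring
  rw [h0, sum_matrixMeasure_mul, sum_wordWeight_hole, J_eq h₁.ne' h₂.ne', e2,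
    Nat.add_sub_cancel, aExp_eq h₁.ne' h₂.ne' (by omega), Nat.add_sub_cancel_left, add_div,
    Finset.sum_div, sub_sub]
  congr 2
  · refine Finset.sum_congr rfl fun p hp => ?_
    have := Finset.mem_range.1 hp
    rw [catTerm_eq h₁ h₂ (by omega), e2, mul_div_assoc]
  · field_simp

lemma dens_matrixMeasure_symm {z₁ z₂ : ℝ} (h₁ : 0 < z₁) (h₂ : 0 < z₂) {n i : ℕ} (hi1 : 1 ≤ i)
    (hi : i ≤ n) :
    dens (matrixMeasure z₁ z₂ : (Fin n → Bool) → ℝ) i =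
      1 / 2 * (1 + signedSum z₁ z₂ n i + J z₁ z₂ n *
        (1 / z₂ * bExp z₁ z₂ (n - 1) (i - 1) - 1 / z₁ * aExp z₁ z₂ (n - 1) (i - 1))) := by
  have ha := dens_matrixMeasure_right h₁ h₂ hi1 hi
  have hb := dens_matrixMeasure_left h₁ h₂ hi1 hi
  rw [signedSum_eq]
  linear_combination (1 / 2 : ℝ) * ha + (1 / 2 : ℝ) * hb

/-- Averaging the symmetric formula needs only averaged contact densities, so the coexistence line
is included. -/
lemma tendsto_avg_dens {z₁ z₂ x : ℝ} (h₁ : 0 < z₁) (h₂ : 0 < z₂)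
    (hJ : Tendsto (fun n => J z₁ z₂ n) atTop (𝓝 x)) :
    Tendsto (fun n : ℕ => (∑ i ∈ Finset.Icc 1 n,
        dens (matrixMeasure z₁ z₂ : (Fin n → Bool) → ℝ) i) / n) atTop
      (𝓝 (1 / 2 * (1 + x * (1 / z₂ * bDens z₁ z₂ - 1 / z₁ * aDens z₁ z₂)))) := by
  refine (tendsto_add_atTop_iff_nat 1).1 ?_
  have h := (((hJ.comp (tendsto_add_atTop_nat 1)).mul
    (((tendsto_avg_bExp h₁ h₂).const_mul (1 / z₂)).sub
      ((tendsto_avg_aExp h₁ h₂).const_mul (1 / z₁)))).const_add 1).const_mul (1 / 2)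
  refine h.congr fun n => ?_
  rw [sum_Icc_one]
  have e : ∀ i ∈ Finset.range (n + 1),
      dens (matrixMeasure z₁ z₂ : (Fin (n + 1) → Bool) → ℝ) (i + 1) =
      1 / 2 * (1 + signedSum z₁ z₂ (n + 1) (i + 1) + J z₁ z₂ (n + 1) *
        (1 / z₂ * bExp z₁ z₂ n i - 1 / z₁ * aExp z₁ z₂ n i)) := fun i hi =>
    dens_matrixMeasure_symm h₁ h₂ (by omega) (by have := Finset.mem_range.1 hi; omega)
  rw [Finset.sum_congr rfl e]
  simp only [← Finset.mul_sum, Finset.sum_add_distrib, Finset.sum_sub_distrib, sum_signedSum,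
    Finset.sum_const, Finset.card_range, nsmul_eq_mul, Function.comp_apply]
  have hn : (n : ℝ) + 1 ≠ 0 := by positivity
  push_cast
  field_simp
  ring

lemma tendsto_dens_bulk {z₁ z₂ x y : ℝ} (h₁ : 0 < z₁) (h₂ : 0 < z₂)
    (hne : ¬ (z₁ = z₂ ∧ z₁ < 1 / 2)) (hJ : Tendsto (fun n => J z₁ z₂ n) atTop (𝓝 x))
    (hy0 : 0 < y) (hy1 : y < 1) {i : ℕ → ℕ}
    (hi : Tendsto (fun n : ℕ => (i n : ℝ) / n) atTop (𝓝 y)) :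
    Tendsto (fun n : ℕ => dens (matrixMeasure z₁ z₂ : (Fin n → Bool) → ℝ) (i n)) atTop
      (𝓝 (1 / 2 * (1 + x * (1 / z₂ * bDens z₁ z₂ - 1 / z₁ * aDens z₁ z₂)))) := by
  obtain ⟨δ, hδ, hev⟩ := eventually_bulk hy0 hy1 hi
  have hl : Tendsto (fun n => i n - 1) atTop atTop :=
    tendsto_atTop_of_mul_le hδ (hev.mono fun n hn => hn.2.2.1)
  have hr : Tendsto (fun n => n - i n) atTop atTop :=
    tendsto_atTop_of_mul_le hδ (hev.mono fun n hn => hn.2.2.2)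
  have ha := (tendsto_contactProb h₁ h₂ hne).comp (hl.prodMk hr)
  have hb := (tendsto_contactProb h₂ h₁ (fun h => hne ⟨h.1.symm, h.1 ▸ h.2⟩)).comp (hr.prodMk hl)
  rw [← bDens_eq_aDens] at hb
  have h := (((tendsto_signedSum h₁ h₂ hy0 hy1 hi).const_add 1).add
    (hJ.mul ((hb.const_mul (1 / z₂)).sub (ha.const_mul (1 / z₁))))).const_mul (1 / 2)
  rw [add_zero] at h
  refine h.congr' ?_
  filter_upwards [hev] with n hn
  obtain ⟨hn1, hn2, -⟩ := hn
  rw [dens_matrixMeasure_symm h₁ h₂ hn1 hn2, bExp_eq_aExp h₁.ne' h₂.ne' (by omega),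
    aExp_eq_contactProb h₁.ne' h₂.ne' (by omega),
    aExp_eq_contactProb h₂.ne' h₁.ne' (Nat.sub_le _ _)]
  have e1 : n - 1 - (i n - 1) = n - i n := by omega
  have e2 : n - 1 - (n - i n) = i n - 1 := by omega
  simp only [Function.comp_apply, e1, e2]

end OneTransit

end

theorem mainTheorem6 (z₁ z₂ : ℝ) (hz₁ : 0 < z₁) (hz₂ : 0 < z₂) :
    (∀ n : ℕ, 1 ≤ n →
      ∃! p : (Fin n → Bool) → ℝ, OneTransit.IsStationary z₁ z₂ p) ∧
    ∀ P : (n : ℕ) → (Fin n → Bool) → ℝ,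
      (∀ n : ℕ, 1 ≤ n → OneTransit.IsStationary z₁ z₂ (P n)) →
      -- the current through every bond of the TASEP
      (∀ n i : ℕ, 1 ≤ n → i ≤ n →
        OneTransit.bondCurrent z₁ z₂ (P n) i = OneTransit.J z₁ z₂ n) ∧
      -- the three exact expressions for the local density
      (∀ n i : ℕ, 1 ≤ i → i ≤ n →
        OneTransit.dens (P n) i =
            ∑ p ∈ Finset.range (n - i), OneTransit.catTerm z₁ z₂ n p +
              1 / z₂ * OneTransit.J z₁ z₂ n * OneTransit.bExp z₁ z₂ (n - 1) (i - 1) ∧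
        OneTransit.dens (P n) i =
            1 - ∑ p ∈ Finset.range (i - 1), OneTransit.catTerm z₁ z₂ n p -
              1 / z₁ * OneTransit.J z₁ z₂ n * OneTransit.aExp z₁ z₂ (n - 1) (i - 1) ∧
        OneTransit.dens (P n) i =
            1 / 2 * (1 + OneTransit.signedSum z₁ z₂ n i +
              OneTransit.J z₁ z₂ n *
                (1 / z₂ * OneTransit.bExp z₁ z₂ (n - 1) (i - 1) -
                  1 / z₁ * OneTransit.aExp z₁ z₂ (n - 1) (i - 1)))) ∧
      -- the second term vanishes in the bulk
      (∀ x : ℝ, 0 < x → x < 1 → ∀ i : ℕ → ℕ,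
        Filter.Tendsto (fun n : ℕ => (i n : ℝ) / n) Filter.atTop (nhds x) →
        Filter.Tendsto (fun n : ℕ => OneTransit.signedSum z₁ z₂ n (i n))
          Filter.atTop (nhds 0)) ∧
      -- the thermodynamic limit
      Filter.Tendsto
        (fun n : ℕ => (∑ i ∈ Finset.Icc 1 n, OneTransit.aExp z₁ z₂ n i) / n)
        Filter.atTop (nhds (OneTransit.aDens z₁ z₂)) ∧
      Filter.Tendsto
        (fun n : ℕ => (∑ i ∈ Finset.Icc 1 n, OneTransit.bExp z₁ z₂ n i) / n)
        Filter.atTop (nhds (OneTransit.bDens z₁ z₂)) ∧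
      ∃ J ρ : ℝ, 0 < J ∧
        Filter.Tendsto (fun n : ℕ => OneTransit.J z₁ z₂ n) Filter.atTop (nhds J) ∧
        Filter.Tendsto
          (fun n : ℕ => (∑ i ∈ Finset.Icc 1 n, OneTransit.dens (P n) i) / n)
          Filter.atTop (nhds ρ) ∧
        (¬ (z₁ = z₂ ∧ z₁ < 1 / 2) →
          ∀ x : ℝ, 0 < x → x < 1 → ∀ i : ℕ → ℕ,
            Filter.Tendsto (fun n : ℕ => (i n : ℝ) / n) Filter.atTop (nhds x) →
            Filter.Tendsto (fun n : ℕ => OneTransit.dens (P n) (i n))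
              Filter.atTop (nhds ρ)) ∧
        (2 * ρ - 1) / J =
          OneTransit.bDens z₁ z₂ / z₂ - OneTransit.aDens z₁ z₂ / z₁ := by
  have huniq : ∀ n : ℕ, 1 ≤ n → ∀ p : (Fin n → Bool) → ℝ, OneTransit.IsStationary z₁ z₂ p →
      p = OneTransit.matrixMeasure z₁ z₂ := by
    intro n hn p hp
    obtain ⟨m, rfl⟩ : ∃ m, n = m + 1 := ⟨n - 1, by omega⟩
    exact OneTransit.eq_matrixMeasure hz₁ hz₂ hp
  refine ⟨fun n hn => ?_, fun P hP => ?_⟩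
  · obtain ⟨m, rfl⟩ : ∃ m, n = m + 1 := ⟨n - 1, by omega⟩
    exact ⟨_, OneTransit.isStationary_matrixMeasure hz₁ hz₂ m, fun p hp => huniq _ hn p hp⟩
  have hPn : ∀ n, 1 ≤ n → P n = OneTransit.matrixMeasure z₁ z₂ := fun n hn =>
    huniq n hn _ (hP n hn)
  obtain ⟨x, hx, -, hreg⟩ := OneTransit.exists_regular hz₁ hz₂
  have hJ := OneTransit.tendsto_J hz₁ hz₂ hx hreg
  refine ⟨fun n i hn hi => ?_, fun n i hi1 hi => ?_, fun y hy0 hy1 i hi => ?_, ?_, ?_, x,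
    1 / 2 * (1 + x * (1 / z₂ * OneTransit.bDens z₁ z₂ - 1 / z₁ * OneTransit.aDens z₁ z₂)),
    hx, hJ, ?_, fun hne y hy0 hy1 i hi => ?_, ?_⟩
  · rw [hPn n hn]
    exact OneTransit.bondCurrent_matrixMeasure hz₁ hz₂ hn hi
  · rw [hPn n (hi1.trans hi)]
    exact ⟨OneTransit.dens_matrixMeasure_right hz₁ hz₂ hi1 hi,
      OneTransit.dens_matrixMeasure_left hz₁ hz₂ hi1 hi,
      OneTransit.dens_matrixMeasure_symm hz₁ hz₂ hi1 hi⟩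
  · exact OneTransit.tendsto_signedSum hz₁ hz₂ hy0 hy1 hi
  · exact OneTransit.tendsto_avg_Icc (fun n => OneTransit.aExp_mem_Icc hz₁ hz₂ n 0)
      (OneTransit.tendsto_avg_aExp hz₁ hz₂)
  · refine OneTransit.tendsto_avg_Icc (fun n => ?_) (OneTransit.tendsto_avg_bExp hz₁ hz₂)
    rw [OneTransit.bExp_eq_aExp hz₁.ne' hz₂.ne' (Nat.zero_le n)]
    exact OneTransit.aExp_mem_Icc hz₂ hz₁ n _
  · refine (OneTransit.tendsto_avg_dens hz₁ hz₂ hJ).congr' ?_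
    filter_upwards [Filter.eventually_ge_atTop 1] with n hn
    rw [hPn n hn]
  · refine (OneTransit.tendsto_dens_bulk hz₁ hz₂ hne hJ hy0 hy1 hi).congr' ?_
    filter_upwards [Filter.eventually_ge_atTop 1] with n hn
    rw [hPn n hn]
  · field_simp
    ring
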